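/- All graphs are finite and simple. A graph is \emph{$2$-extendable} if every matching of at most two edges (including the empty matching) is contained in a perfect matching; a \emph{brace} is a $2$-extendable bipartite graph. A subgraph $K$ of a graph $G$ is \emph{central} if $G\setminus V(K)$ has a perfect matching (the null graph has one). An \emph{even subdivision} of a graph $H$ is a graph obtained from $H$ by replacing its edges by internally disjoint paths, each with an even number of vertices and at least one edge. A graph $G$ \emph{contains} a graph $H$ if some even subdivision of $H$ is isomorphic to a central subgraph of $G$. The \emph{Heawood graph} is the bipartite graph on the seven points and seven lines of the Fano plane in which a point is adjacent to a line if and only if they are incident. Theorem. Let $G$ be a connected brace that contains the Heawood graph and does not contain $K_{3,3}$. Then $G$ is isomorphic to the Heawood graph. -/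

import Mathlib

/-- A graph is `k`-extendable if every matching with at most `k` edges
extends to a perfect matching. -/
def SimpleGraph.IsExtendable {V : Type*} (G : SimpleGraph V) (k : ℕ) : Prop :=
  ∀ M : G.Subgraph, M.IsMatching → M.edgeSet.encard ≤ k →
    ∃ N : G.Subgraph, N.IsPerfectMatching ∧ M ≤ N

/-- A brace is a 2-extendable bipartite graph. -/
def SimpleGraph.IsBrace {V : Type*} (G : SimpleGraph V) : Prop :=
  G.IsBipartite ∧ G.IsExtendable 2

/-- A subgraph `K` of `G` is central if deleting the vertices of `K` from `G`
leaves a graph with a perfect matching (the null graph has one). -/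
def SimpleGraph.Subgraph.IsCentral {V : Type*} {G : SimpleGraph V} (K : G.Subgraph) : Prop :=
  ∃ M : (G.induce (K.vertsᶜ)).Subgraph, M.IsPerfectMatching

/-- `K` is (up to isomorphism) an even subdivision of `H`: it is obtained from `H` by replacing
the edges by internally disjoint paths, each with an odd number of edges, that is, with an even
number of vertices and at least one edge. The map `f` sends the vertices of `H` to the
corresponding vertices of `K`, and `P u v h` is the path that replaces the edge `uv`, traversed
from `f u` to `f v`. -/
structure SimpleGraph.EvenSubdivision {W U : Type*} (H : SimpleGraph W) (K : SimpleGraph U) where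
  f : W → U
  P : ∀ u v : W, H.Adj u v → K.Walk (f u) (f v)
  f_injective : Function.Injective f
  P_symm : ∀ (u v : W) (h : H.Adj u v), P v u h.symm = (P u v h).reverse
  isPath : ∀ (u v : W) (h : H.Adj u v), (P u v h).IsPath
  odd_length : ∀ (u v : W) (h : H.Adj u v), Odd (P u v h).length
  /-- A vertex of `H` lies on the path of an edge only as an end of that edge. -/
  end_of_mem : ∀ (u v : W) (h : H.Adj u v) (w : W), f w ∈ (P u v h).support → w = u ∨ w = v
  /-- The paths of distinct edges meet only in common ends. -/
  disjoint : ∀ (u v : W) (h : H.Adj u v) (u' v' : W) (h' : H.Adj u' v'), s(u, v) ≠ s(u', v') →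
    ∀ x : U, x ∈ (P u v h).support → x ∈ (P u' v' h').support →
      ∃ w : W, x = f w ∧ (w = u ∨ w = v) ∧ (w = u' ∨ w = v')
  /-- `K` has no other vertices. -/
  verts_cover : ∀ x : U, (∃ w : W, f w = x) ∨
    ∃ (u v : W) (h : H.Adj u v), x ∈ (P u v h).support
  /-- `K` has no other edges. -/
  edges_cover : ∀ e ∈ K.edgeSet, ∃ (u v : W) (h : H.Adj u v), e ∈ (P u v h).edges

/-- `G` contains `H` if some even subdivision of `H` is isomorphic to a central
subgraph of `G`. -/
def SimpleGraph.ContainsEvenly {V W : Type*} (G : SimpleGraph V) (H : SimpleGraph W) : Prop :=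
  ∃ K : G.Subgraph, K.IsCentral ∧ Nonempty (SimpleGraph.EvenSubdivision H K.coe)

/-- The bipartite graph associated with a matrix: its vertices are the rows and the columns, and
a row is adjacent to a column exactly if the corresponding entry is nonzero. -/
def Matrix.associatedGraph {m n : Type*} (A : Matrix m n ℕ) : SimpleGraph (m ⊕ n) where
  Adj
    | Sum.inl i, Sum.inr j => A i j ≠ 0
    | Sum.inr j, Sum.inl i => A i j ≠ 0
    | _, _ => False
  symm := ⟨by rintro (i | i) (j | j) h <;> exact h⟩
  loopless := ⟨by rintro (i | i) h <;> exact h⟩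

/-- The 0-1 incidence matrix of the Fano plane: the points are the integers modulo 7, and the
seven lines are the translates `{l, l + 1, l + 3}` of `{0, 1, 3}`. Rows are points,
columns are lines. -/
def fanoIncidenceMatrix : Matrix (ZMod 7) (ZMod 7) ℕ :=
  fun p l => if p = l ∨ p = l + 1 ∨ p = l + 3 then 1 else 0

/-- The Heawood graph. -/
def heawoodGraph : SimpleGraph (ZMod 7 ⊕ ZMod 7) :=
  fanoIncidenceMatrix.associatedGraph

/-! The proof is an ear-by-ear growth argument inside `G`, driven by two facts: the Heawood graph
plus a missing point-line edge produces `K₃,₃`, and a brace has no nontrivial tight cut.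

The basic object is an alternating tree of colour `s`, in which every vertex of the other colour has
degree two. Deleting any vertex of colour `s` leaves a set that can be paired
(`AltTree.paired_erase`), so such a tree behaves like a single vertex of colour `s`. Replacing the
vertices of a graph `J` by disjoint alternating trees gives a `TreeModel` of `J`. Models compose
(`TreeModel.trans`), and since `K₃,₃` is cubic, a model of it contains an even subdivision of it
(`TreeModel.containsEvenly`). A finite check, `exists_treeModel_heawoodGraph_sup_edge`, shows that
the Heawood graph plus an edge has a model of `K₃,₃`. Hence an ear joining the trees of nonadjacent
vertices of different colours in a Heawood model yields `K₃,₃` (`TreeModel.containsEvenly_of_ear`).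
Of an ear, only what is used is recorded: its interior forms an alternating tree with either end,
for opposite colours.

A central even subdivision of the Heawood graph gives a `TightPartition`: a matching covered
subgraph `E` on `U`, whose complement can be paired, with classes that have one extra vertex in
their main colour and that contract to the Heawood graph. Strict Hall conditions make each class
spanned by an alternating tree, so the partition is also a model. In a maximal such pair `(U, E)`
every available ear is already present, by `TightPartition.exists_add_ear`. If both ends of an ear
have the main colour of their classes, then the ear either fits or creates `K₃,₃`. An end `b` of the
minority colour in the class of `q` is treated by `TightPartition.move_or_treeModel`: either a piece
of the class containing `b` moves to the class of a prescribed neighbour `v₁` of `q`, where `b` has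
the main colour, or the tree of `q` splits at `b` and `b` can be put into the tree of another
neighbour. Since two vertices of the same kind have exactly one common neighbour if distinct, `v₁`
can be chosen so that the second outcome makes the ear join nonadjacent vertices.

A connected brace always offers an ear outside a proper `U` (`IsExtendable.exists_ear`), so the
maximal pair is all of `G`. Two disjoint edges leaving a class would extend to a perfect matching,
which a class with a minority vertex cannot afford (`TightPartition.filter_eq_empty`). So all
classes are singletons and the contraction map is an isomorphism. -/

namespace SimpleGraph

open Finset

variable {V : Type*} [DecidableEq V] {G : SimpleGraph V} {col : V → Bool}

/-! ### Pairings, alternating trees and ears -/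

/-- The vertex set `R` can be partitioned into pairs of adjacent vertices. -/
inductive Paired (G : SimpleGraph V) : Finset V → Prop
  | empty : Paired G ∅
  | cons {R : Finset V} {x y : V} : Paired G R → G.Adj x y → x ∉ R → y ∉ R →
      Paired G (insert x (insert y R))

/-- `T` is the vertex set of a tree of `G` whose vertices of colour `s` include all leaves and
whose other vertices have degree two. -/
inductive AltTree (G : SimpleGraph V) (col : V → Bool) (s : Bool) : Finset V → Prop
  | single {x : V} : col x = s → AltTree G col s {x}
  | step {T : Finset V} {x y z : V} : AltTree G col s T → x ∈ T → col x = s → G.Adj x y →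
      G.Adj y z → y ∉ T → z ∉ T → AltTree G col s (insert y (insert z T))

/-- `S` is the set of interior vertices of an odd path from `a` to `b`. -/
structure Ear (G : SimpleGraph V) (col : V → Bool) (s : Bool) (a b : V) (S : Finset V) :
    Prop where
  left_col : col a = s
  right_col : col b = !s
  left_notMem : a ∉ S
  right_notMem : b ∉ S
  left_tree : AltTree G col s (insert a S)
  right_tree : AltTree G col (!s) (insert b S)
  right_adj : ∃ z ∈ insert a S, col z = s ∧ G.Adj z b
  left_adj : ∃ y ∈ insert b S, col y = !s ∧ G.Adj y a

theorem Paired.union {R S : Finset V} (hR : G.Paired R) (hS : G.Paired S) (h : Disjoint R S) :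
    G.Paired (R ∪ S) := by
  induction hR with
  | empty => simpa using hS
  | @cons R x y _ hxy hx hy ih =>
    simp only [Finset.disjoint_insert_left] at h
    rw [Finset.insert_union, Finset.insert_union]
    exact (ih h.2.2).cons hxy (by simp [hx, h.1]) (by simp [hy, h.2.1])

theorem Paired.pair {x y : V} (h : G.Adj x y) : G.Paired {x, y} := by
  simpa using (Paired.empty (G := G)).cons h (by simp) (by simp)

theorem Paired.biUnion {ι : Type*} [DecidableEq ι] (I : Finset ι) (f : ι → Finset V)
    (h : ∀ i ∈ I, G.Paired (f i)) (hd : (I : Set ι).PairwiseDisjoint f) :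
    G.Paired (I.biUnion f) := by
  induction I using Finset.induction_on with
  | empty => simpa using Paired.empty
  | insert i I hi ih =>
    rw [Finset.biUnion_insert]
    refine (h i (by simp)).union (ih (fun j hj => h j (by simp [hj])) (hd.subset (by simp))) ?_
    rw [Finset.disjoint_biUnion_right]
    intro j hj
    exact hd (by simp) (by simp [hj]) (by rintro rfl; exact hi hj)

/-- Root the tree at `p`: each vertex of degree two has exactly one child, and pairing it with that
child uses every vertex but the root. -/
theorem AltTree.paired_erase (hcol : ∀ ⦃x y⦄, G.Adj x y → col y = !col x) {s : Bool}
    {T : Finset V} (h : G.AltTree col s T) {p : V} (hp : p ∈ T) (hps : col p = s) :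
    G.Paired (T.erase p) := by
  induction h generalizing p with
  | single h =>
    obtain rfl : p = _ := by simpa using hp
    simpa using Paired.empty
  | @step T x y z _ hx hxs hxy hyz hy hz ih =>
    have hcy : col y = !s := by rw [hcol hxy, hxs]
    have hcz : col z = s := by rw [hcol hyz, hcy, Bool.not_not]
    have hyp : y ≠ p := by rintro rfl; rw [hcy] at hps; simp at hps
    have hzy : z ≠ y := hyz.ne'
    by_cases hpz : p = z
    · subst hpz
      have := (ih hx hxs).cons hxy (by simp) (by simp [hy])
      convert this using 1
      ext w
      simp only [mem_erase, mem_insert]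
      constructor
      · rintro ⟨h1, rfl | h2 | h2⟩
        · simp
        · exact absurd h2 h1
        · by_cases hw : w = x <;> simp [hw, h2]
      · rintro (rfl | rfl | ⟨h1, h2⟩)
        · exact ⟨fun h => hz (h ▸ hx), by simp [hx]⟩
        · exact ⟨hyp, by simp⟩
        · exact ⟨fun h => hz (h ▸ h2), by simp [h2]⟩
    · have hpT : p ∈ T := by
        simp only [mem_insert] at hp
        rcases hp with rfl | rfl | h
        · exact absurd rfl hyp
        · exact absurd rfl hpz
        · exact h
      have := (ih hpT hps).cons hyz (by simp [hy]) (by simp [hz])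
      rwa [Finset.erase_insert_of_ne hyp, Finset.erase_insert_of_ne (Ne.symm hpz)]

/-- Every step adds one vertex of each colour. This surplus of one is what makes the cut around the
tree tight. -/
theorem AltTree.card (hcol : ∀ ⦃x y⦄, G.Adj x y → col y = !col x) {s : Bool}
    {T : Finset V} (h : G.AltTree col s T) :
    (T.filter fun x => col x = s).card = (T.filter fun x => col x = !s).card + 1 := by
  induction h with
  | @single x h => simp [Finset.filter_singleton, h]
  | @step T x y z _ hx hxs hxy hyz hy hz ih =>
    have hcy : col y = !s := by rw [hcol hxy, hxs]
    have hcz : col z = s := by rw [hcol hyz, hcy, Bool.not_not]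
    simp [Finset.filter_insert, hcy, hcz, hy, hz, ih]

/-- In an alternating tree, every nonempty set of vertices of degree two has more neighbours
than elements. -/
theorem AltTree.card_lt_card_neighbors (hcol : ∀ ⦃x y⦄, G.Adj x y → col y = !col x) {s : Bool}
    {T : Finset V} (h : G.AltTree col s T) {X : Finset V} (hX : X ⊆ T) (hXs : ∀ x ∈ X, col x = !s)
    (hne : X.Nonempty) {N : Finset V} (hN : ∀ y ∈ X, ∀ x ∈ T, G.Adj y x → x ∈ N) :
    X.card < (N ∩ T).card := by
  induction h generalizing X with
  | single h =>
    obtain ⟨x, hx⟩ := hne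
    have := hXs x hx
    have h2 := hX hx
    simp only [mem_singleton] at h2
    rw [h2, h] at this
    simp at this
  | @step T x y z _ hx hxs hxy hyz hy hz ih =>
    have hcy : col y = !s := by rw [hcol hxy, hxs]
    have hcz : col z = s := by rw [hcol hyz, hcy, Bool.not_not]
    have hzX : z ∉ X := fun h => by have := hXs z h; rw [hcz] at this; simp at this
    by_cases hyX : y ∈ X
    -- If `y` lies in `X`, the new neighbour `z` pays for it. When `y` is the only element, its
    -- other neighbour `x` supplies the strict excess.
    · have hzN : z ∈ N := hN y hyX z (by simp) hyz
      have hxN : x ∈ N := hN y hyX x (by simp [hx]) hxy.symm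
      have h1 : X.card = (X.erase y).card + 1 := (Finset.card_erase_add_one hyX).symm
      have hsub : insert z (N ∩ T) ⊆ N ∩ insert y (insert z T) := by
        intro w hw
        simp only [mem_insert, mem_inter] at hw ⊢
        rcases hw with rfl | ⟨h1, h2⟩ <;> simp_all
      have h2 := Finset.card_le_card hsub
      rw [Finset.card_insert_of_notMem (by simp [hz])] at h2
      by_cases he : (X.erase y).Nonempty
      · have := ih (X := X.erase y) (by
          intro w hw
          have := hX (mem_of_mem_erase hw)
          simp only [mem_insert] at this
          rcases this with rfl | rfl | h
          · simp at hw
          · exact absurd (mem_of_mem_erase hw) hzX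
          · exact h) (fun w hw => hXs w (mem_of_mem_erase hw)) he
          (fun w hw v hv hwv => hN w (mem_of_mem_erase hw) v (by simp [hv]) hwv)
        omega
      · rw [Finset.not_nonempty_iff_eq_empty] at he
        rw [he] at h1
        have : 0 < (N ∩ T).card := Finset.card_pos.2 ⟨x, by simp [hx, hxN]⟩
        simp at h1
        omega
    · have := ih (X := X) (by
        intro w hw
        have := hX hw
        simp only [mem_insert] at this
        rcases this with rfl | rfl | h
        · exact absurd hw hyX
        · exact absurd hw hzX
        · exact h) hXs hne (fun w hw v hv hwv => hN w hw v (by simp [hv]) hwv)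
      refine this.trans_le (Finset.card_le_card ?_)
      intro w hw
      simp only [mem_insert, mem_inter] at hw ⊢
      exact ⟨hw.1, .inr (.inr hw.2)⟩

/-- Two alternating trees that share exactly one vertex, a potential leaf, can be merged. -/
theorem AltTree.union (hcol : ∀ ⦃x y⦄, G.Adj x y → col y = !col x) {s : Bool}
    {T U : Finset V} (hT : G.AltTree col s T) (hU : G.AltTree col s U) {p : V} (hps : col p = s)
    (hpT : p ∈ T) (hpU : p ∈ U) (h : ∀ w ∈ T, w ∈ U → w = p) : G.AltTree col s (T ∪ U) := by
  induction hU generalizing T p with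
  | @single x hx =>
    obtain rfl : p = x := by simpa using hpU
    rwa [Finset.union_eq_left.2 (by simpa using hpT)]
  | @step U x y z _ hx hxs hxy hyz hy hz ih =>
    have hcy : col y = !s := by rw [hcol hxy, hxs]
    have hcz : col z = s := by rw [hcol hyz, hcy, Bool.not_not]
    have hyp : y ≠ p := by rintro rfl; rw [hcy] at hps; simp at hps
    have hyT : y ∉ T := fun h' => hyp (h y h' (by simp))
    by_cases hpz : p = z
    · subst hpz
      have hxT : x ∉ T := fun h' => hz ((h x h' (by simp [hx])) ▸ hx)
      -- The shared vertex is the last leaf of the second tree. Its final step is reversed: `y` and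
      -- `x` are hung on `T` at the shared vertex, and what remains is a union along `x`.
      have h1 := hT.step hpT hps hyz.symm hxy.symm hyT hxT
      have h2 := ih h1 hxs (by simp) hx (by
        intro w hw hwU
        simp only [mem_insert] at hw
        rcases hw with rfl | rfl | hw
        · exact absurd hwU hy
        · rfl
        · exact absurd ((h w hw (by simp [hwU])) ▸ hwU) hz)
      convert h2 using 1
      ext w
      simp only [mem_union, mem_insert]
      constructor
      · rintro (h | rfl | rfl | h) <;> simp_all
      · rintro ((rfl | rfl | h) | h) <;> simp_all
    · have hpU' : p ∈ U := by
        simp only [mem_insert] at hpU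
        rcases hpU with rfl | rfl | h
        · exact absurd rfl hyp
        · exact absurd rfl hpz
        · exact h
      have hzT : z ∉ T := fun h' => hpz (h z h' (by simp)).symm
      have h2 := (ih hT hps hpT hpU' (fun w hw hwU => h w hw (by simp [hwU]))).step
        (mem_union_right _ hx) hxs hxy hyz (by simp [hy, hyT]) (by simp [hz, hzT])
      convert h2 using 1
      ext w
      simp only [mem_union, mem_insert]
      tauto

theorem Ear.symm {s : Bool} {a b : V} {S : Finset V} (h : G.Ear col s a b S) :
    G.Ear col (!s) b a S where
  left_col := h.right_col
  right_col := by rw [h.left_col, Bool.not_not]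
  left_notMem := h.right_notMem
  right_notMem := h.left_notMem
  left_tree := h.right_tree
  right_tree := by rw [Bool.not_not]; exact h.left_tree
  right_adj := h.left_adj
  left_adj := by rw [Bool.not_not]; exact h.right_adj

theorem Ear.of_adj (hcol : ∀ ⦃x y⦄, G.Adj x y → col y = !col x) {s : Bool} {a b : V}
    (has : col a = s) (h : G.Adj a b) : G.Ear col s a b ∅ where
  left_col := has
  right_col := by rw [hcol h, has]
  left_notMem := by simp
  right_notMem := by simp
  left_tree := by simpa using AltTree.single has
  right_tree := by simpa using AltTree.single (by rw [hcol h, has])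
  right_adj := ⟨a, by simp, has, h⟩
  left_adj := ⟨b, by simp, by rw [hcol h, has], h.symm⟩

/-- The left tree grows by `b` and `z`. For the right one, the path `c, z, b` is itself an
alternating tree, and it meets the old right tree only in `b`. -/
theorem Ear.snoc (hcol : ∀ ⦃x y⦄, G.Adj x y → col y = !col x) {s : Bool} {a b z c : V}
    {S : Finset V} (h : G.Ear col s a b S) (hbz : G.Adj b z) (hzc : G.Adj z c)
    (hab : b ≠ a) (haz : z ≠ a) (hac : c ≠ a) (hbc : c ≠ b) (hz : z ∉ S) (hc : c ∉ S) :
    G.Ear col s a c (insert b (insert z S)) := by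
  have hcz : col z = s := by rw [hcol hbz, h.right_col, Bool.not_not]
  have hcc : col c = !s := by rw [hcol hzc, hcz]
  obtain ⟨z0, hz0, hz0s, hz0b⟩ := h.right_adj
  obtain ⟨y0, hy0, hy0s, hy0a⟩ := h.left_adj
  have hbS := h.right_notMem
  have haS := h.left_notMem
  refine ⟨h.left_col, hcc, by simp [hab.symm, haz.symm, haS], by simp [hbc, hzc.ne', hc], ?_, ?_,
    ⟨z, by simp, hcz, hzc⟩, ⟨y0, ?_, hy0s, hy0a⟩⟩
  · have := h.left_tree.step hz0 hz0s hz0b hbz (by simp [hab, hbS]) (by simp [haz, hz])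
    convert this using 1
    ext w; simp only [mem_insert]; tauto
  · have h1 : G.AltTree col (!s) {c} := .single hcc
    have h2 := h1.step (by simp) hcc hzc.symm hbz.symm (by simp [hzc.ne]) (by simp [hbc.symm])
    have h3 := h2.union hcol h.right_tree (p := b) h.right_col (by simp) (by simp) (by
      intro w hw hw'
      simp only [mem_insert, mem_singleton] at hw hw'
      rcases hw with rfl | rfl | rfl
      · rcases hw' with rfl | h
        · rfl
        · exact absurd h hz
      · rfl
      · rcases hw' with rfl | h
        · rfl
        · exact absurd h hc)
    convert h3 using 1
    ext w; simp only [mem_insert, mem_union, mem_singleton]; tauto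
  · simp only [mem_insert] at hy0 ⊢; tauto

/-- Any two potential leaves `x` and `c` of an alternating tree are joined by a path of the tree
whose complement in the tree can be paired up; extended by an edge `cb` it becomes an ear. -/
theorem AltTree.exists_ear (hcol : ∀ ⦃x y⦄, G.Adj x y → col y = !col x) {s : Bool}
    {T : Finset V} (h : G.AltTree col s T) {x c b : V} (hx : x ∈ T) (hxs : col x = s)
    (hc : c ∈ T) (hcs : col c = s) (hb : b ∉ T) (hcb : G.Adj c b) :
    ∃ S ⊆ T, G.Ear col s x b S ∧ c ∈ insert x S ∧ G.Paired (T \ insert x S) := by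
  induction h generalizing x c b with
  | @single w hw =>
    obtain rfl : x = w := by simpa using hx
    obtain rfl : c = x := by simpa using hc
    exact ⟨∅, by simp, Ear.of_adj hcol hxs hcb, by simp, by simpa using Paired.empty⟩
  | @step T x0 y z hT hx0 hx0s hxy hyz hy hz ih =>
    have hcy : col y = !s := by rw [hcol hxy, hx0s]
    have hcz : col z = s := by rw [hcol hyz, hcy, Bool.not_not]
    have key : ∀ w ∈ insert y (insert z T), col w = s → w = z ∨ w ∈ T := by
      intro w hw hws
      simp only [mem_insert] at hw
      rcases hw with rfl | hw
      · rw [hcy] at hws; simp at hws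
      · exact hw
    simp only [mem_insert, not_or] at hb
    have hzx : ∀ w ∈ T, z ≠ w := fun w hw h => hz (h ▸ hw)
    have hyx : ∀ w ∈ T, y ≠ w := fun w hw h => hy (h ▸ hw)
    rcases key x hx hxs with rfl | hxT <;> rcases key c hc hcs with rfl | hcT
    · refine ⟨∅, by simp, Ear.of_adj hcol hxs hcb, by simp, ?_⟩
      have h1 := (hT.paired_erase hcol hx0 hx0s).cons hxy (by simp) (by simp [hy])
      convert h1 using 1
      ext w
      simp only [mem_erase, mem_insert, mem_sdiff, notMem_empty, or_false]
      constructor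
      · rintro ⟨rfl | rfl | h, h'⟩
        · simp
        · exact absurd rfl h'
        · by_cases hw : w = x0 <;> simp [hw, h]
      · rintro (rfl | rfl | ⟨h, h'⟩)
        · exact ⟨by simp [hx0], (hzx _ hx0).symm⟩
        · exact ⟨by simp, hyz.ne⟩
        · exact ⟨by simp [h'], (hzx _ h').symm⟩
    -- Only `x` is new: an ear from `x0` in the old tree is prolonged backwards through `y`, which
    -- is why it is reversed around `snoc`.
    · obtain ⟨S, hS, hE, hcS, hP⟩ := ih hx0 hx0s hcT hcs hb.2.2 hcb
      have hyS : y ∉ S := fun h => hy (hS h)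
      have hzS : x ∉ S := fun h => hz (hS h)
      have := (hE.symm.snoc hcol hxy hyz (fun h => hb.2.2 (h ▸ hx0)) (Ne.symm hb.1) (Ne.symm hb.2.1)
        (hzx _ hx0) hyS hzS).symm
      rw [Bool.not_not] at this
      refine ⟨_, ?_, this, ?_, ?_⟩
      · intro w hw
        simp only [mem_insert] at hw ⊢
        rcases hw with rfl | rfl | h
        · simp [hx0]
        · simp
        · simp [hS h]
      · simp only [mem_insert] at hcS ⊢; tauto
      · convert hP using 1
        ext w
        simp only [mem_insert, mem_sdiff]
        constructor
        · rintro ⟨h1, h2⟩; tauto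
        · rintro ⟨h1, h2⟩
          have := hzx w h1
          have := hyx w h1
          refine ⟨by simp [h1], ?_⟩
          rintro (h | h | h | h) <;> simp_all
    -- Only `c` is new: the induction hypothesis is used with `y` as the outside end, and the ear
    -- then continues through `c` to `b`.
    · obtain ⟨S, hS, hE, hcS, hP⟩ := ih hxT hxs hx0 hx0s hy hxy
      have hyS : y ∉ S := fun h => hy (hS h)
      have hzS : c ∉ S := fun h => hz (hS h)
      have := hE.snoc hcol hyz hcb (hyx _ hxT) (hzx _ hxT) (fun h => hb.2.2 (h ▸ hxT)) hb.1 hzS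
        (fun h => hb.2.2 (hS h))
      refine ⟨_, ?_, this, by simp, ?_⟩
      · intro w hw
        simp only [mem_insert] at hw ⊢
        rcases hw with rfl | rfl | h
        · simp
        · simp
        · simp [hS h]
      · convert hP using 1
        ext w
        simp only [mem_insert, mem_sdiff]
        constructor
        · rintro ⟨h1, h2⟩; tauto
        · rintro ⟨h1, h2⟩
          have := hzx w h1
          have := hyx w h1
          refine ⟨by simp [h1], ?_⟩
          rintro (h | h | h | h) <;> simp_all
    · obtain ⟨S, hS, hE, hcS, hP⟩ := ih hxT hxs hcT hcs hb.2.2 hcb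
      refine ⟨S, hS.trans (by intro w hw; simp [hw]), hE, hcS, ?_⟩
      have := hP.cons hyz (by simp [hy]) (by simp [hz])
      convert this using 1
      ext w
      simp only [mem_insert, mem_sdiff]
      have h1 : y ∉ insert x S := by
        simp only [mem_insert, not_or]; exact ⟨hyx _ hxT, fun h => hy (hS h)⟩
      have h2 : z ∉ insert x S := by
        simp only [mem_insert, not_or]; exact ⟨hzx _ hxT, fun h => hz (hS h)⟩
      simp only [mem_insert] at h1 h2
      constructor
      · rintro ⟨h3, h4⟩; tauto
      · rintro (rfl | rfl | ⟨h3, h4⟩)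
        · exact ⟨by simp, h1⟩
        · exact ⟨by simp, h2⟩
        · exact ⟨by simp [h3], h4⟩

/-- An alternating tree can be extended along a path that is attached to it by an edge. -/
theorem AltTree.attach (hcol : ∀ ⦃x y⦄, G.Adj x y → col y = !col x) {s : Bool}
    {T : Finset V} (h : G.AltTree col s T) {x y z : V} {S : Finset V} (hx : x ∈ T)
    (hxs : col x = s) (hxy : G.Adj x y) (hS : G.Ear col (!s) y z S) (hyT : y ∉ T) (hzT : z ∉ T)
    (hd : Disjoint T S) : G.AltTree col s (T ∪ insert y (insert z S)) := by
  obtain ⟨w, hw, hws, hwy⟩ := hS.left_adj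
  rw [Bool.not_not] at hws
  have hyS := hS.left_notMem
  have hzS := hS.right_notMem
  have hyz : y ≠ z := by
    rintro rfl
    have h1 := hS.left_col
    rw [hS.right_col] at h1; simp at h1
  have hdw : ∀ v ∈ T, v ∉ S := fun v hv => Finset.disjoint_left.1 hd hv
  have hwT : w ∉ T := by
    simp only [mem_insert] at hw
    rcases hw with rfl | hw
    · exact hzT
    · exact fun h => hdw _ h hw
  -- `w` is a neighbour of `y` on the ear. Once `y` and `w` hang on `T`, the tree meets the right
  -- tree of the ear in `w` alone.
  have h1 := h.step hx hxs hxy hwy.symm hyT hwT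
  have ht := hS.right_tree
  rw [Bool.not_not] at ht
  have h2 := h1.union hcol ht hws (by simp) hw (by
    intro v hv hv'
    simp only [mem_insert] at hv hv'
    rcases hv with rfl | rfl | hv
    · rcases hv' with rfl | hv'
      · exact absurd rfl hyz
      · exact absurd hv' hyS
    · rfl
    · rcases hv' with rfl | hv'
      · exact absurd hv hzT
      · exact absurd hv' (hdw _ hv))
  convert h2 using 1
  ext v
  simp only [mem_union, mem_insert] at hw ⊢
  constructor
  · tauto
  · rintro ((rfl | rfl | h) | h) <;> tauto

end SimpleGraph

/-! ### Hall's theorem and spanning alternating trees -/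

namespace SimpleGraph

open Finset

variable {V : Type*} [DecidableEq V] {G : SimpleGraph V} {col : V → Bool}

theorem image_erase_of_injOn {f : V → V} {B : Finset V} (hf : Set.InjOn f B) {y : V}
    (hy : y ∈ B) : (B.erase y).image f = (B.image f).erase (f y) := by
  ext w
  simp only [mem_image, mem_erase]
  constructor
  · rintro ⟨v, ⟨hv, hvB⟩, rfl⟩
    exact ⟨fun h => hv (hf hvB hy h), v, hvB, rfl⟩
  · rintro ⟨h, v, hv, rfl⟩
    exact ⟨v, ⟨fun h' => h (h' ▸ rfl), hv⟩, rfl⟩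

open Classical in
/-- The vertices of `A` that have a neighbour in `X`. -/
noncomputable def neighborsIn (G : SimpleGraph V) (A X : Finset V) : Finset V :=
  A.filter fun x => ∃ y ∈ X, G.Adj y x

@[simp] theorem mem_neighborsIn {A X : Finset V} {x : V} :
    x ∈ G.neighborsIn A X ↔ x ∈ A ∧ ∃ y ∈ X, G.Adj y x := by
  simp [neighborsIn]

theorem neighborsIn_subset {A X : Finset V} : G.neighborsIn A X ⊆ A := by
  intro x hx; exact (mem_neighborsIn.1 hx).1

theorem AltTree.mono {G' : SimpleGraph V} (hG : G' ≤ G) {s : Bool} {T : Finset V}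
    (h : G'.AltTree col s T) : G.AltTree col s T := by
  induction h with
  | single h => exact .single h
  | step _ h1 h2 h3 h4 h5 h6 ih => exact ih.step h1 h2 (hG h3) (hG h4) h5 h6

/-- Hall's theorem for a set `B` of vertices that is to be matched into `A`. -/
theorem exists_injOn_adj {A B : Finset V}
    (h : ∀ X ⊆ B, X.card ≤ (G.neighborsIn A X).card) :
    ∃ f : V → V, Set.InjOn f B ∧ ∀ y ∈ B, f y ∈ A ∧ G.Adj y (f y) := by
  classical
  have := (Finset.all_card_le_biUnion_card_iff_exists_injective
    (fun y : B => G.neighborsIn A {y.1})).1 (by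
      intro X
      have h1 := h (X.map (Function.Embedding.subtype _)) (by
        intro x hx
        obtain ⟨y, _, rfl⟩ := Finset.mem_map.1 hx
        exact y.2)
      rw [Finset.card_map] at h1
      refine h1.trans (Finset.card_le_card ?_)
      intro x hx
      simp only [mem_neighborsIn, Finset.mem_map, Function.Embedding.subtype_apply] at hx
      obtain ⟨hxA, _, ⟨y, hy, rfl⟩, hadj⟩ := hx
      simp only [Finset.mem_biUnion, mem_neighborsIn]
      exact ⟨y, hy, hxA, y.1, by simp, hadj⟩)
  obtain ⟨f, hf, hfm⟩ := this
  refine ⟨fun y => if h : y ∈ B then f ⟨y, h⟩ else y, ?_, ?_⟩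
  · intro x hx y hy hxy
    simp only [Finset.mem_coe] at hx hy
    simp only [hx, hy, dif_pos] at hxy
    simpa using hf hxy
  · intro y hy
    simp only [hy, dif_pos]
    have := hfm ⟨y, hy⟩
    simp only [mem_neighborsIn, mem_singleton, exists_eq_left] at this
    exact this

/-- A greedy extension of an alternating tree by matched pairs. -/
theorem AltTree.grow (hcol : ∀ ⦃x y⦄, G.Adj x y → col y = !col x) {s : Bool}
    {C : Finset V} (hC : G.AltTree col s C) (Y : Finset V) (f : V → V)
    (hYs : ∀ y ∈ Y, col y = !s) (hYf : ∀ y ∈ Y, G.Adj y (f y)) (hf : Set.InjOn f Y)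
    (hYC : ∀ y ∈ Y, y ∉ C) (hfC : ∀ y ∈ Y, f y ∉ C) :
    ∃ Y' ⊆ Y, G.AltTree col s (C ∪ (Y' ∪ Y'.image f)) ∧
      ∀ y ∈ Y, y ∉ Y' → ∀ x ∈ C ∪ (Y' ∪ Y'.image f), ¬ G.Adj y x := by
  classical
  -- Take a largest set of pairs that can be absorbed: an omitted `y` with a neighbour in the tree
  -- could be hung on together with `f y`.
  obtain ⟨Y', hY', hmax⟩ := Finset.exists_max_image
    (Y.powerset.filter fun Y' => G.AltTree col s (C ∪ (Y' ∪ Y'.image f))) Finset.card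
    ⟨∅, by simpa using hC⟩
  simp only [Finset.mem_filter, Finset.mem_powerset] at hY' hmax
  refine ⟨Y', hY'.1, hY'.2, ?_⟩
  intro y hy hyY' x hx hadj
  have hxs : col x = s := by
    have := hcol hadj
    rw [hYs y hy, Bool.not_not] at this
    exact this
  have hfs : ∀ w ∈ Y, col (f w) = s := by
    intro w hw
    rw [hcol (hYf w hw), hYs w hw, Bool.not_not]
  have hne : ∀ u w, u ∈ Y → w ∈ Y → u ≠ f w := by
    rintro u w hu hw rfl
    have h1 := hYs _ hu
    rw [hfs w hw] at h1
    simp at h1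
  have h1 := hY'.2.step hx hxs hadj.symm (hYf y hy) (by
    simp only [mem_union, mem_image, not_or, not_exists, not_and]
    exact ⟨hYC y hy, hyY', fun w hw h => hne y w hy (hY'.1 hw) h.symm⟩) (by
    simp only [mem_union, mem_image, not_or, not_exists, not_and]
    refine ⟨hfC y hy, fun h => hne (f y) y (hY'.1 h) hy rfl, fun w hw h => ?_⟩
    exact hyY' ((hf (hY'.1 hw) hy h) ▸ hw))
  have h2 := hmax (insert y Y') ⟨by
    intro w hw
    rcases mem_insert.1 hw with rfl | hw
    · exact hy
    · exact hY'.1 hw, by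
    convert h1 using 1
    ext w
    simp only [mem_union, mem_insert, mem_image]
    constructor
    · rintro (h | (h | h) | ⟨v, rfl | hv, rfl⟩)
      · tauto
      · tauto
      · tauto
      · tauto
      · exact .inr (.inr (.inr (.inr ⟨v, hv, rfl⟩)))
    · rintro (h | h | h | h | ⟨v, hv, rfl⟩)
      · tauto
      · exact .inr (.inr ⟨y, .inl rfl, h.symm⟩)
      · tauto
      · tauto
      · exact .inr (.inr ⟨v, .inr hv, rfl⟩)⟩
  rw [Finset.card_insert_of_notMem hyY'] at h2
  omega

/-- The symmetric difference of two matchings of `B`, which miss `r, r'` and `a₁, a₂`, contains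
paths that join `r` and `r'` to `a₁` and `a₂`. -/
theorem exists_disjoint_altTree {s : Bool}
    (f₁ f₂ : V → V) {a₁ a₂ : V} (A B : Finset V) (r r' : V)
    (hA : ∀ x ∈ A, col x = s) (hB : ∀ y ∈ B, col y = !s)
    (hf₁ : Set.InjOn f₁ B) (hf₂ : Set.InjOn f₂ B) (hadj₁ : ∀ y ∈ B, G.Adj y (f₁ y))
    (hadj₂ : ∀ y ∈ B, G.Adj y (f₂ y)) (hr : r ∈ A) (hr' : r' ∈ A) (hrr : r ≠ r')
    (ha₁ : a₁ ∈ A) (ha₂ : a₂ ∈ A) (haa : a₁ ≠ a₂)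
    (him₁ : B.image f₁ = (A.erase r).erase r') (him₂ : B.image f₂ = (A.erase a₁).erase a₂) :
    ∃ C₁ C₂ : Finset V, C₁ ⊆ A ∪ B ∧ C₂ ⊆ A ∪ B ∧ r ∈ C₁ ∧ r' ∈ C₂ ∧ Disjoint C₁ C₂ ∧
      G.AltTree col s C₁ ∧ G.AltTree col s C₂ ∧
      (a₁ ∈ C₁ ∧ a₂ ∈ C₂ ∨ a₂ ∈ C₁ ∧ a₁ ∈ C₂) ∧
      ∀ y ∈ B, (y ∈ C₁ ↔ f₁ y ∈ C₁) ∧ (y ∈ C₂ ↔ f₁ y ∈ C₂) := by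
  induction hn : B.card generalizing A B r r' with
  | zero =>
    obtain rfl := Finset.card_eq_zero.1 hn
    have h1 : ∀ x ∈ A, x = r ∨ x = r' := by
      intro x hx
      by_contra h
      simp only [not_or] at h
      have : x ∈ (A.erase r).erase r' := by simp [h, hx]
      rw [← him₁] at this
      simp at this
    refine ⟨{r}, {r'}, by simpa using hr, by simpa using hr', by simp, by simp, by simpa using hrr,
      .single (hA _ hr), .single (hA _ hr'), ?_, by simp⟩
    have := h1 _ ha₁
    have := h1 _ ha₂
    simp only [mem_singleton]
    grind
  | succ n ih =>
    -- Trace the path from `r`: its `f₂`-partner `y` leads to `f₁ y`, which replaces `r` as the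
    -- uncovered vertex after `r` and `y` are deleted. The induction stops when `r` and `r'` are
    -- `a₁` and `a₂` in some order.
    have step : ∀ r r', r ∈ A → r' ∈ A → r ≠ r' → B.image f₁ = (A.erase r).erase r' →
        r ≠ a₁ → r ≠ a₂ → ∃ C₁ C₂ : Finset V, C₁ ⊆ A ∪ B ∧ C₂ ⊆ A ∪ B ∧ r ∈ C₁ ∧ r' ∈ C₂ ∧
        Disjoint C₁ C₂ ∧ G.AltTree col s C₁ ∧ G.AltTree col s C₂ ∧
        (a₁ ∈ C₁ ∧ a₂ ∈ C₂ ∨ a₂ ∈ C₁ ∧ a₁ ∈ C₂) ∧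
        ∀ y ∈ B, (y ∈ C₁ ↔ f₁ y ∈ C₁) ∧ (y ∈ C₂ ↔ f₁ y ∈ C₂) := by
      intro r r' hr hr' hrr him₁ hra₁ hra₂
      have : r ∈ B.image f₂ := by rw [him₂]; simp [hr, hra₁, hra₂]
      obtain ⟨y, hy, hyr⟩ := mem_image.1 this
      have hz : f₁ y ∈ (A.erase r).erase r' := him₁ ▸ mem_image_of_mem f₁ hy
      simp only [mem_erase] at hz
      have hAB : ∀ x ∈ A, x ∉ B := by
        intro x hx hx'
        have := hA x hx
        rw [hB x hx'] at this
        simp at this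
      obtain ⟨C₁, C₂, hC₁, hC₂, hz₁, hr₂, hd, ht₁, ht₂, ha, hcl⟩ := ih (A.erase r) (B.erase y)
        (f₁ y) r' (fun x hx => hA x (mem_of_mem_erase hx)) (fun x hx => hB x (mem_of_mem_erase hx))
        (hf₁.mono (by simp)) (hf₂.mono (by simp))
        (fun x hx => hadj₁ x (mem_of_mem_erase hx)) (fun x hx => hadj₂ x (mem_of_mem_erase hx))
        (by simp [hz]) (by simp [hr', hrr.symm]) hz.1 (by simp [ha₁, hra₁.symm])
        (by simp [ha₂, hra₂.symm]) (by
          rw [image_erase_of_injOn hf₁ hy, him₁]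
          ext w; simp only [mem_erase]; tauto) (by
          rw [image_erase_of_injOn hf₂ hy, him₂, hyr]
          ext w; simp only [mem_erase]; tauto) (by
          rw [Finset.card_erase_of_mem hy, hn]; rfl)
      have hyA : y ∉ A := fun h => hAB y h hy
      have hyC : ∀ C ⊆ A.erase r ∪ B.erase y, y ∉ C := fun C hC h => by
        have := hC h; simp [hyA] at this
      have hrC : ∀ C ⊆ A.erase r ∪ B.erase y, r ∉ C := fun C hC h => by
        have := hC h; simp [hAB r hr] at this
      have hsub : A.erase r ∪ B.erase y ⊆ A ∪ B := by
        intro w; simp only [mem_union, mem_erase]; tauto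
      refine ⟨insert y (insert r C₁), C₂, ?_, hC₂.trans hsub, by simp, hr₂, ?_,
        ht₁.step hz₁ (hA _ hz.2.2) (hadj₁ y hy).symm (hyr ▸ hadj₂ y hy) (hyC _ hC₁) (hrC _ hC₁),
        ht₂, ?_, ?_⟩
      · intro w hw
        simp only [mem_insert] at hw
        rcases hw with rfl | rfl | hw
        · simp [hy]
        · simp [hr]
        · exact hsub (hC₁ hw)
      · simp only [Finset.disjoint_insert_left]
        exact ⟨hyC _ hC₂, hrC _ hC₂, hd⟩
      · simp only [mem_insert]; tauto
      · intro w hw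
        by_cases hwy : w = y
        · subst hwy
          refine ⟨by simp [hz₁], iff_of_false (hyC _ hC₂) ?_⟩
          exact fun h => Finset.disjoint_left.1 hd hz₁ h
        · have h1 := hcl w (by simp [hwy, hw])
          refine ⟨?_, h1.2⟩
          have h2 : f₁ w ∈ (A.erase r).erase r' := him₁ ▸ mem_image_of_mem f₁ hw
          simp only [mem_erase] at h2
          have h3 : w ≠ r := fun h => hAB r hr (h ▸ hw)
          have h4 : f₁ w ≠ y := fun h => hyA (h ▸ h2.2.2)
          simp only [mem_insert, hwy, h3, h4, h2.2.1, false_or]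
          exact h1.1
    by_cases h : r ≠ a₁ ∧ r ≠ a₂
    · exact step r r' hr hr' hrr him₁ h.1 h.2
    by_cases h' : r' ≠ a₁ ∧ r' ≠ a₂
    · obtain ⟨C₁, C₂, h1, h2, h3, h4, h5, h6, h7, h8, h9⟩ := step r' r hr' hr hrr.symm
        (him₁.trans (by ext w; simp only [mem_erase]; tauto)) h'.1 h'.2
      exact ⟨C₂, C₁, h2, h1, h4, h3, h5.symm, h7, h6, by tauto, fun y hy => (h9 y hy).symm⟩
    refine ⟨{r}, {r'}, by simp [hr], by simp [hr'], by simp, by simp,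
      by simpa using hrr, .single (hA _ hr), .single (hA _ hr'), ?_, ?_⟩
    · simp only [mem_singleton]
      grind
    · intro y hy
      have h2 : f₁ y ∈ (A.erase r).erase r' := him₁ ▸ mem_image_of_mem f₁ hy
      simp only [mem_erase] at h2
      have hyA : y ∉ A := by
        intro h
        have := hA y h
        rw [hB y hy] at this
        simp at this
      simp only [mem_singleton, h2.2.1, h2.1, iff_false]
      exact ⟨fun h => hyA (h ▸ hr), fun h => hyA (h ▸ hr')⟩

/-- A bipartite graph with sides `A` and `B` in which every nonempty subset of `B` has more
neighbours than elements, and which has `|B| + 1` vertices in `A`, is spanned by an alternating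
tree. -/
theorem AltTree.of_card_lt (hcol : ∀ ⦃x y⦄, G.Adj x y → col y = !col x) {s : Bool}
    {A B : Finset V} (hA : ∀ x ∈ A, col x = s) (hB : ∀ y ∈ B, col y = !s)
    (hcard : A.card = B.card + 1)
    (hall : ∀ X ⊆ B, X.Nonempty → X.card < (G.neighborsIn A X).card) :
    G.AltTree col s (A ∪ B) := by
  obtain ⟨r, hr⟩ : A.Nonempty := Finset.card_pos.1 (by omega)
  obtain ⟨f, hf, hfA⟩ := exists_injOn_adj (G := G) (A := A.erase r) (B := B) (by
    intro X hX
    rcases X.eq_empty_or_nonempty with rfl | hne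
    · simp
    have h1 := hall X hX hne
    have h2 : (G.neighborsIn A X).erase r ⊆ G.neighborsIn (A.erase r) X := by
      intro w; simp only [mem_erase, mem_neighborsIn]; tauto
    have h3 := Finset.card_le_card h2
    have h4 := Finset.pred_card_le_card_erase (s := G.neighborsIn A X) (a := r)
    omega)
  have him : B.image f = A.erase r := by
    refine Finset.eq_of_subset_of_card_le ?_ ?_
    · intro w hw
      obtain ⟨y, hy, rfl⟩ := mem_image.1 hw
      exact (hfA y hy).1
    · rw [Finset.card_image_of_injOn hf, Finset.card_erase_of_mem hr]; omega
  have hAB : ∀ x ∈ A, x ∉ B := by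
    intro x hx hx'
    have := hA x hx
    rw [hB x hx'] at this
    simp at this
  obtain ⟨Y, hY, hT, hst⟩ := (AltTree.single (G := G) (hA r hr)).grow hcol B f hB
    (fun y hy => (hfA y hy).2) hf (fun y hy h => hAB r hr ((mem_singleton.1 h) ▸ hy)) (by
      intro y hy
      have := (hfA y hy).1
      simp only [mem_erase] at this
      simpa using this.1)
  have : Y = B := by
    by_contra hne
    have hU : (B \ Y).Nonempty := by
      rw [Finset.sdiff_nonempty]
      exact fun h => hne (hY.antisymm h)
    have h1 := hall _ Finset.sdiff_subset hU
    -- The leftover vertices have neighbours only among their own partners, so they have no surplus.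
    have h2 : G.neighborsIn A (B \ Y) ⊆ (B \ Y).image f := by
      intro w hw
      simp only [mem_neighborsIn, mem_sdiff] at hw
      obtain ⟨hwA, y, ⟨hyB, hyY⟩, hyw⟩ := hw
      have h3 : w ∉ {r} ∪ (Y ∪ Y.image f) := fun h => hst y hyB hyY w h hyw
      simp only [mem_union, mem_singleton, not_or] at h3
      have h4 : w ∈ B.image f := by rw [him]; simp [hwA, h3.1]
      obtain ⟨v, hv, rfl⟩ := mem_image.1 h4
      refine mem_image_of_mem f ?_
      simp only [mem_sdiff]
      exact ⟨hv, fun h => h3.2.2 (mem_image_of_mem f h)⟩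
    have h3 := (Finset.card_le_card h2).trans Finset.card_image_le
    omega
  subst this
  rw [him] at hT
  convert hT using 1
  ext w
  simp only [mem_union, mem_singleton, mem_erase]
  by_cases hw : w = r
  · subst hw; simp [hr]
  · simp [hw]; tauto

/-- Unless some set of vertices avoiding `b` prevents it, such a graph can be split, after the
removal of `b`, into two alternating trees that contain `r` and `r'` and are attached to `b`. -/
theorem exists_altTree_split (hcol : ∀ ⦃x y⦄, G.Adj x y → col y = !col x) {s : Bool}
    {A B : Finset V} (hA : ∀ x ∈ A, col x = s) (hB : ∀ y ∈ B, col y = !s)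
    (hcard : A.card = B.card + 1)
    (hall : ∀ X ⊆ B, X.Nonempty → X.card < (G.neighborsIn A X).card)
    {b r r' : V} (hb : b ∈ B) (hr : r ∈ A) (hr' : r' ∈ A) (hrr : r ≠ r')
    (htight : ∀ X ⊆ B, b ∉ X → r ∈ G.neighborsIn A X → r' ∈ G.neighborsIn A X →
      X.card + 1 < (G.neighborsIn A X).card) :
    ∃ C₁ C₂ : Finset V, Disjoint C₁ C₂ ∧ C₁ ∪ C₂ = (A ∪ B).erase b ∧ r ∈ C₁ ∧ r' ∈ C₂ ∧
      G.AltTree col s C₁ ∧ G.AltTree col s C₂ ∧ (∃ x ∈ C₁, G.Adj b x) ∧ ∃ x ∈ C₂, G.Adj b x := by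
  have hAB : ∀ x ∈ A, x ∉ B := by
    intro x hx hx'
    have := hA x hx
    rw [hB x hx'] at this
    simp at this
  have hBcard := Finset.card_erase_add_one hb
  have hArr : ((A.erase r).erase r').card + 2 = A.card := by
    rw [Finset.card_erase_of_mem (by simp [hr', hrr.symm]), Finset.card_erase_of_mem hr]
    have : 1 < A.card := Finset.one_lt_card.2 ⟨r, hr, r', hr', hrr⟩
    omega
  -- Deleting `r` and `r'` costs a set at most two neighbours. One is covered by the surplus; both
  -- are lost only when `htight` provides a surplus of two.
  obtain ⟨f₁, hf₁, hfA₁⟩ := exists_injOn_adj (G := G) (A := (A.erase r).erase r')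
      (B := B.erase b) (by
    intro X hX
    rcases X.eq_empty_or_nonempty with rfl | hne
    · simp
    have hXB : X ⊆ B := hX.trans (Finset.erase_subset _ _)
    have h1 := hall X hXB hne
    have h2 : G.neighborsIn ((A.erase r).erase r') X = ((G.neighborsIn A X).erase r).erase r' := by
      ext w; simp only [mem_erase, mem_neighborsIn]; tauto
    rw [h2]
    have hp1 := Finset.pred_card_le_card_erase (s := G.neighborsIn A X) (a := r)
    have hp2 := Finset.pred_card_le_card_erase (s := (G.neighborsIn A X).erase r) (a := r')
    by_cases hrN : r ∈ G.neighborsIn A X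
    · by_cases hrN' : r' ∈ G.neighborsIn A X
      · have := htight X hXB (fun h => by simpa using hX h) hrN hrN'
        omega
      · rw [Finset.erase_right_comm, Finset.erase_eq_of_notMem hrN']; omega
    · rw [Finset.erase_eq_of_notMem hrN] at hp2 ⊢; omega)
  have him₁ : (B.erase b).image f₁ = (A.erase r).erase r' := by
    refine Finset.eq_of_subset_of_card_le ?_ ?_
    · intro w hw
      obtain ⟨y, hy, rfl⟩ := mem_image.1 hw
      exact (hfA₁ y hy).1
    · rw [Finset.card_image_of_injOn hf₁]; omega
  obtain ⟨a₁, ha₁⟩ : (G.neighborsIn A {b}).Nonempty := by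
    have := hall {b} (by simpa using hb) (by simp)
    exact Finset.card_pos.1 (by omega)
  simp only [mem_neighborsIn, mem_singleton, exists_eq_left] at ha₁
  -- A matching of all of `B` that misses a neighbour `a₁` of `b`. Restricted to `B.erase b`, it
  -- also misses `f₂ b`, so both uncovered vertices are neighbours of `b`. The two disjoint trees in
  -- the symmetric difference of `f₁` and `f₂` therefore both attach to `b`.
  obtain ⟨f₂, hf₂, hfA₂⟩ := exists_injOn_adj (G := G) (A := A.erase a₁) (B := B) (by
    intro X hX
    rcases X.eq_empty_or_nonempty with rfl | hne
    · simp
    have h1 := hall X hX hne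
    have h2 : (G.neighborsIn A X).erase a₁ ⊆ G.neighborsIn (A.erase a₁) X := by
      intro w; simp only [mem_erase, mem_neighborsIn]; tauto
    have h3 := Finset.card_le_card h2
    have h4 := Finset.pred_card_le_card_erase (s := G.neighborsIn A X) (a := a₁)
    omega)
  have ha₂ := hfA₂ b hb
  simp only [mem_erase] at ha₂
  have him₂ : (B.erase b).image f₂ = (A.erase a₁).erase (f₂ b) := by
    rw [image_erase_of_injOn hf₂ hb]
    congr 1
    refine Finset.eq_of_subset_of_card_le ?_ ?_
    · intro w hw
      obtain ⟨y, hy, rfl⟩ := mem_image.1 hw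
      exact (hfA₂ y hy).1
    · rw [Finset.card_image_of_injOn hf₂, Finset.card_erase_of_mem ha₁.1]; omega
  obtain ⟨C₁, C₂, hC₁, hC₂, hrC₁, hrC₂, hd, ht₁, ht₂, ha, hcl⟩ := exists_disjoint_altTree
    f₁ f₂ A (B.erase b) r r' hA (fun y hy => hB y (mem_of_mem_erase hy)) hf₁
    (hf₂.mono (by simp)) (fun y hy => (hfA₁ y hy).2)
    (fun y hy => (hfA₂ y (mem_of_mem_erase hy)).2) hr hr' hrr ha₁.1 ha₂.1.2 (Ne.symm ha₂.1.1)
    him₁ him₂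
  have hbC₁ : ∃ x ∈ C₁, G.Adj b x := by
    rcases ha with h | h
    · exact ⟨a₁, h.1, ha₁.2⟩
    · exact ⟨_, h.1, ha₂.2⟩
  have hbC₂ : ∃ x ∈ C₂, G.Adj b x := by
    rcases ha with h | h
    · exact ⟨_, h.2, ha₂.2⟩
    · exact ⟨a₁, h.2, ha₁.2⟩
  -- Both trees absorb further `f₁`-pairs, the first greedily and the second from what is left. This
  -- is possible because each tree is closed under `f₁`.
  obtain ⟨Y₁, hY₁, hT₁, hst₁⟩ := ht₁.grow hcol ((B.erase b) \ (C₁ ∪ C₂)) f₁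
    (fun y hy => hB y (by simp only [mem_sdiff, mem_erase] at hy; exact hy.1.2))
    (fun y hy => (hfA₁ y (Finset.sdiff_subset hy)).2)
    (hf₁.mono (by exact_mod_cast Finset.sdiff_subset))
    (fun y hy => by simp only [mem_sdiff, mem_union] at hy; tauto)
    (fun y hy => by
      have h1 := (hcl y (Finset.sdiff_subset hy)).1
      simp only [mem_sdiff, mem_union] at hy; tauto)
  obtain ⟨Y₂, hY₂, hT₂, hst₂⟩ := ht₂.grow hcol (((B.erase b) \ (C₁ ∪ C₂)) \ Y₁) f₁
    (fun y hy => hB y (by simp only [mem_sdiff, mem_erase] at hy; exact hy.1.1.2))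
    (fun y hy => (hfA₁ y (Finset.sdiff_subset (Finset.sdiff_subset hy))).2)
    (hf₁.mono (by exact_mod_cast Finset.sdiff_subset.trans Finset.sdiff_subset))
    (fun y hy => by simp only [mem_sdiff, mem_union] at hy; tauto)
    (fun y hy => by
      have h1 := (hcl y (Finset.sdiff_subset (Finset.sdiff_subset hy))).2
      simp only [mem_sdiff, mem_union] at hy; tauto)
  have hYB : ∀ y ∈ Y₁ ∪ Y₂, y ∈ B.erase b ∧ y ∉ C₁ ∧ y ∉ C₂ := by
    intro y hy
    have : y ∈ (B.erase b) \ (C₁ ∪ C₂) := by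
      rcases mem_union.1 hy with h | h
      · exact hY₁ h
      · exact Finset.sdiff_subset (hY₂ h)
    simp only [mem_sdiff, mem_union, not_or] at this
    exact this
  have hfC : ∀ y ∈ Y₁ ∪ Y₂, f₁ y ∉ C₁ ∧ f₁ y ∉ C₂ := by
    intro y hy
    have h1 := hYB y hy
    have h2 := hcl y h1.1
    exact ⟨fun h => h1.2.1 (h2.1.2 h), fun h => h1.2.2 (h2.2.2 h)⟩
  have hd₁₂ : ∀ y ∈ Y₁, y ∉ Y₂ := fun y h1 h2 => by
    have := hY₂ h2; simp only [mem_sdiff] at this; exact this.2 h1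
  have hfAm : ∀ y ∈ B.erase b, f₁ y ∈ A := fun y hy => by
    have := (hfA₁ y hy).1; simp only [mem_erase] at this; exact this.2.2
  -- An unabsorbed set would see only its own `f₁`-partners and so contradict the surplus.
  have hcover : ∀ y ∈ B.erase b, y ∈ C₁ ∨ y ∈ C₂ ∨ y ∈ Y₁ ∨ y ∈ Y₂ := by
    by_contra! hne
    set U := (B.erase b).filter fun y => y ∉ C₁ ∧ y ∉ C₂ ∧ y ∉ Y₁ ∧ y ∉ Y₂ with hUdef
    have hU : U.Nonempty := by
      obtain ⟨y, hy, h⟩ := hne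
      exact ⟨y, by rw [hUdef, mem_filter]; exact ⟨hy, h⟩⟩
    have h1 := hall U ((Finset.filter_subset _ _).trans (Finset.erase_subset _ _)) hU
    have h2 : G.neighborsIn A U ⊆ U.image f₁ := by
      intro w hw
      simp only [mem_neighborsIn] at hw
      obtain ⟨hwA, y, hyU, hyw⟩ := hw
      rw [hUdef, mem_filter] at hyU
      have hy' : y ∈ B.erase b \ (C₁ ∪ C₂) := by
        simp only [mem_sdiff, mem_union, not_or]; exact ⟨hyU.1, hyU.2.1, hyU.2.2.1⟩
      have h3 : w ∉ C₁ ∪ (Y₁ ∪ Y₁.image f₁) := fun h => hst₁ y hy' hyU.2.2.2.1 w h hyw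
      have h3' : w ∉ C₂ ∪ (Y₂ ∪ Y₂.image f₁) := fun h =>
        hst₂ y (mem_sdiff.2 ⟨hy', hyU.2.2.2.1⟩) hyU.2.2.2.2 w h hyw
      simp only [mem_union, not_or] at h3 h3'
      have h4 : w ∈ (B.erase b).image f₁ := by
        rw [him₁]
        simp only [mem_erase]
        exact ⟨fun h => h3'.1 (h ▸ hrC₂), fun h => h3.1 (h ▸ hrC₁), hwA⟩
      obtain ⟨v, hv, rfl⟩ := mem_image.1 h4
      refine mem_image_of_mem f₁ ?_
      have h5 := hcl v hv
      rw [hUdef, mem_filter]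
      exact ⟨hv, fun h => h3.1 (h5.1.1 h), fun h => h3'.1 (h5.2.1 h),
        fun h => h3.2.2 (mem_image_of_mem f₁ h), fun h => h3'.2.2 (mem_image_of_mem f₁ h)⟩
    have h3 := (Finset.card_le_card h2).trans Finset.card_image_le
    omega
  refine ⟨_, _, ?_, ?_, mem_union_left _ hrC₁, mem_union_left _ hrC₂, hT₁, hT₂, ?_, ?_⟩
  · rw [Finset.disjoint_left]
    intro w hw hw'
    simp only [mem_union, mem_image] at hw hw'
    rcases hw with h1 | h1 | ⟨v, h1, rfl⟩
    · rcases hw' with h2 | h2 | ⟨v, h2, rfl⟩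
      · exact Finset.disjoint_left.1 hd h1 h2
      · exact (hYB w (by simp [h2])).2.1 h1
      · exact (hfC v (by simp [h2])).1 h1
    · rcases hw' with h2 | h2 | ⟨v, h2, rfl⟩
      · exact (hYB w (by simp [h1])).2.2 h2
      · exact hd₁₂ w h1 h2
      · exact hAB _ (hfAm v (hYB v (by simp [h2])).1) (mem_of_mem_erase (hYB _ (by simp [h1])).1)
    · rcases hw' with h2 | h2 | ⟨v', h2, h3⟩
      · exact (hfC v (by simp [h1])).2 h2
      · exact hAB _ (hfAm v (hYB v (by simp [h1])).1) (mem_of_mem_erase (hYB _ (by simp [h2])).1)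
      · have := hf₁ (hYB v' (by simp [h2])).1 (hYB v (by simp [h1])).1 h3
        exact hd₁₂ v h1 (this ▸ h2)
  · have hbA : b ∉ A := fun h => hAB b h hb
    have hsub : ∀ w ∈ A ∪ B.erase b, w ∈ (A ∪ B).erase b := by
      intro w hw
      simp only [mem_union, mem_erase] at hw ⊢
      rcases hw with h | h
      · exact ⟨fun h' => hbA (h' ▸ h), .inl h⟩
      · exact ⟨h.1, .inr h.2⟩
    refine Finset.Subset.antisymm ?_ ?_
    · intro w hw
      apply hsub
      simp only [mem_union, mem_image] at hw
      rcases hw with (h | h | ⟨v, h, rfl⟩) | (h | h | ⟨v, h, rfl⟩)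
      · exact hC₁ h
      · exact mem_union_right _ (hYB w (by simp [h])).1
      · exact mem_union_left _ (hfAm v (hYB v (by simp [h])).1)
      · exact hC₂ h
      · exact mem_union_right _ (hYB w (by simp [h])).1
      · exact mem_union_left _ (hfAm v (hYB v (by simp [h])).1)
    · intro w hw
      simp only [mem_erase, mem_union] at hw
      obtain ⟨hwb, hwA | hwB⟩ := hw
      · by_cases h1 : w = r
        · subst h1; simp [hrC₁]
        by_cases h2 : w = r'
        · subst h2; simp [hrC₂]
        have h4 : w ∈ (B.erase b).image f₁ := by
          rw [him₁]; simp [h1, h2, hwA]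
        obtain ⟨v, hv, rfl⟩ := mem_image.1 h4
        have h5 := hcl v hv
        simp only [mem_union, mem_image]
        rcases hcover v hv with h | h | h | h
        · exact .inl (.inl (h5.1.1 h))
        · exact .inr (.inl (h5.2.1 h))
        · exact .inl (.inr (.inr ⟨v, h, rfl⟩))
        · exact .inr (.inr (.inr ⟨v, h, rfl⟩))
      · have := hcover w (by simp [hwb, hwB])
        simp only [mem_union]; tauto
  · obtain ⟨x, hx, h⟩ := hbC₁; exact ⟨x, mem_union_left _ hx, h⟩
  · obtain ⟨x, hx, h⟩ := hbC₂; exact ⟨x, mem_union_left _ hx, h⟩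

end SimpleGraph

/-! ### Tree models, their composition, and the Heawood graph plus an edge -/

namespace SimpleGraph

open Finset

variable {V : Type*} [DecidableEq V] {G : SimpleGraph V} {col : V → Bool}

/-- A model of the graph `J` in `G`: disjoint alternating trees, one for each vertex of `J`, such
that for every edge of `J` two potential leaves of the corresponding trees are adjacent, and such
that the remaining vertices of the vertex set `D` of `G` can be paired up. -/
structure TreeModel {V W : Type*} [DecidableEq V] [Fintype W] (G : SimpleGraph V)
    (col : V → Bool) (D : Finset V) (J : SimpleGraph W) (c : W → Bool) (T : W → Finset V) :
    Prop where
  subset : ∀ w, T w ⊆ D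
  disjoint : ∀ u v, u ≠ v → Disjoint (T u) (T v)
  tree : ∀ w, G.AltTree col (c w) (T w)
  exists_adj : ∀ u v, J.Adj u v → ∃ x ∈ T u, ∃ y ∈ T v, col x = c u ∧ col y = c v ∧ G.Adj x y
  rest : G.Paired (D \ univ.biUnion T)

variable {D : Finset V} {W : Type*} [Fintype W] [DecidableEq W] {J : SimpleGraph W} {c : W → Bool}
  {T : W → Finset V}

/-- A pair `u, v` lifts to an edge `xy` between potential leaves of the two trees, and each tree
without that leaf can be paired. -/
theorem Paired.biUnion_model (hcol : ∀ ⦃x y⦄, G.Adj x y → col y = !col x)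
    (hT : G.TreeModel col D J c T) {R : Finset W} (hR : J.Paired R) : G.Paired (R.biUnion T) := by
  induction hR with
  | empty => simpa using Paired.empty
  | @cons R u v _ huv hu hv ih =>
    obtain ⟨x, hx, y, hy, hxc, hyc, hxy⟩ := hT.exists_adj u v huv
    have hd := hT.disjoint u v huv.ne
    have h1 := ((hT.tree u).paired_erase hcol hx hxc).union
      ((hT.tree v).paired_erase hcol hy hyc)
      (hd.mono (Finset.erase_subset _ _) (Finset.erase_subset _ _))
    have hxv : x ∉ T v := Finset.disjoint_left.1 hd hx
    have hyu : y ∉ T u := Finset.disjoint_right.1 hd hy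
    have h2 := h1.cons hxy (by simp [hxv]) (by simp [hyu])
    have h3 : insert x (insert y ((T u).erase x ∪ (T v).erase y)) = T u ∪ T v := by
      ext w
      simp only [mem_insert, mem_union, mem_erase]
      constructor
      · rintro (rfl | rfl | h | h) <;> simp_all
      · rintro (h | h)
        · by_cases hw : w = x <;> simp [hw, h]
        · by_cases hw : w = y <;> simp [hw, h]
    rw [h3] at h2
    rw [Finset.biUnion_insert, Finset.biUnion_insert, ← Finset.union_assoc]
    refine h2.union ih ?_
    rw [Finset.disjoint_biUnion_right]
    intro w hw
    rw [Finset.disjoint_union_left]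
    exact ⟨hT.disjoint _ _ (fun h => hu (h ▸ hw)), hT.disjoint _ _ (fun h => hv (h ▸ hw))⟩

/-- The lifting step behind composition. Trees of vertices of colour `s` are kept whole; from the
tree of a degree-two vertex only a path between its two attachments is kept, and the rest of that
tree is paired. -/
theorem AltTree.exists_biUnion (hcol : ∀ ⦃x y⦄, G.Adj x y → col y = !col x)
    (hc : ∀ ⦃x y⦄, J.Adj x y → c y = !c x)
    (hT : G.TreeModel col D J c T) {s : Bool} {Z : Finset W} (hZ : J.AltTree c s Z) :
    ∃ U ⊆ Z.biUnion T, G.AltTree col s U ∧ (∀ w ∈ Z, c w = s → T w ⊆ U) ∧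
      G.Paired (Z.biUnion T \ U) := by
  induction hZ with
  | @single w hw =>
    refine ⟨T w, by simp, hw ▸ hT.tree w, by simp, by simpa using Paired.empty⟩
  | @step Z u v w _ hu hus huv hvw hv hw ih =>
    obtain ⟨U, hU, hUt, hUT, hUP⟩ := ih
    have hcv : c v = !s := by rw [hc huv, hus]
    have hcw : c w = s := by rw [hc hvw, hcv, Bool.not_not]
    obtain ⟨x', hx', y', hy', hx's, hy's, hxy'⟩ := hT.exists_adj u v huv
    obtain ⟨y'', hy'', z', hz', hy''s, hz's, hyz'⟩ := hT.exists_adj v w hvw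
    have hdZ : ∀ t ∉ Z, ∀ x ∈ T t, x ∉ Z.biUnion T := by
      intro t ht x hx h
      obtain ⟨t', ht', hx'⟩ := mem_biUnion.1 h
      exact Finset.disjoint_left.1 (hT.disjoint t t' (fun h => ht (h ▸ ht'))) hx hx'
    have hvw' : ∀ x ∈ T v, x ∉ T w := fun x hx => Finset.disjoint_left.1
      (hT.disjoint v w hvw.ne) hx
    have htv := hT.tree v
    rw [hcv] at htv
    obtain ⟨S, hS, hE, hmem, hP⟩ := htv.exists_ear hcol hy' (hy's.trans hcv) hy''
      (hy''s.trans hcv) (fun h => hvw' _ h hz') hyz'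
    have h1 := hUt.attach hcol (hUT u hu hus hx') (hx's.trans hus) hxy' hE
      (fun h => hdZ v hv _ hy' (hU h)) (fun h => hdZ w hw _ hz' (hU h))
      (Finset.disjoint_left.2 fun x hx hx' => hdZ v hv _ (hS hx') (hU hx))
    have h2 := h1.union hcol (hcw ▸ hT.tree w) (p := z') (hz's.trans hcw) (by simp) hz' (by
      intro t ht ht'
      simp only [mem_union, mem_insert] at ht
      rcases ht with ht | rfl | rfl | ht
      · exact absurd (hU ht) (hdZ w hw _ ht')
      · exact absurd ht' (hvw' _ hy')
      · rfl
      · exact absurd ht' (hvw' _ (hS ht)))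
    refine ⟨_, ?_, h2, ?_, ?_⟩
    · intro t ht
      simp only [mem_union, mem_insert] at ht
      rw [Finset.biUnion_insert, Finset.biUnion_insert]
      simp only [mem_union]
      rcases ht with (ht | rfl | rfl | ht) | ht
      · exact .inr (.inr (hU ht))
      · exact .inl hy'
      · exact .inr (.inl hz')
      · exact .inl (hS ht)
      · exact .inr (.inl ht)
    · intro t ht hts
      simp only [mem_insert] at ht
      rcases ht with rfl | rfl | ht
      · rw [hcv] at hts; simp at hts
      · exact Finset.subset_union_right
      · intro p hp
        have := hUT t ht hts hp
        simp [this]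
    · have h3 := hUP.union hP (Finset.disjoint_left.2 fun x hx hx' =>
        hdZ v hv _ (Finset.sdiff_subset hx') (Finset.sdiff_subset hx))
      convert h3 using 1
      rw [Finset.biUnion_insert, Finset.biUnion_insert]
      ext t
      have e1 : t ∈ T v → t ∉ T w := hvw' t
      have e2 : t ∈ T v → t ∉ U := fun h h' => hdZ v hv t h (hU h')
      have e3 : t ∈ T w → t ∉ Z.biUnion T := fun h => hdZ w hw t h
      have e4 : t ∈ T v → t ∉ Z.biUnion T := fun h => hdZ v hv t h
      have e5 : t ∈ S → t ∈ T v := fun h => hS h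
      have e6 : t = y' → t ∈ T v := fun h => h ▸ hy'
      have e7 : t = z' → t ∈ T w := fun h => h ▸ hz'
      simp only [mem_sdiff, mem_union, mem_insert, not_or]
      grind

/-- Tree models can be composed. -/
theorem TreeModel.trans {W' : Type*} [Fintype W'] [DecidableEq W'] {J' : SimpleGraph W'}
    {c' : W' → Bool} {Z : W' → Finset W} (hcol : ∀ ⦃x y⦄, G.Adj x y → col y = !col x)
    (hc : ∀ ⦃x y⦄, J.Adj x y → c y = !c x) (hT : G.TreeModel col D J c T)
    (hZ : J.TreeModel c univ J' c' Z) : ∃ U, G.TreeModel col D J' c' U := by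
  choose U hU hUt hUT hUP using fun w => AltTree.exists_biUnion hcol hc hT (hZ.tree w)
  have hdisj : ∀ D D' : Finset W, Disjoint D D' → Disjoint (D.biUnion T) (D'.biUnion T) := by
    intro D D' h
    simp only [Finset.disjoint_biUnion_left, Finset.disjoint_biUnion_right]
    intro i hi j hj
    refine hT.disjoint _ _ ?_
    rintro rfl
    exact Finset.disjoint_left.1 h hj hi
  refine ⟨U, ?_, ?_, hUt, ?_, ?_⟩
  · intro w x hx
    obtain ⟨v, _, hv⟩ := mem_biUnion.1 (hU w hx)
    exact hT.subset v hv
  · intro u v huv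
    exact (hdisj _ _ (hZ.disjoint u v huv)).mono (hU u) (hU v)
  · intro u v huv
    obtain ⟨x, hx, y, hy, hxc, hyc, hxy⟩ := hZ.exists_adj u v huv
    obtain ⟨p, hp, q, hq, hpc, hqc, hpq⟩ := hT.exists_adj x y hxy
    exact ⟨p, hUT u x hx hxc hp, q, hUT v y hy hyc hq, hpc.trans hxc, hqc.trans hyc, hpq⟩
  -- The remaining vertices have three sources: those outside all trees `T`, the trees of vertices
  -- of `J` unused by `Z`, and the leftovers inside used trees.
  · have h1 := Paired.biUnion_model hcol hT hZ.rest
    have h2 : G.Paired (univ.biUnion fun w => (Z w).biUnion T \ U w) :=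
      Paired.biUnion _ _ (fun w _ => hUP w) (fun u _ v _ huv =>
        (hdisj _ _ (hZ.disjoint u v huv)).mono Finset.sdiff_subset Finset.sdiff_subset)
    have h3 : Disjoint ((univ \ univ.biUnion Z).biUnion T)
        (univ.biUnion fun w => (Z w).biUnion T \ U w) := by
      rw [Finset.disjoint_biUnion_right]
      intro w _
      refine (hdisj _ (Z w) ?_).mono_right Finset.sdiff_subset
      rw [Finset.disjoint_left]
      intro x hx hx'
      simp only [mem_sdiff, mem_biUnion, mem_univ, true_and, not_exists] at hx
      exact hx w hx'
    have h4 := h1.union h2 h3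
    have h5 := hT.rest.union h4 (by
      rw [Finset.disjoint_left]
      intro x hx hx'
      simp only [mem_sdiff, mem_biUnion, mem_univ, true_and, not_exists] at hx
      simp only [mem_union, mem_biUnion, mem_sdiff] at hx'
      rcases hx' with ⟨w, _, hw⟩ | ⟨w, _, ⟨t, _, ht⟩, _⟩
      · exact hx.2 w hw
      · exact hx.2 t ht)
    convert h5 using 1
    ext x
    simp only [mem_sdiff, mem_univ, true_and, mem_biUnion, mem_union, not_exists]
    constructor
    · rintro ⟨hxD, h⟩
      by_cases hx : ∃ w, x ∈ T w
      · obtain ⟨w, hw⟩ := hx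
        right
        by_cases hwZ : ∃ t, w ∈ Z t
        · obtain ⟨t, ht⟩ := hwZ
          exact .inr ⟨t, ⟨w, ht, hw⟩, h t⟩
        · exact .inl ⟨w, not_exists.1 hwZ, hw⟩
      · exact .inl ⟨hxD, not_exists.1 hx⟩
    · rintro (⟨hxD, h⟩ | ⟨w, hw, hx⟩ | ⟨t, ⟨w, hw, hx⟩, hxt⟩)
      · refine ⟨hxD, fun v hv => ?_⟩
        obtain ⟨w, hw, hx⟩ := mem_biUnion.1 (hU v hv)
        exact h w hx
      · refine ⟨hT.subset w hx, fun v hv => ?_⟩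
        obtain ⟨w', hw', hx'⟩ := mem_biUnion.1 (hU v hv)
        by_cases hww : w = w'
        · subst hww; exact hw v hw'
        · exact Finset.disjoint_left.1 (hT.disjoint _ _ hww) hx hx'
      · refine ⟨hT.subset w hx, fun v hv => ?_⟩
        obtain ⟨w', hw', hx'⟩ := mem_biUnion.1 (hU v hv)
        by_cases hww : w = w'
        · subst hww
          by_cases hvt : v = t
          · subst hvt; exact hxt hv
          · exact Finset.disjoint_left.1 (hZ.disjoint _ _ hvt) hw' hw
        · exact Finset.disjoint_left.1 (hT.disjoint _ _ hww) hx hx'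

theorem TreeModel.sup_edge (hT : G.TreeModel col D J c T) {u v : W} {x y : V} (hx : x ∈ T u)
    (hy : y ∈ T v) (hxc : col x = c u) (hyc : col y = c v) (hxy : G.Adj x y) :
    G.TreeModel col D (J ⊔ edge u v) c T where
  subset := hT.subset
  disjoint := hT.disjoint
  tree := hT.tree
  rest := hT.rest
  exists_adj := by
    intro p q hpq
    rw [sup_adj, edge_adj] at hpq
    rcases hpq with h | ⟨⟨rfl, rfl⟩ | ⟨rfl, rfl⟩, _⟩
    · exact hT.exists_adj p q h
    · exact ⟨x, hx, y, hy, hxc, hyc, hxy⟩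
    · exact ⟨y, hy, x, hx, hyc, hxc, hxy.symm⟩

instance heawoodGraph_decidableAdj : DecidableRel heawoodGraph.Adj
  | .inl p, .inr l => inferInstanceAs (Decidable (fanoIncidenceMatrix p l ≠ 0))
  | .inr l, .inl p => inferInstanceAs (Decidable (fanoIncidenceMatrix p l ≠ 0))
  | .inl _, .inl _ => inferInstanceAs (Decidable False)
  | .inr _, .inr _ => inferInstanceAs (Decidable False)

/-- The vertex set described by a vertex `x` and possibly a path `x, y, z`. -/
def starSet (B : W × Option (W × W)) : Finset W :=
  match B.2 with
  | none => {B.1}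
  | some (y, z) => {y, z, B.1}

theorem altTree_starSet {s : Bool} (B : W × Option (W × W)) (h : c B.1 = s)
    (h' : ∀ P ∈ B.2, J.Adj B.1 P.1 ∧ J.Adj P.1 P.2 ∧ P.1 ≠ B.1 ∧ P.2 ≠ B.1) :
    J.AltTree c s (starSet B) := by
  obtain ⟨x, _ | ⟨y, z⟩⟩ := B
  · exact .single h
  · obtain ⟨h1, h2, h3, h4⟩ := h' (y, z) rfl
    exact (AltTree.single h).step (by simp) h h1 h2 (by simpa using h3) (by simpa using h4)

/-- A decidable certificate: six sets with one or three vertices each, and one adjacent pair left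
over. The additional edge is allowed only as a connection between two sets. -/
theorem treeModel_starSet {u v : ZMod 7}
    (B : Fin 3 ⊕ Fin 3 → (ZMod 7 ⊕ ZMod 7) × Option ((ZMod 7 ⊕ ZMod 7) × (ZMod 7 ⊕ ZMod 7)))
    (r r' : ZMod 7 ⊕ ZMod 7)
    (h1 : ∀ k, (B k).1.isLeft = k.isLeft ∧ ∀ P ∈ (B k).2.toList, heawoodGraph.Adj (B k).1 P.1 ∧
      heawoodGraph.Adj P.1 P.2 ∧ P.1 ≠ (B k).1 ∧ P.2 ≠ (B k).1)
    (h2 : ∀ k l, k ≠ l → Disjoint (starSet (B k)) (starSet (B l)))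
    (h3 : ∀ i j, ∃ x ∈ starSet (B (.inl i)), ∃ y ∈ starSet (B (.inr j)), x.isLeft = true ∧
      y.isLeft = false ∧ (heawoodGraph.Adj x y ∨ x = .inl u ∧ y = .inr v))
    (h4 : univ \ univ.biUnion (fun k => starSet (B k)) = {r, r'} ∧ heawoodGraph.Adj r r') :
    (heawoodGraph ⊔ edge (.inl u) (.inr v)).TreeModel Sum.isLeft univ
      (completeBipartiteGraph (Fin 3) (Fin 3)) Sum.isLeft (fun k => starSet (B k)) := by
  have key : ∀ i j, ∃ x ∈ starSet (B (.inl i)), ∃ y ∈ starSet (B (.inr j)), x.isLeft = true ∧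
      y.isLeft = false ∧ (heawoodGraph ⊔ edge (.inl u) (.inr v)).Adj x y := by
    intro i j
    obtain ⟨x, hx, y, hy, h, h', h''⟩ := h3 i j
    refine ⟨x, hx, y, hy, h, h', ?_⟩
    rw [sup_adj, edge_adj]
    rcases h'' with h'' | ⟨rfl, rfl⟩
    · exact .inl h''
    · exact .inr ⟨.inl ⟨rfl, rfl⟩, by simp⟩
  refine ⟨fun _ => Finset.subset_univ _, h2, fun k => altTree_starSet (B k) (h1 k).1 fun P hP => ?_, ?_, ?_⟩
  · obtain ⟨h5, h6, h7⟩ := (h1 k).2 P (by simpa using hP)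
    exact ⟨.inl h5, .inl h6, h7⟩
  · rintro (i | i) (j | j) h
    · simp at h
    · exact key i j
    · obtain ⟨x, hx, y, hy, h, h', h''⟩ := key j i
      exact ⟨y, hy, x, hx, h', h, h''.symm⟩
    · simp at h
  · rw [h4.1]
    exact Paired.pair (.inl h4.2)

/-- The Heawood graph with an additional edge has a model of `K₃,₃`. -/
theorem exists_treeModel_heawoodGraph_sup_edge (p l : ZMod 7)
    (h : ¬ heawoodGraph.Adj (.inl p) (.inr l)) :
    ∃ Z, (heawoodGraph ⊔ edge (.inl p) (.inr l)).TreeModel Sum.isLeft univ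
      (completeBipartiteGraph (Fin 3) (Fin 3)) Sum.isLeft Z := by
  -- The residues outside `{0, 1, 3}`. Each certificate is written relative to `l`, following the
  -- cyclic symmetry.
  have : p = l + 2 ∨ p = l + 4 ∨ p = l + 5 ∨ p = l + 6 := by
    revert p l; decide
  clear h
  rcases this with rfl | rfl | rfl | rfl
  · refine ⟨_, treeModel_starSet (Sum.elim
      ![(.inl (l + 2), none), (.inl (l + 3), some (.inr (l + 3), .inl (l + 4))),
        (.inl (l + 1), some (.inr (l + 5), .inl (l + 5)))]
      ![(.inr (l + 1), none), (.inr (l + 2), none), (.inr l, some (.inl l, .inr (l + 4)))])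
      (.inl (l + 6)) (.inr (l + 6)) ?_ ?_ ?_ ?_⟩ <;> (revert l; decide +kernel)
  · refine ⟨_, treeModel_starSet (Sum.elim
      ![(.inl (l + 1), none), (.inl (l + 3), none),
        (.inl (l + 4), some (.inr (l + 4), .inl (l + 5)))]
      ![(.inr l, none), (.inr (l + 1), some (.inl (l + 2), .inr (l + 2))),
        (.inr (l + 3), some (.inl (l + 6), .inr (l + 5)))])
      (.inl l) (.inr (l + 6)) ?_ ?_ ?_ ?_⟩ <;> (revert l; decide +kernel)
  -- The same certificate as for `l + 4`: one set contains both points `l + 4` and `l + 5`, and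
  -- either may carry its connection to the line `l`.
  · refine ⟨_, treeModel_starSet (Sum.elim
      ![(.inl (l + 1), none), (.inl (l + 3), none),
        (.inl (l + 4), some (.inr (l + 4), .inl (l + 5)))]
      ![(.inr l, none), (.inr (l + 1), some (.inl (l + 2), .inr (l + 2))),
        (.inr (l + 3), some (.inl (l + 6), .inr (l + 5)))])
      (.inl l) (.inr (l + 6)) ?_ ?_ ?_ ?_⟩ <;> (revert l; decide +kernel)
  · refine ⟨_, treeModel_starSet (Sum.elim
      ![(.inl (l + 6), none), (.inl (l + 4), some (.inr (l + 1), .inl (l + 1))),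
        (.inl (l + 3), some (.inr (l + 2), .inl (l + 5)))]
      ![(.inr (l + 3), none), (.inr (l + 5), none), (.inr l, some (.inl l, .inr (l + 4)))])
      (.inl (l + 2)) (.inr (l + 6)) ?_ ?_ ?_ ?_⟩ <;> (revert l; decide +kernel)

end SimpleGraph

/-! ### From models of `K₃,₃` to central even subdivisions -/

namespace SimpleGraph

open Finset

variable {V : Type*} [DecidableEq V] {G : SimpleGraph V} {col : V → Bool}

/-- Any three potential leaves of an alternating tree are joined to a vertex of the tree by
internally disjoint paths whose complement in the tree can be paired up. -/
theorem AltTree.exists_claw (hcol : ∀ ⦃x y⦄, G.Adj x y → col y = !col x) {s : Bool}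
    {T : Finset V} (h : G.AltTree col s T) (p : Fin 3 → V) (hp : ∀ i, p i ∈ T)
    (hps : ∀ i, col (p i) = s) :
    ∃ c, col c = s ∧ c ∈ T ∧ ∃ w : ∀ i, G.Walk c (p i), (∀ i, (w i).IsPath) ∧
      (∀ i, ∀ x ∈ (w i).support, x ∈ T) ∧
      (∀ i j, i ≠ j → ∀ x, x ∈ (w i).support → x ∈ (w j).support → x = c) ∧
      ∃ R, G.Paired R ∧ ∀ x, x ∈ R ↔ x ∈ T ∧ ∀ i, x ∉ (w i).support := by
  induction h generalizing p with
  | @single c hc =>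
    have : p = fun _ => c := by funext i; simpa using hp i
    subst this
    exact ⟨c, hc, by simp, fun _ => .nil, by simp, by simp, by simp, ∅, .empty, by simp⟩
  | @step T x y z hT hx hxs hxy hyz hy hz ih =>
    have hcy : col y = !s := by rw [hcol hxy, hxs]
    have hcz : col z = s := by rw [hcol hyz, hcy, Bool.not_not]
    have hpT : ∀ i, p i ≠ z → p i ∈ T := by
      intro i hi
      have := hp i
      simp only [mem_insert] at this
      rcases this with h | h | h
      · have := hps i
        rw [h, hcy] at this
        simp at this
      · exact absurd h hi
      · exact h
    by_cases hz0 : ∀ i, p i ≠ z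
    · obtain ⟨c, hcs, hcT, w, hw1, hw2, hw3, R, hR, hR'⟩ := ih p (fun i => hpT i (hz0 i)) hps
      refine ⟨c, hcs, by simp [hcT], w, hw1, fun i x hx => by simp [hw2 i x hx], hw3, _,
        hR.cons hyz (by simp [hR', hy]) (by simp [hR', hz]), ?_⟩
      intro t
      simp only [mem_insert, hR']
      constructor
      · rintro (rfl | rfl | h)
        · exact ⟨by simp, fun i h => hy (hw2 i _ h)⟩
        · exact ⟨by simp, fun i h => hz (hw2 i _ h)⟩
        · exact ⟨by simp [h.1], h.2⟩
      · tauto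
    push Not at hz0
    obtain ⟨i₀, hi₀⟩ := hz0
    -- Every end at the new leaf `z` is first replaced by `x`. A single such leg is prolonged by `y,
    -- z` afterwards.
    obtain ⟨c, hcs, hcT, w, hw1, hw2, hw3, R, hR, hR'⟩ := ih (fun i => if p i = z then x else p i)
      (fun i => by split_ifs with h; exacts [hx, hpT i h])
      (fun i => by split_ifs with h; exacts [hxs, hps i])
    by_cases hj : ∃ j, j ≠ i₀ ∧ p j = z
    · obtain ⟨j₀, hji, hj₀⟩ := hj
      have hend : ∀ i, p i = z → x ∈ (w i).support := by
        intro i hi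
        have := (w i).end_mem_support
        simpa [hi] using this
      -- Two legs ending at `x` can share only the centre, so `x` is the centre. It is then moved to
      -- `z`, and the third leg, if it ends elsewhere, starts with `z, y, x`.
      obtain rfl : x = c := hw3 _ _ hji x (hend _ hj₀) (hend _ hi₀)
      have hnil : ∀ i, p i = z → (w i).support = [x] := by
        intro i hi
        have : ∀ u (q : G.Walk x u), u = x → q.IsPath → q.support = [x] := by
          rintro u q rfl hq
          rw [Walk.isPath_iff_nil] at hq
          rw [Walk.eq_nil_iff_nil.2 hq]; rfl
        exact this _ _ (by simp [hi]) (hw1 i)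
      have hex : ∀ i, ∃ q : G.Walk z (p i), q.IsPath ∧
          q.support = if p i = z then [z] else z :: y :: (w i).support := by
        intro i
        split_ifs with hi
        · exact ⟨(Walk.nil : G.Walk z z).copy rfl hi.symm, by simp, by simp⟩
        · refine ⟨Walk.cons hyz.symm (Walk.cons hxy.symm ((w i).copy rfl (by simp [hi]))),
            ?_, by simp⟩
          rw [Walk.cons_isPath_iff, Walk.cons_isPath_iff]
          have h1 : y ∉ (w i).support := fun h => hy (hw2 i _ h)
          have h2 : z ∉ (w i).support := fun h => hz (hw2 i _ h)
          simp [hw1 i, h1, h2, hyz.ne']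
      choose q hq hqs using hex
      refine ⟨z, hcz, by simp, q, hq, ?_, ?_, ?_⟩
      · intro i t ht
        rw [hqs] at ht
        split_ifs at ht with hi
        · simp at ht; simp [ht]
        · simp only [List.mem_cons] at ht
          rcases ht with rfl | rfl | ht
          · simp
          · simp
          · simp [hw2 i t ht]
      · intro i j hij t hti htj
        rw [hqs] at hti htj
        by_cases hi : p i = z
        · simpa [hi] using hti
        by_cases hj : p j = z
        · simpa [hj] using htj
        · exfalso
          have h1 : i ≠ i₀ := fun h => hi (h ▸ hi₀)
          have h2 : i ≠ j₀ := fun h => hi (h ▸ hj₀)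
          have h3 : j ≠ i₀ := fun h => hj (h ▸ hi₀)
          have h4 : j ≠ j₀ := fun h => hj (h ▸ hj₀)
          omega
      · by_cases hk : ∃ k, p k ≠ z
        · obtain ⟨k, hk⟩ := hk
          refine ⟨R, hR, ?_⟩
          intro t
          rw [hR']
          constructor
          · rintro ⟨ht, hts⟩
            refine ⟨by simp [ht], fun i => ?_⟩
            rw [hqs]
            have h1 : t ≠ z := fun h => hz (h ▸ ht)
            have h2 : t ≠ y := fun h => hy (h ▸ ht)
            split_ifs with hi
            · simp [h1]
            · simp [h1, h2, hts i]
          · rintro ⟨ht, hts⟩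
            have h1 := hts k
            rw [hqs, if_neg hk] at h1
            simp only [List.mem_cons, not_or] at h1
            simp only [mem_insert, h1.1, h1.2.1, false_or] at ht
            refine ⟨ht, fun i => ?_⟩
            by_cases hi : p i = z
            · rw [hnil i hi]
              simp only [List.mem_singleton]
              rintro rfl
              exact h1.2.2 (w k).start_mem_support
            · have := hts i
              rw [hqs, if_neg hi] at this
              simp only [List.mem_cons, not_or] at this
              exact this.2.2
        -- All three ends are `z`, so the claw is the single vertex `z` and `y` is paired with `x`.
        · push Not at hk
          refine ⟨_, (hT.paired_erase hcol hx hxs).cons hxy (by simp) (by simp [hy]), ?_⟩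
          intro t
          simp only [hqs, hk, if_true, mem_insert, mem_erase, List.mem_singleton]
          constructor
          · rintro (rfl | rfl | ⟨_, h⟩)
            · exact ⟨by simp [hx], fun _ h => hz (h ▸ hx)⟩
            · exact ⟨by simp, fun _ => hyz.ne⟩
            · exact ⟨by simp [h], fun _ h' => hz (h' ▸ h)⟩
          · rintro ⟨h1, h2⟩
            have := h2 0
            by_cases htx : t = x <;> simp_all
    · push Not at hj
      have hex : ∀ i, ∃ q : G.Walk c (p i), q.IsPath ∧
          q.support = if p i = z then (w i).support ++ [y, z] else (w i).support := by
        intro i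
        split_ifs with hi
        · have h1 : y ∉ (w i).support := fun h => hy (hw2 i _ h)
          have h2 : z ∉ (w i).support := fun h => hz (hw2 i _ h)
          have hs : (((w i).copy rfl (by simp [hi])).append
              (Walk.cons hxy (Walk.cons hyz (.nil' z)))).support = (w i).support ++ [y, z] := by
            rw [Walk.support_append]; simp
          refine ⟨(((w i).copy rfl (by simp [hi])).append
            (Walk.cons hxy (Walk.cons hyz (.nil' z)))).copy rfl hi.symm, ?_, ?_⟩
          · rw [Walk.isPath_copy, Walk.isPath_def, hs, List.nodup_append]
            refine ⟨(hw1 i).support_nodup, by simp [hyz.ne], ?_⟩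
            rintro a ha b hb rfl
            simp only [List.mem_cons, List.not_mem_nil, or_false] at hb
            rcases hb with rfl | rfl
            · exact h1 ha
            · exact h2 ha
          · rw [Walk.support_copy, hs]
        · exact ⟨(w i).copy rfl (by simp [hi]), by simp [hw1 i], by simp⟩
      choose q hq hqs using hex
      have hqs' : ∀ i, i ≠ i₀ → (q i).support = (w i).support := fun i hi => by
        rw [hqs, if_neg (hj i hi)]
      have hqs₀ : (q i₀).support = (w i₀).support ++ [y, z] := by rw [hqs, if_pos hi₀]
      have hmem : ∀ i t, t ∈ T → (t ∈ (q i).support ↔ t ∈ (w i).support) := by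
        intro i t ht
        have h1 : t ≠ z := fun h => hz (h ▸ ht)
        have h2 : t ≠ y := fun h => hy (h ▸ ht)
        rw [hqs]
        split_ifs <;> simp [h1, h2]
      refine ⟨c, hcs, by simp [hcT], q, hq, ?_, ?_, R, hR, ?_⟩
      · intro i t ht
        rw [hqs] at ht
        split_ifs at ht with hi
        · simp only [List.mem_append, List.mem_cons, List.not_mem_nil, or_false] at ht
          rcases ht with ht | rfl | rfl
          · simp [hw2 i t ht]
          · simp
          · simp
        · simp [hw2 i t ht]
      · intro i j hij t hti htj
        have htT : t ∈ T := by
          by_cases hi : i = i₀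
          · rw [hqs' j (fun h => hij (hi.trans h.symm))] at htj
            exact hw2 j t htj
          · rw [hqs' i hi] at hti
            exact hw2 i t hti
        exact hw3 i j hij t ((hmem i t htT).1 hti) ((hmem j t htT).1 htj)
      · intro t
        rw [hR']
        constructor
        · rintro ⟨ht, hts⟩
          exact ⟨by simp [ht], fun i h => hts i ((hmem i t ht).1 h)⟩
        · rintro ⟨ht, hts⟩
          have h1 := hts i₀
          rw [hqs₀] at h1
          simp only [List.mem_append, List.mem_cons, List.not_mem_nil, or_false, not_or] at h1
          simp only [mem_insert, h1.2.1, h1.2.2, false_or] at ht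
          exact ⟨ht, fun i h => hts i ((hmem i t ht).2 h)⟩

theorem Walk.odd_length_of_col (hcol : ∀ ⦃x y⦄, G.Adj x y → col y = !col x) {u v : V}
    (w : G.Walk u v) : (Odd w.length ↔ col v = !col u) := by
  induction w with
  | nil => simp
  | @cons u x v h p ih =>
    rw [Walk.length_cons, Nat.odd_add_one, ih, hcol h]
    cases col u <;> cases col v <;> simp

theorem Paired.exists_involution {R : Finset V} (h : G.Paired R) :
    ∃ m : V → V, ∀ x ∈ R, m x ∈ R ∧ m (m x) = x ∧ G.Adj x (m x) := by
  induction h with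
  | empty => exact ⟨id, by simp⟩
  | @cons R x y _ hxy hx hy ih =>
    obtain ⟨m, hm⟩ := ih
    refine ⟨fun t => if t = x then y else if t = y then x else m t, ?_⟩
    have hyx := hxy.ne'
    intro t ht
    simp only [mem_insert] at ht
    by_cases htx : t = x
    · subst htx; simp [hyx, hxy]
    by_cases hty : t = y
    · subst hty; simp [hyx, hxy.symm]
    have htR : t ∈ R := by simpa [htx, hty] using ht
    obtain ⟨h1, h2, h3⟩ := hm t htR
    have h4 : m t ≠ x := fun h => hx (h ▸ h1)
    have h5 : m t ≠ y := fun h => hy (h ▸ h1)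
    simp [htx, hty, h1, h2, h3, h4, h5]

theorem Paired.exists_isPerfectMatching {R : Finset V} (h : G.Paired R) {S : Set V}
    (hS : ∀ x, x ∈ R ↔ x ∈ S) : ∃ M : (G.induce S).Subgraph, M.IsPerfectMatching := by
  obtain ⟨m, hm⟩ := h.exists_involution
  refine ⟨{ verts := Set.univ, Adj := fun a b => m a = b, adj_sub := ?_, edge_vert := ?_,
            symm := ?_ }, ?_, ?_⟩
  · intro a b hab
    have := (hm a ((hS _).2 a.2)).2.2
    rw [hab] at this
    exact this
  · simp
  · exact ⟨fun a b hab => by rw [← hab]; exact (hm a ((hS _).2 a.2)).2.1⟩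
  · intro a _
    refine ⟨⟨m a, (hS _).1 (hm a ((hS _).2 a.2)).1⟩, rfl, ?_⟩
    intro b hb
    exact Subtype.ext (Eq.symm hb)
  · intro a
    simp

theorem Subgraph.exists_walk_coe {K : G.Subgraph} {u v : V} (w : G.Walk u v)
    (h : w.toSubgraph ≤ K) (hu : u ∈ K.verts) (hv : v ∈ K.verts) :
    ∃ q : K.coe.Walk ⟨u, hu⟩ ⟨v, hv⟩, q.support.map Subtype.val = w.support ∧
      q.edges.map (Sym2.map Subtype.val) = w.edges := by
  induction w with
  | nil => exact ⟨.nil, by simp, by simp⟩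
  | @cons u x v hux p ih =>
    have hp : p.toSubgraph ≤ K := le_trans (by simp) h
    have hK : K.Adj u x := h.2 (by simp)
    obtain ⟨q, hq, hq'⟩ := ih hp (K.edge_vert hK.symm) hv
    exact ⟨.cons (v := ⟨x, K.edge_vert hK.symm⟩) (by simpa using hK) q, by simp [hq],
      by simp [hq']⟩

/-- Internally disjoint odd paths between two triples of vertices, together with a pairing of the
remaining vertices, show that a graph contains `K₃,₃`. -/
theorem containsEvenly_of_walks (a b : Fin 3 → V)
    (P : ∀ i j, G.Walk (a i) (b j)) (ha : Function.Injective a) (hb : Function.Injective b)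
    (hab : ∀ i j, a i ≠ b j) (hP : ∀ i j, (P i j).IsPath) (hodd : ∀ i j, Odd (P i j).length)
    (haP : ∀ i j k, a k ∈ (P i j).support → k = i) (hbP : ∀ i j k, b k ∈ (P i j).support → k = j)
    (hd : ∀ i j i' j', (i, j) ≠ (i', j') → ∀ x, x ∈ (P i j).support → x ∈ (P i' j').support →
      (x = a i ∧ i = i') ∨ (x = b j ∧ j = j'))
    (hR : ∃ R, G.Paired R ∧ ∀ x, x ∈ R ↔ ∀ i j, x ∉ (P i j).support) :
    G.ContainsEvenly (completeBipartiteGraph (Fin 3) (Fin 3)) := by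
  set K : G.Subgraph := ⨆ i, ⨆ j, (P i j).toSubgraph with hK
  have hPK : ∀ i j, (P i j).toSubgraph ≤ K := fun i j =>
    le_trans (le_iSup (fun j => (P i j).toSubgraph) j) (le_iSup (fun i => ⨆ j, (P i j).toSubgraph) i)
  have hverts : ∀ x, x ∈ K.verts ↔ ∃ i j, x ∈ (P i j).support := by
    intro x
    simp only [hK, Subgraph.verts_iSup, Set.mem_iUnion, Walk.mem_verts_toSubgraph]
  have hKadj : ∀ x y, K.Adj x y → ∃ i j, s(x, y) ∈ (P i j).edges := by
    intro x y h
    simpa only [hK, Subgraph.iSup_adj, Walk.adj_toSubgraph_iff_mem_edges] using h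
  have haK : ∀ i, a i ∈ K.verts := fun i => (hverts _).2 ⟨i, 0, by simp⟩
  have hbK : ∀ i, b i ∈ K.verts := fun i => (hverts _).2 ⟨0, i, by simp⟩
  choose Q hQ hQe using fun i j =>
    Subgraph.exists_walk_coe (P i j) (hPK i j) (haK i) (hbK j)
  have hsupp : ∀ i j (x : K.verts), x ∈ (Q i j).support ↔ x.1 ∈ (P i j).support := by
    intro i j x
    rw [← hQ i j]
    simp
  have hQp : ∀ i j, (Q i j).IsPath := fun i j => by
    have := (hP i j).support_nodup
    rw [← hQ i j] at this
    exact (Walk.isPath_def _).2 this.of_map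
  have hQo : ∀ i j, Odd (Q i j).length := fun i j => by
    have h1 := congrArg List.length (hQe i j)
    rw [List.length_map, Walk.length_edges, Walk.length_edges] at h1
    rw [h1]
    exact hodd i j
  refine ⟨K, ?_, ⟨?_⟩⟩
  · obtain ⟨R, hR, hR'⟩ := hR
    exact hR.exists_isPerfectMatching (fun x => by simp [hR', hverts])
  · refine
      { f := Sum.elim (fun i => ⟨a i, haK i⟩) (fun j => ⟨b j, hbK j⟩)
        P := fun u v => match u, v with
          | .inl i, .inr j => fun _ => Q i j
          | .inr j, .inl i => fun _ => (Q i j).reverse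
          | .inl _, .inl _ => fun h => (by simp at h)
          | .inr _, .inr _ => fun h => (by simp at h)
        f_injective := ?_
        P_symm := ?_
        isPath := ?_
        odd_length := ?_
        end_of_mem := ?_
        disjoint := ?_
        verts_cover := ?_
        edges_cover := ?_ }
    · rintro (i | i) (j | j) h
      · simp only [Sum.elim_inl, Subtype.mk.injEq] at h; rw [ha h]
      · simp only [Sum.elim_inl, Sum.elim_inr, Subtype.mk.injEq] at h; exact absurd h (hab _ _)
      · simp only [Sum.elim_inl, Sum.elim_inr, Subtype.mk.injEq] at h
        exact absurd h.symm (hab _ _)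
      · simp only [Sum.elim_inr, Subtype.mk.injEq] at h; rw [hb h]
    · rintro (i | i) (j | j) h
      · simp at h
      · rfl
      · simp
      · simp at h
    · rintro (i | i) (j | j) h
      · simp at h
      · exact hQp i j
      · exact (hQp j i).reverse
      · simp at h
    · rintro (i | i) (j | j) h
      · simp at h
      · exact hQo i j
      · simpa using hQo j i
      · simp at h
    · have key : ∀ i j w, Sum.elim (fun i => (⟨a i, haK i⟩ : K.verts)) (fun j => ⟨b j, hbK j⟩) w ∈
          (Q i j).support → w = .inl i ∨ w = .inr j := by
        rintro i j (k | k) h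
        · rw [hsupp] at h; exact .inl (congrArg _ (haP i j k h))
        · rw [hsupp] at h; exact .inr (congrArg _ (hbP i j k h))
      rintro (i | i) (j | j) h w hw
      · simp at h
      · exact key i j w hw
      · exact (key j i w (by simpa using hw)).symm
      · simp at h
    · have key : ∀ i j i' j', (i, j) ≠ (i', j') → ∀ x, x ∈ (Q i j).support →
          x ∈ (Q i' j').support →
          ∃ w, x = Sum.elim (fun i => (⟨a i, haK i⟩ : K.verts)) (fun j => ⟨b j, hbK j⟩) w ∧
          (w = .inl i ∨ w = .inr j) ∧ (w = .inl i' ∨ w = .inr j') := by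
        intro i j i' j' hne x hx hx'
        rw [hsupp] at hx hx'
        rcases hd i j i' j' hne x hx hx' with ⟨h, rfl⟩ | ⟨h, rfl⟩
        · exact ⟨.inl i, Subtype.ext h, by simp, by simp⟩
        · exact ⟨.inr j, Subtype.ext h, by simp, by simp⟩
      rintro (i | i) (j | j) h (i' | i') (j' | j') h' hne x hx hx'
      all_goals first | (simp at h; done) | (simp at h'; done) | skip
      · exact key i j i' j' (by rintro ⟨⟩; exact hne rfl) x hx hx'
      · obtain ⟨w, h1, h2, h3⟩ := key i j j' i' (by rintro ⟨⟩; exact hne Sym2.eq_swap) x hx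
          (by simpa using hx')
        exact ⟨w, h1, h2, h3.symm⟩
      · obtain ⟨w, h1, h2, h3⟩ := key j i i' j' (by rintro ⟨⟩; exact hne Sym2.eq_swap) x
          (by simpa using hx) hx'
        exact ⟨w, h1, h2.symm, h3⟩
      · obtain ⟨w, h1, h2, h3⟩ := key j i j' i' (by rintro ⟨⟩; exact hne rfl) x
          (by simpa using hx) (by simpa using hx')
        exact ⟨w, h1, h2.symm, h3.symm⟩
    · intro x
      obtain ⟨i, j, h⟩ := (hverts x).1 x.2
      exact .inr ⟨.inl i, .inr j, by simp, (hsupp i j x).2 h⟩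
    · intro e
      induction e using Sym2.ind with
      | _ x y =>
        intro he
        obtain ⟨i, j, hij⟩ := hKadj x.1 y.1 he
        refine ⟨.inl i, .inr j, by simp, ?_⟩
        rw [← hQe i j, List.mem_map] at hij
        obtain ⟨e, he, h⟩ := hij
        have : e = s(x, y) := Sym2.map.injective Subtype.val_injective h
        exact this ▸ he

variable [Fintype V] in
/-- A graph with a model of `K₃,₃` contains `K₃,₃`. -/
theorem TreeModel.containsEvenly (hcol : ∀ ⦃x y⦄, G.Adj x y → col y = !col x)
    {T : Fin 3 ⊕ Fin 3 → Finset V}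
    (hT : G.TreeModel col univ (completeBipartiteGraph (Fin 3) (Fin 3)) Sum.isLeft T) :
    G.ContainsEvenly (completeBipartiteGraph (Fin 3) (Fin 3)) := by
  -- Each tree has three connections, one for each neighbour in `K₃,₃`. Its claw provides the branch
  -- vertex and the beginnings of three subdivided edges.
  choose x hx y hy hxc hyc hxy using fun i j => hT.exists_adj (.inl i) (.inr j) (by simp)
  choose a has haT A hAp hAT hAd RA hRA hRA' using fun i =>
    (hT.tree (.inl i)).exists_claw hcol (x i) (hx i) (hxc i)
  choose b hbs hbT B hBp hBT hBd RB hRB hRB' using fun j =>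
    (hT.tree (.inr j)).exists_claw hcol (fun i => y i j) (fun i => hy i j) (fun i => hyc i j)
  have hdl : ∀ i i' v, v ∈ T (.inl i) → v ∈ T (.inl i') → i = i' := by
    intro i i' v h h'
    by_contra hne
    exact Finset.disjoint_left.1 (hT.disjoint (.inl i) (.inl i') (by simpa using hne)) h h'
  have hdr : ∀ i i' v, v ∈ T (.inr i) → v ∈ T (.inr i') → i = i' := by
    intro i i' v h h'
    by_contra hne
    exact Finset.disjoint_left.1 (hT.disjoint (.inr i) (.inr i') (by simpa using hne)) h h'
  have hdlr : ∀ i j v, v ∈ T (.inl i) → v ∈ T (.inr j) → False := fun i j v h h' =>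
    Finset.disjoint_left.1 (hT.disjoint (.inl i) (.inr j) (by simp)) h h'
  -- A leg of the claw of row `i`, the connecting edge, and a leg of the claw of column `j`
  -- backwards. The length is odd because the branch vertices have different colours.
  set P : ∀ i j, G.Walk (a i) (b j) := fun i j =>
    (A i j).append (Walk.cons (hxy i j) (B j i).reverse) with hPdef
  have hPs : ∀ i j v, v ∈ (P i j).support ↔ v ∈ (A i j).support ∨ v ∈ (B j i).support := by
    intro i j v
    rw [hPdef]
    simp only [Walk.mem_support_append_iff, Walk.support_cons, List.mem_cons,
      Walk.support_reverse, List.mem_reverse]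
    constructor
    · rintro (h | rfl | h)
      · exact .inl h
      · exact .inl (A i j).end_mem_support
      · exact .inr h
    · tauto
  refine containsEvenly_of_walks a b P ?_ ?_ ?_ ?_ ?_ ?_ ?_ ?_ ?_
  · intro i i' h
    exact hdl i i' (a i) (haT i) (h ▸ haT i')
  · intro i i' h
    exact hdr i i' (b i) (hbT i) (h ▸ hbT i')
  · intro i j h
    exact hdlr i j (a i) (haT i) (h ▸ hbT j)
  · intro i j
    rw [Walk.isPath_def, hPdef]
    simp only [Walk.support_append, Walk.support_cons, List.tail_cons, Walk.support_reverse]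
    rw [List.nodup_append]
    refine ⟨(hAp i j).support_nodup, List.nodup_reverse.2 (hBp j i).support_nodup, ?_⟩
    rintro v hv v' hv' rfl
    exact hdlr i j v (hAT i j v hv) (hBT j i v (List.mem_reverse.1 hv'))
  · intro i j
    rw [Walk.odd_length_of_col hcol, has, hbs]
    rfl
  · intro i j k h
    rcases (hPs i j _).1 h with h | h
    · exact hdl k i _ (haT k) (hAT i j _ h)
    · exact (hdlr k j _ (haT k) (hBT j i _ h)).elim
  · intro i j k h
    rcases (hPs i j _).1 h with h | h
    · exact (hdlr i k _ (hAT i j _ h) (hbT k)).elim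
    · exact hdr k j _ (hbT k) (hBT j i _ h)
  · intro i j i' j' hne v hv hv'
    rcases (hPs i j _).1 hv with h | h <;> rcases (hPs i' j' _).1 hv' with h' | h'
    · obtain rfl := hdl i i' v (hAT i j v h) (hAT i' j' v h')
      exact .inl ⟨hAd i j j' (fun h => hne (by rw [h])) v h h', rfl⟩
    · exact (hdlr i j' v (hAT i j v h) (hBT j' i' v h')).elim
    · exact (hdlr i' j v (hAT i' j' v h') (hBT j i v h)).elim
    · obtain rfl := hdr j j' v (hBT j i v h) (hBT j' i' v h')
      exact .inr ⟨hBd j i i' (fun h => hne (by rw [h])) v h h', rfl⟩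
  · have hsubA : ∀ i, RA i ⊆ T (.inl i) := fun i v hv => ((hRA' i v).1 hv).1
    have hsubB : ∀ i, RB i ⊆ T (.inr i) := fun i v hv => ((hRB' i v).1 hv).1
    have h1 : G.Paired (univ.biUnion RA) := Paired.biUnion _ _ (fun i _ => hRA i) (by
      intro i _ j _ hij
      exact (hT.disjoint (.inl i) (.inl j) (by simpa using hij)).mono (hsubA i) (hsubA j))
    have h2 : G.Paired (univ.biUnion RB) := Paired.biUnion _ _ (fun i _ => hRB i) (by
      intro i _ j _ hij
      exact (hT.disjoint (.inr i) (.inr j) (by simpa using hij)).mono (hsubB i) (hsubB j))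
    have h3 := h1.union h2 (by
      simp only [Finset.disjoint_biUnion_left, Finset.disjoint_biUnion_right]
      intro j _ i _
      exact (hT.disjoint (.inl i) (.inr j) (by simp)).mono (hsubA i) (hsubB j))
    refine ⟨_, hT.rest.union h3 ?_, ?_⟩
    · rw [Finset.disjoint_left]
      intro v hv hv'
      simp only [mem_sdiff, mem_univ, true_and, mem_biUnion, not_exists] at hv
      simp only [mem_union, mem_biUnion, mem_univ, true_and] at hv'
      rcases hv' with ⟨i, hi⟩ | ⟨i, hi⟩
      · exact hv _ (hsubA i hi)
      · exact hv _ (hsubB i hi)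
    · intro v
      simp only [mem_union, mem_sdiff, mem_univ, true_and, mem_biUnion, not_exists, hPs, not_or,
        hRA', hRB']
      constructor
      · rintro (h | ⟨k, h, hk⟩ | ⟨k, h, hk⟩) i j
        · exact ⟨fun h' => h _ (hAT i j v h'), fun h' => h _ (hBT j i v h')⟩
        · refine ⟨fun h' => ?_, fun h' => hdlr k j v h (hBT j i v h')⟩
          obtain rfl := hdl k i v h (hAT i j v h')
          exact hk j h'
        · refine ⟨fun h' => hdlr i k v (hAT i j v h') h, fun h' => ?_⟩
          obtain rfl := hdr k j v h (hBT j i v h')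
          exact hk i h'
      · intro h
        by_cases hv : ∃ k, v ∈ T k
        · obtain ⟨k | k, hk⟩ := hv
          · exact .inr (.inl ⟨k, hk, fun j => (h k j).1⟩)
          · exact .inr (.inr ⟨k, hk, fun i => (h i k).2⟩)
        · exact .inl (not_exists.1 hv)

end SimpleGraph

/-! ### Tight partitions and the addition of ears -/

namespace SimpleGraph

open Finset

variable {V : Type*} [DecidableEq V] [Fintype V] {G : SimpleGraph V} {col : V → Bool}
  {W : Type*} [Fintype W] [DecidableEq W] {J : SimpleGraph W} {c : W → Bool}
  {T : W → Finset V} {U : Finset V} {E : SimpleGraph V} {φ : V → W}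

/-- A partition of the vertex set `U` of a matching covered subgraph `E` of `G` into the classes
of a map `φ` to the vertices of `J`, such that contracting the classes, which are shores of tight
cuts of `E`, yields `J`. -/
structure TightPartition {V W : Type*} [DecidableEq V] [Fintype V] [DecidableEq W]
    (G : SimpleGraph V) (col : V → Bool) (J : SimpleGraph W) (c : W → Bool) (U : Finset V)
    (E : SimpleGraph V) (φ : V → W) : Prop where
  le : E ≤ G
  mem : ∀ ⦃x y⦄, E.Adj x y → x ∈ U
  paired : G.Paired (univ \ U)
  hall : ∀ s, ∀ X ⊆ U, (∀ x ∈ X, col x = s) → X.Nonempty → (∃ y ∈ U, col y = s ∧ y ∉ X) →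
    X.card < (E.neighborsIn U X).card
  card : ∀ w, (U.filter fun x => φ x = w ∧ col x = c w).card =
    (U.filter fun x => φ x = w ∧ col x = !c w).card + 1
  tight : ∀ ⦃x y⦄, E.Adj x y →
    φ x = φ y ∨ J.Adj (φ x) (φ y) ∧ col x = c (φ x) ∧ col y = c (φ y)
  full : ∀ ⦃u v⦄, J.Adj u v →
    ∃ x y, E.Adj x y ∧ φ x = u ∧ φ y = v ∧ col x = c u ∧ col y = c v

namespace TightPartition

theorem exists_main (h : TightPartition G col J c U E φ) (w : W) :
    ∃ x ∈ U, φ x = w ∧ col x = c w := by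
  have := h.card w
  obtain ⟨x, hx⟩ : (U.filter fun x => φ x = w ∧ col x = c w).Nonempty :=
    Finset.card_pos.1 (by omega)
  exact ⟨x, by simpa using hx⟩

/-- By `tight`, an edge leaves a class only from a vertex of its main colour. A minority vertex thus
keeps all its `E`-neighbours in its class. -/
theorem neighborsIn_subset (hcol : ∀ ⦃x y⦄, G.Adj x y → col y = !col x)
    (h : TightPartition G col J c U E φ) {w : W} {X : Finset V}
    (hX : X ⊆ U.filter fun x => φ x = w ∧ col x = !c w) :
    E.neighborsIn U X ⊆
      E.neighborsIn (U.filter fun x => φ x = w ∧ col x = c w) X := by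
  intro x hx
  simp only [mem_neighborsIn, mem_filter] at hx ⊢
  obtain ⟨hxU, y, hy, hyx⟩ := hx
  have hy' := hX hy
  simp only [mem_filter] at hy'
  refine ⟨⟨hxU, ?_, ?_⟩, y, hy, hyx⟩
  · rcases h.tight hyx with h1 | ⟨-, h1, -⟩
    · exact h1.symm.trans hy'.2.1
    · rw [hy'.2.2, hy'.2.1] at h1; simp at h1
  · rw [hcol (h.le hyx), hy'.2.2, Bool.not_not]

/-- The surplus of `E` survives inside a class. The vertex outside `X` that `hall` demands comes
from a neighbouring class, whose main colour is the minority colour here. -/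
theorem card_lt_card_neighborsIn (hcol : ∀ ⦃x y⦄, G.Adj x y → col y = !col x)
    (hc : ∀ ⦃x y⦄, J.Adj x y → c y = !c x) (h : TightPartition G col J c U E φ) {w v : W}
    (hwv : J.Adj w v) {X : Finset V} (hX : X ⊆ U.filter fun x => φ x = w ∧ col x = !c w)
    (hne : X.Nonempty) :
    X.card < (E.neighborsIn (U.filter fun x => φ x = w ∧ col x = c w) X).card := by
  refine lt_of_lt_of_le (h.hall (!c w) X (hX.trans (Finset.filter_subset _ _)) ?_ hne ?_)
    (Finset.card_le_card (h.neighborsIn_subset hcol hX))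
  · intro x hx
    have := hX hx
    simp only [mem_filter] at this
    exact this.2.2
  · obtain ⟨y, hyU, hyv, hyc⟩ := h.exists_main v
    refine ⟨y, hyU, by rw [hyc, hc hwv], fun hy => ?_⟩
    have := hX hy
    simp only [mem_filter] at this
    exact hwv.ne (this.2.1.symm.trans hyv)

theorem filter_union (w : W) : ((U.filter fun x => φ x = w ∧ col x = c w) ∪
    (U.filter fun x => φ x = w ∧ col x = !c w)) = U.filter fun x => φ x = w := by
  ext x
  simp only [mem_union, mem_filter]
  cases col x <;> cases c w <;> simp

/-- A class has one extra main vertex and strict surplus inside, so `AltTree.of_card_lt` spans it by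
an alternating tree. The classes cover `U`, so nothing remains to be paired. -/
theorem treeModel (hcol : ∀ ⦃x y⦄, G.Adj x y → col y = !col x)
    (hc : ∀ ⦃x y⦄, J.Adj x y → c y = !c x) (hJ : ∀ w, ∃ v, J.Adj w v)
    (h : TightPartition G col J c U E φ) :
    G.TreeModel col U J c fun w => U.filter fun x => φ x = w where
  subset _ := Finset.filter_subset _ _
  disjoint := by
    intro u v huv
    rw [Finset.disjoint_left]
    intro x hx hx'
    simp only [mem_filter] at hx hx'
    exact huv (hx.2.symm.trans hx'.2)
  tree := by
    intro w
    obtain ⟨v, hwv⟩ := hJ w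
    rw [← filter_union (c := c) (col := col)]
    refine AltTree.mono h.le (AltTree.of_card_lt (fun x y hxy => hcol (h.le hxy))
      (by simp) (by simp) (h.card w) ?_)
    intro X hX hne
    exact h.card_lt_card_neighborsIn hcol hc hwv hX hne
  exists_adj := by
    intro u v huv
    obtain ⟨x, y, hxy, hx, hy, hxc, hyc⟩ := h.full huv
    exact ⟨x, by simp [hx, h.mem hxy], y, by simp [hy, h.mem hxy.symm], hxc, hyc, h.le hxy⟩
  rest := by
    have : U \ univ.biUnion (fun w => U.filter fun x => φ x = w) = ∅ := by
      ext x
      simp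
    rw [this]
    exact .empty

end TightPartition

/-- Adding an ear to a matching covered bipartite graph preserves Hall's condition. -/
theorem card_lt_card_neighborsIn_of_ear (hcol : ∀ ⦃x y⦄, G.Adj x y → col y = !col x) {s : Bool}
    {a b : V} {S : Finset V} (hS : G.Ear col s a b S) (ha : a ∈ U) (hb : b ∈ U)
    (hSU : Disjoint S U) {E' : SimpleGraph V} (hEE : E ≤ E')
    (hE' : ∀ x ∈ insert a (insert b S), ∀ y ∈ insert a (insert b S), G.Adj x y → E'.Adj x y)
    (hG : E' ≤ G)
    (hall : ∀ X ⊆ U, (∀ x ∈ X, col x = !s) → X.Nonempty → (∃ y ∈ U, col y = !s ∧ y ∉ X) →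
      X.card < (E.neighborsIn U X).card)
    (htwo : ∃ y ∈ U, col y = !s ∧ y ≠ b)
    {X : Finset V} (hX : X ⊆ U ∪ S) (hXs : ∀ x ∈ X, col x = !s) (hne : X.Nonempty)
    (hmiss : ∃ y ∈ U ∪ S, col y = !s ∧ y ∉ X) :
    X.card < (E'.neighborsIn (U ∪ S) X).card := by
  set N := E'.neighborsIn (U ∪ S) X with hN
  have hXU : X.card = (X ∩ U).card + (X ∩ S).card := by
    rw [← Finset.card_union_of_disjoint (hSU.symm.mono Finset.inter_subset_right
      Finset.inter_subset_right), ← Finset.inter_union_distrib_left,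
      Finset.inter_eq_left.2 hX]
  have hNU : N.card = (N ∩ U).card + (N ∩ S).card := by
    rw [← Finset.card_union_of_disjoint (hSU.symm.mono Finset.inter_subset_right
      Finset.inter_subset_right), ← Finset.inter_union_distrib_left,
      Finset.inter_eq_left.2 neighborsIn_subset]
  have hN1 : ∀ Y ⊆ X, E.neighborsIn U Y ⊆ N ∩ U := by
    intro Y hY x hx
    simp only [mem_neighborsIn, hN, mem_inter, mem_union] at hx ⊢
    obtain ⟨hxU, y, hy, hyx⟩ := hx
    exact ⟨⟨.inl hxU, y, hY hy, hEE hyx⟩, hxU⟩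
  have hS2 : (X ∩ S).Nonempty → (X ∩ S).card < (N ∩ insert a S).card := by
    intro h
    -- The left tree gives `X ∩ S` an excess of neighbours, of which at most the end `a` lies
    -- outside `S`.
    refine hS.left_tree.card_lt_card_neighbors hcol ?_ ?_ h ?_
    · intro x hx; simp [(mem_inter.1 hx).2]
    · intro x hx; exact hXs x (mem_inter.1 hx).1
    · intro y hy x hx hyx
      rw [mem_inter] at hy
      rw [hN, mem_neighborsIn]
      refine ⟨?_, y, hy.1, hE' y (by simp [hy.2]) x ?_ hyx⟩
      · simp only [mem_insert, mem_union] at hx ⊢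
        rcases hx with rfl | hx
        · exact .inl ha
        · exact .inr hx
      · simp only [mem_insert] at hx ⊢; tauto
  have hS3 : (N ∩ insert a S).card ≤ (N ∩ S).card + 1 := by
    refine (Finset.card_le_card (t := insert a (N ∩ S)) ?_).trans (Finset.card_insert_le _ _)
    intro x hx
    simp only [mem_inter, mem_insert] at hx ⊢; tauto
  have hS4 : (X ∩ S).card ≤ (N ∩ S).card := by
    rcases (X ∩ S).eq_empty_or_nonempty with h | h
    · simp [h]
    · have := hS2 h; omega
  rcases (X ∩ U).eq_empty_or_nonempty with hXU0 | hXU0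
  · have : (X ∩ S).Nonempty := by
      rw [← Finset.card_pos]
      rw [hXU0] at hXU
      have := Finset.card_pos.2 hne
      simp at hXU; omega
    have h1 := hS2 this
    have h2 : (N ∩ insert a S).card ≤ N.card := Finset.card_le_card Finset.inter_subset_left
    rw [hXU, hXU0]
    simp; omega
  by_cases hm : ∃ y ∈ U, col y = !s ∧ y ∉ X ∩ U
  · have h1 := hall (X ∩ U) Finset.inter_subset_right
      (fun x hx => hXs x (mem_inter.1 hx).1) hXU0 hm
    have h2 := Finset.card_le_card (hN1 (X ∩ U) Finset.inter_subset_left)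
    omega
  push Not at hm
  have hbX : b ∈ X := (mem_inter.1 (hm b hb hS.right_col)).1
  -- Now `X` contains all vertices of its colour in `U`. Dropping `b` makes `hall` applicable, and
  -- its strictness compensates for the dropped vertex.
  have h1 : (X ∩ U).card ≤ (N ∩ U).card := by
    obtain ⟨y, hyU, hys, hyb⟩ := htwo
    have hy := hm y hyU hys
    have hlt := hall ((X ∩ U).erase b) ((Finset.erase_subset _ _).trans Finset.inter_subset_right)
      (fun x hx => hXs x (mem_inter.1 (mem_of_mem_erase hx)).1) ⟨y, mem_erase.2 ⟨hyb, hy⟩⟩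
      ⟨b, hb, hS.right_col, by simp⟩
    rw [Finset.card_erase_of_mem (hm b hb hS.right_col)] at hlt
    have h2 := Finset.card_le_card (hN1 ((X ∩ U).erase b)
      ((Finset.erase_subset _ _).trans Finset.inter_subset_left))
    omega
  obtain ⟨y, hyUS, hys, hyX⟩ := hmiss
  have hyS : y ∈ S := by
    rcases mem_union.1 hyUS with h | h
    · exact absurd (mem_inter.1 (hm y h hys)).1 hyX
    · exact h
  have hbal : (S.filter fun x => col x = s).card = (S.filter fun x => col x = !s).card := by
    have := hS.left_tree.card hcol
    rw [Finset.filter_insert, Finset.filter_insert, if_pos hS.left_col,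
      if_neg (by rw [hS.left_col]; simp), Finset.card_insert_of_notMem
      (by simp [hS.left_notMem])] at this
    omega
  have hNs : ∀ x ∈ N, col x = s := by
    intro x hx
    rw [hN, mem_neighborsIn] at hx
    obtain ⟨-, z, hz, hzx⟩ := hx
    rw [hcol (hG hzx), hXs z hz, Bool.not_not]
  have hXS : (X ∩ S).card + (S.filter fun x => col x = !s ∧ x ∉ X).card =
      (S.filter fun x => col x = !s).card := by
    rw [← Finset.card_union_of_disjoint]
    · congr 1
      ext x
      simp only [mem_union, mem_inter, mem_filter]
      constructor
      · rintro (h | h)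
        · exact ⟨h.2, hXs x h.1⟩
        · exact ⟨h.1, h.2.1⟩
      · tauto
    · rw [Finset.disjoint_left]
      intro x hx hx'
      exact (mem_filter.1 hx').2.2 (mem_inter.1 hx).1
  have hNSc : (N ∩ S).card + (S.filter fun x => col x = s ∧ x ∉ N).card =
      (S.filter fun x => col x = s).card := by
    rw [← Finset.card_union_of_disjoint]
    · congr 1
      ext x
      simp only [mem_union, mem_inter, mem_filter]
      constructor
      · rintro (h | h)
        · exact ⟨h.2, hNs x h.1⟩
        · exact ⟨h.1, h.2.1⟩
      · tauto
    · rw [Finset.disjoint_left]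
      intro x hx hx'
      exact (mem_filter.1 hx').2.2 (mem_inter.1 hx).1
  have hpos : 0 < (S.filter fun x => col x = !s ∧ x ∉ X).card :=
    Finset.card_pos.2 ⟨y, by simp [hyS, hys, hyX]⟩
  -- Count complements in `S`, whose colours are balanced. Non-neighbours of `X` have all their
  -- neighbours in the right tree outside `X`; since `b` is in `X`, these lie in `S`, and they
  -- outnumber the non-neighbours.
  have hlast : (S.filter fun x => col x = s ∧ x ∉ N).card <
      (S.filter fun x => col x = !s ∧ x ∉ X).card := by
    rcases (S.filter fun x => col x = s ∧ x ∉ N).eq_empty_or_nonempty with h0 | h0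
    · rw [h0]; simpa using hpos
    refine lt_of_lt_of_le (hS.right_tree.card_lt_card_neighbors hcol
      (N := S.filter fun x => col x = !s ∧ x ∉ X) ?_ ?_ h0 ?_)
      (Finset.card_le_card Finset.inter_subset_left)
    · intro x hx; simp [(mem_filter.1 hx).1]
    · intro x hx; simp [(mem_filter.1 hx).2.1]
    · intro z hz v hv hzv
      rw [mem_filter] at hz
      have hvX : v ∉ X := by
        intro hvX
        refine hz.2.2 ?_
        rw [hN, mem_neighborsIn]
        refine ⟨by simp [hz.1], v, hvX, hE' v ?_ z (by simp [hz.1]) hzv.symm⟩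
        simp only [mem_insert] at hv ⊢; tauto
      have hvS : v ∈ S := by
        rcases mem_insert.1 hv with rfl | h
        · exact absurd hbX hvX
        · exact h
      rw [mem_filter]
      exact ⟨hvS, by rw [hcol hzv, hz.2.1], hvX⟩
  omega

namespace TightPartition

/-- An ear whose ends are allowed to be adjacent can be added to a tight partition. -/
theorem add_ear (hcol : ∀ ⦃x y⦄, G.Adj x y → col y = !col x)
    (hc : ∀ ⦃x y⦄, J.Adj x y → c y = !c x) (htwo : ∀ s w, ∃ w', w' ≠ w ∧ c w' = s)
    (h : TightPartition G col J c U E φ) {s : Bool} {a b : V} {S : Finset V}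
    (hS : G.Ear col s a b S) (ha : a ∈ U) (hb : b ∈ U) (hSU : Disjoint S U)
    (hR : G.Paired (univ \ (U ∪ S)))
    (hab : φ a = φ b ∨ J.Adj (φ a) (φ b) ∧ col a = c (φ a) ∧ col b = c (φ b)) :
    ∃ E' φ', TightPartition G col J c (U ∪ S) E' φ' ∧ E ≤ E' ∧ (G.Adj a b → E'.Adj a b) := by
  -- All edges of `G` on the ear and its ends are added, including `ab` if present. With an empty
  -- interior this adds just that edge.
  let E' : SimpleGraph V :=
    { Adj := fun x y => E.Adj x y ∨
        G.Adj x y ∧ x ∈ insert a (insert b S) ∧ y ∈ insert a (insert b S)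
      symm := ⟨fun x y hxy => hxy.imp (fun h => h.symm) (fun h => ⟨h.1.symm, h.2.2, h.2.1⟩)⟩
      loopless := ⟨fun x hx => hx.elim (fun h => h.ne rfl) (fun h => h.1.ne rfl)⟩ }
  have hEE : E ≤ E' := fun x y hxy => .inl hxy
  have hE'G : E' ≤ G := fun x y hxy => hxy.elim (fun h' => h.le h') (fun h => h.1)
  have hE' : ∀ x ∈ insert a (insert b S), ∀ y ∈ insert a (insert b S), G.Adj x y →
    E'.Adj x y := fun x hx y hy hxy => .inr ⟨hxy, hx, hy⟩
  have hD : ∀ x ∈ insert a (insert b S), x ∈ U ∪ S := by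
    intro x hx
    simp only [mem_insert, mem_union] at hx ⊢
    rcases hx with rfl | rfl | hx
    · exact .inl ha
    · exact .inl hb
    · exact .inr hx
  have hUS : ∀ x ∈ U, x ∉ S := fun x hx hx' => Finset.disjoint_left.1 hSU hx' hx
  have htwo' : ∀ s v, ∃ y ∈ U, col y = s ∧ y ≠ v := by
    intro s v
    obtain ⟨w, hw, hws⟩ := htwo s (φ v)
    obtain ⟨y, hy, hyw, hyc⟩ := h.exists_main w
    exact ⟨y, hy, hyc.trans hws, fun h => hw (hyw.symm.trans (congrArg φ h))⟩
  have hbal : (S.filter fun x => col x = s).card = (S.filter fun x => col x = !s).card := by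
    have := hS.left_tree.card hcol
    rw [Finset.filter_insert, Finset.filter_insert, if_pos hS.left_col,
      if_neg (by rw [hS.left_col]; simp), Finset.card_insert_of_notMem
      (by simp [hS.left_notMem])] at this
    omega
  -- The interior joins the class of `a`. It is balanced, so the surplus is unchanged, and only
  -- edges at `b` can leave this class.
  refine ⟨E', fun x => if x ∈ S then φ a else φ x, ⟨hE'G, ?_, hR, ?_, ?_, ?_, ?_⟩, hEE,
    fun hab => hE' a (by simp) b (by simp) hab⟩
  · rintro x y (hxy | ⟨-, hx, -⟩)
    · exact mem_union_left _ (h.mem hxy)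
    · exact hD x hx
  · intro s' X hX hXs hne hmiss
    by_cases hs : s' = s
    · subst hs
      refine card_lt_card_neighborsIn_of_ear hcol hS.symm hb ha hSU hEE ?_ hE'G ?_ ?_ hX ?_ hne ?_
      · rw [Finset.insert_comm]; exact hE'
      · rw [Bool.not_not]; exact h.hall s'
      · rw [Bool.not_not]; exact htwo' s' a
      · rwa [Bool.not_not]
      · rwa [Bool.not_not]
    · obtain rfl : s' = !s := by cases s <;> cases s' <;> simp_all
      exact card_lt_card_neighborsIn_of_ear hcol hS ha hb hSU hEE hE' hE'G (h.hall _)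
        (htwo' _ b) hX hXs hne hmiss
  · intro w
    have key : ∀ t, ((U ∪ S).filter fun x => (if x ∈ S then φ a else φ x) = w ∧ col x = t).card =
        (U.filter fun x => φ x = w ∧ col x = t).card +
        (S.filter fun x => φ a = w ∧ col x = t).card := by
      intro t
      rw [Finset.filter_union, Finset.card_union_of_disjoint]
      · congr 2
        · refine Finset.filter_congr fun x hx => ?_
          rw [if_neg (hUS x hx)]
        · refine Finset.filter_congr fun x hx => ?_
          rw [if_pos hx]
      · exact (hSU.symm.mono (Finset.filter_subset _ _) (Finset.filter_subset _ _))
    rw [key, key, h.card w]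
    by_cases hw : φ a = w
    · simp only [hw, true_and]
      have : (S.filter fun x => col x = c w).card = (S.filter fun x => col x = !c w).card := by
        by_cases hs : c w = s
        · rw [hs]; exact hbal
        · obtain hs : c w = !s := by cases h1 : c w <;> cases h2 : s <;> simp_all
          rw [hs, Bool.not_not]; exact hbal.symm
      omega
    · simp [hw]
  · rintro x y (hxy | ⟨hxy, hx, hy⟩)
    · rw [if_neg (hUS x (h.mem hxy)), if_neg (hUS y (h.mem hxy.symm))]
      exact h.tight hxy
    · have key : ∀ x ∈ insert a (insert b S), x = b ∨ (if x ∈ S then φ a else φ x) = φ a := by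
        intro x hx
        simp only [mem_insert] at hx
        rcases hx with rfl | rfl | hx
        · right; simp
        · exact .inl rfl
        · right; simp [hx]
      have hbb : (if b ∈ S then φ a else φ b) = φ b := if_neg (hUS b hb)
      rcases hab with hab | ⟨hab, hac, hbc⟩
      · left
        have key' : ∀ x ∈ insert a (insert b S), (if x ∈ S then φ a else φ x) = φ a := by
          intro x hx
          rcases key x hx with rfl | h
          · rw [hbb, hab]
          · exact h
        rw [key' x hx, key' y hy]
      · have hcb : c (φ b) = !c (φ a) := hc hab
        rcases key x hx with rfl | h1 <;> rcases key y hy with rfl | h2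
        · exact absurd rfl hxy.ne
        · right
          rw [hbb, h2]
          exact ⟨hab.symm, hbc, by rw [hcol hxy, hbc, hcb, Bool.not_not]⟩
        · right
          rw [hbb, h1]
          refine ⟨hab, ?_, hbc⟩
          rw [hcol hxy.symm, hbc, hcb, Bool.not_not]
        · left; rw [h1, h2]
  · intro u v huv
    obtain ⟨x, y, hxy, hx, hy, h'⟩ := h.full huv
    refine ⟨x, y, hEE hxy, ?_, ?_, h'⟩
    · rw [if_neg (hUS x (h.mem hxy)), hx]
    · rw [if_neg (hUS y (h.mem hxy.symm)), hy]

/-- Part of the class of `q` can be moved to the class of a neighbour `v` of `q`. -/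
theorem move (hcol : ∀ ⦃x y⦄, G.Adj x y → col y = !col x)
    (hc : ∀ ⦃x y⦄, J.Adj x y → c y = !c x) (h : TightPartition G col J c U E φ) {q v : W}
    (hqv : J.Adj q v) {X Q : Finset V} {b : V} (hb : b ∈ U) (hbq : φ b = q) (hbc : col b = !c q)
    (hX : X ⊆ U.filter fun x => φ x = q ∧ col x = c q)
    (hQ : Q ⊆ U.filter fun x => φ x = q ∧ col x = !c q) (hcard : X.card = Q.card + 1)
    (hN : E.neighborsIn U Q ⊆ X) (hbQ : b ∉ Q)
    (hport : ∀ x y, E.Adj x y → φ x = q → φ y ≠ q → φ y ≠ v → x ∈ X) :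
    ∃ φ', TightPartition G col J c U E φ' ∧ φ' b = v ∧ ∀ x, φ x ≠ q → φ' x = φ x := by
  have hcv : c v = !c q := hc hqv
  have hcX : ∀ x ∈ X, col x = c q := fun x hx => (mem_filter.1 (hX hx)).2.2
  have hcQ : ∀ x ∈ Q, col x = !c q := fun x hx => (mem_filter.1 (hQ hx)).2.2
  have hbX : b ∉ X := fun h => by
    have := hcX b h
    rw [hbc] at this; simp at this
  have hcol' : ∀ ⦃x y⦄, E.Adj x y → col y = !col x := fun x y hxy => hcol (h.le hxy)
  -- `X ∪ Q` stays with `q` and the rest of the class goes to `v`. As `X` exceeds `Q` by one, the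
  -- moved part is balanced and both classes keep their surplus of one.
  set φ' : V → W := fun x => if φ x = q ∧ x ∉ X ∧ x ∉ Q then v else φ x with hφ'
  have h1 : ∀ x, φ x ≠ q → φ' x = φ x := fun x hx => by simp [hφ', hx]
  have h2 : ∀ x, φ x = q → x ∈ X → φ' x = q := fun x hx hx' => by simp [hφ', hx, hx']
  have h3 : ∀ x, φ x = q → x ∈ Q → φ' x = q := fun x hx hx' => by simp [hφ', hx, hx']
  have h4 : ∀ x, φ x = q → x ∉ X → x ∉ Q → φ' x = v := fun x hx hx' hx'' => by
    simp [hφ', hx, hx', hx'']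
  have hvq : v ≠ q := hqv.ne'
  have hXn : ∀ x, col x = !c q → x ∉ X := fun x hx hx' => by
    have := hcX x hx'; rw [hx] at this; simp at this
  have hQn : ∀ x, col x = c q → x ∉ Q := fun x hx hx' => by
    have := hcQ x hx'; rw [hx] at this; simp at this
  -- the classes of the new map
  have hA : ((U.filter fun x => φ x = q ∧ col x = c q) \ X).card =
      ((U.filter fun x => φ x = q ∧ col x = !c q) \ Q).card := by
    rw [Finset.card_sdiff_of_subset hX, Finset.card_sdiff_of_subset hQ, h.card q]
    omega
  refine ⟨φ', ⟨h.le, h.mem, h.paired, h.hall, ?_, ?_, ?_⟩, h4 b hbq hbX hbQ, h1⟩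
  · intro w
    by_cases hwq : w = q
    · subst hwq
      have e1 : (U.filter fun x => φ' x = w ∧ col x = c w) = X := by
        ext x
        rw [mem_filter]
        constructor
        · rintro ⟨hxU, hx, hxc⟩
          by_contra hxX
          by_cases hxq : φ x = w
          · exact hvq ((h4 x hxq hxX (hQn x hxc)).symm.trans hx)
          · exact hxq ((h1 x hxq).symm.trans hx)
        · intro hx
          have := mem_filter.1 (hX hx)
          exact ⟨this.1, h2 x this.2.1 hx, this.2.2⟩
      have e2 : (U.filter fun x => φ' x = w ∧ col x = !c w) = Q := by
        ext x
        rw [mem_filter]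
        constructor
        · rintro ⟨hxU, hx, hxc⟩
          by_contra hxX
          by_cases hxq : φ x = w
          · exact hvq ((h4 x hxq (hXn x hxc) hxX).symm.trans hx)
          · exact hxq ((h1 x hxq).symm.trans hx)
        · intro hx
          have := mem_filter.1 (hQ hx)
          exact ⟨this.1, h3 x this.2.1 hx, this.2.2⟩
      rw [e1, e2, hcard]
    by_cases hwv : w = v
    · subst hwv
      have e1 : (U.filter fun x => φ' x = w ∧ col x = c q) =
          (U.filter fun x => φ x = w ∧ col x = c q) ∪
            ((U.filter fun x => φ x = q ∧ col x = c q) \ X) := by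
        ext x
        simp only [mem_filter, mem_union, mem_sdiff]
        constructor
        · rintro ⟨hxU, hx, hxc⟩
          by_cases hxq : φ x = q
          · refine .inr ⟨⟨hxU, hxq, hxc⟩, fun hxX => hvq (hx.symm.trans (h2 x hxq hxX))⟩
          · exact .inl ⟨hxU, (h1 x hxq).symm.trans hx, hxc⟩
        · rintro (⟨hxU, hx, hxc⟩ | ⟨⟨hxU, hx, hxc⟩, hxX⟩)
          · exact ⟨hxU, (h1 x (fun h => hvq (hx.symm.trans h))).trans hx, hxc⟩
          · exact ⟨hxU, h4 x hx hxX (hQn x hxc), hxc⟩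
      have e2 : (U.filter fun x => φ' x = w ∧ col x = !c q) =
          (U.filter fun x => φ x = w ∧ col x = !c q) ∪
            ((U.filter fun x => φ x = q ∧ col x = !c q) \ Q) := by
        ext x
        simp only [mem_filter, mem_union, mem_sdiff]
        constructor
        · rintro ⟨hxU, hx, hxc⟩
          by_cases hxq : φ x = q
          · refine .inr ⟨⟨hxU, hxq, hxc⟩, fun hxX => hvq (hx.symm.trans (h3 x hxq hxX))⟩
          · exact .inl ⟨hxU, (h1 x hxq).symm.trans hx, hxc⟩
        · rintro (⟨hxU, hx, hxc⟩ | ⟨⟨hxU, hx, hxc⟩, hxX⟩)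
          · exact ⟨hxU, (h1 x (fun h => hvq (hx.symm.trans h))).trans hx, hxc⟩
          · exact ⟨hxU, h4 x hx (hXn x hxc) hxX, hxc⟩
      have hdis : ∀ t t' (Y : Finset V), Disjoint (U.filter fun x => φ x = w ∧ col x = t)
          ((U.filter fun x => φ x = q ∧ col x = t') \ Y) := by
        intro t t' Y
        rw [Finset.disjoint_left]
        intro x hx hx'
        simp only [mem_filter, mem_sdiff] at hx hx'
        exact hvq (hx.2.1.symm.trans hx'.1.2.1)
      have := h.card w
      rw [hcv, Bool.not_not] at this ⊢
      rw [e1, e2, Finset.card_union_of_disjoint (hdis _ _ _),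
        Finset.card_union_of_disjoint (hdis _ _ _), hA, this]
      omega
    · have e : ∀ t, (U.filter fun x => φ' x = w ∧ col x = t) =
          U.filter fun x => φ x = w ∧ col x = t := by
        intro t
        refine Finset.filter_congr fun x _ => ?_
        by_cases hxq : φ x = q
        · have : φ' x = q ∨ φ' x = v := by
            simp only [hφ']; split_ifs
            · exact .inr rfl
            · exact .inl hxq
          constructor
          · rintro ⟨hx, -⟩
            rcases this with h | h
            · exact absurd (hx.symm.trans h) hwq
            · exact absurd (hx.symm.trans h) hwv
          · rintro ⟨hx, -⟩
            exact absurd (hx.symm.trans hxq) hwq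
        · rw [h1 x hxq]
      rw [e, e, h.card w]
  · -- it suffices to consider edges with an end in the moved set
    have key : ∀ x y, E.Adj x y → φ x = q → x ∉ X → x ∉ Q →
        φ' x = φ' y ∨ J.Adj (φ' x) (φ' y) ∧ col x = c (φ' x) ∧ col y = c (φ' y) := by
      intro x y hxy hxq hxX hxQ
      have hx' := h4 x hxq hxX hxQ
      by_cases hxc : col x = c q
      · by_cases hyq : φ y = q
        · have hyc : col y = !c q := by rw [hcol' hxy, hxc]
          by_cases hyQ : y ∈ Q
          · exact absurd (hN (mem_neighborsIn.2 ⟨h.mem hxy, y, hyQ, hxy.symm⟩)) hxX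
          · left; rw [hx', h4 y hyq (hXn y hyc) hyQ]
        · left
          rw [hx', h1 y hyq]
          by_contra hne
          exact hxX (hport x y hxy hxq hyq (Ne.symm hne))
      · have hxc' : col x = !c q := by cases h1 : col x <;> cases h2 : c q <;> simp_all
        have hyq : φ y = q := by
          rcases h.tight hxy with h5 | ⟨-, h5, -⟩
          · exact h5.symm.trans hxq
          · rw [hxq] at h5; exact absurd h5 hxc
        have hyc : col y = c q := by rw [hcol' hxy, hxc', Bool.not_not]
        by_cases hyX : y ∈ X
        · right
          rw [hx', h2 y hyq hyX]
          exact ⟨hqv.symm, by rw [hxc', hcv], hyc⟩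
        · left; rw [hx', h4 y hyq hyX (hQn y hyc)]
    have hsame : ∀ x, ¬ (φ x = q ∧ x ∉ X ∧ x ∉ Q) → φ' x = φ x := fun x hx => if_neg hx
    intro x y hxy
    by_cases hx : φ x = q ∧ x ∉ X ∧ x ∉ Q
    · exact key x y hxy hx.1 hx.2.1 hx.2.2
    by_cases hy : φ y = q ∧ y ∉ X ∧ y ∉ Q
    · rcases key y x hxy.symm hy.1 hy.2.1 hy.2.2 with h | ⟨h, h', h''⟩
      · exact .inl h.symm
      · exact .inr ⟨h.symm, h'', h'⟩
    · rw [hsame x hx, hsame y hy]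
      exact h.tight hxy
  -- The edge `qv` of `J` must be realized anew, between `X` and the moved minority vertices.
  -- Otherwise these vertices, among them `b`, would see only an equally large part of the class and
  -- have no surplus.
  · have hnew : ∃ x y, E.Adj x y ∧ φ' x = q ∧ φ' y = v ∧ col x = c q ∧ col y = c v := by
      by_contra hno
      push Not at hno
      have hsub : (U.filter fun x => φ x = q ∧ col x = !c q) \ Q ⊆
          U.filter fun x => φ x = q ∧ col x = !c q := Finset.sdiff_subset
      have hlt := h.card_lt_card_neighborsIn hcol hc hqv hsub ⟨b, by simp [hb, hbq, hbc, hbQ]⟩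
      have hle : (E.neighborsIn (U.filter fun x => φ x = q ∧ col x = c q)
          ((U.filter fun x => φ x = q ∧ col x = !c q) \ Q)) ⊆
          (U.filter fun x => φ x = q ∧ col x = c q) \ X := by
        intro x hx
        rw [mem_neighborsIn] at hx
        obtain ⟨hxA, y, hy, hyx⟩ := hx
        rw [mem_sdiff]
        refine ⟨hxA, fun hxX => ?_⟩
        simp only [mem_filter, mem_sdiff] at hxA hy
        exact hno x y hyx.symm (h2 x hxA.2.1 hxX) (h4 y hy.1.2.1 (hXn y hy.1.2.2) hy.2)
          hxA.2.2 (by rw [hcv]; exact hy.1.2.2)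
      have := Finset.card_le_card hle
      omega
    have key : ∀ w, J.Adj q w →
        ∃ x y, E.Adj x y ∧ φ' x = q ∧ φ' y = w ∧ col x = c q ∧ col y = c w := by
      intro w hqw
      by_cases hwv : w = v
      · subst hwv; exact hnew
      · obtain ⟨x, y, hxy, hx, hy, hxc, hyc⟩ := h.full hqw
        have hyq : φ y ≠ q := by rw [hy]; exact hqw.ne'
        exact ⟨x, y, hxy, h2 x hx (hport x y hxy hx hyq (by rw [hy]; exact hwv)),
          (h1 y hyq).trans hy, hxc, hyc⟩
    intro u w huw
    by_cases huq : u = q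
    · subst huq; exact key w huw
    by_cases hwq : w = q
    · subst hwq
      obtain ⟨x, y, hxy, hx, hy, hxc, hyc⟩ := key u huw.symm
      exact ⟨y, x, hxy.symm, hy, hx, hyc, hxc⟩
    · obtain ⟨x, y, hxy, hx, hy, h'⟩ := h.full huw
      exact ⟨x, y, hxy, (h1 x (by rw [hx]; exact huq)).trans hx,
        (h1 y (by rw [hy]; exact hwq)).trans hy, h'⟩

end TightPartition

end SimpleGraph

/-! ### Moving a minority vertex to a neighbouring class or tree -/

namespace SimpleGraph

open Finset

variable {V : Type*} [DecidableEq V] [Fintype V] {G : SimpleGraph V} {col : V → Bool}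
  {W : Type*} [Fintype W] [DecidableEq W] {J : SimpleGraph W} {c : W → Bool}
  {T : W → Finset V} {D U : Finset V} {E : SimpleGraph V} {φ : V → W}

/-- If the tree of `q` splits at `b` into two alternating trees, then `b` and a part of the second
one can be moved to the tree of a neighbour `v` of `q`. -/
theorem TreeModel.split (hcol : ∀ ⦃x y⦄, G.Adj x y → col y = !col x)
    (hc : ∀ ⦃x y⦄, J.Adj x y → c y = !c x) (hT : G.TreeModel col D J c T) {q v : W}
    (hqv : J.Adj q v) {b : V} {C₁ C₂ : Finset V} (hbT : b ∈ T q) (hbc : col b = !c q)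
    (hd : Disjoint C₁ C₂) (hC : C₁ ∪ C₂ = (T q).erase b) (ht₁ : G.AltTree col (c q) C₁)
    (ht₂ : G.AltTree col (c q) C₂) (hb₁ : ∃ x ∈ C₁, G.Adj b x) (hb₂ : ∃ x ∈ C₂, G.Adj b x)
    (hp₂ : ∃ x ∈ C₂, ∃ y ∈ T v, col x = c q ∧ col y = c v ∧ G.Adj x y)
    (hp₁ : ∀ w, J.Adj q w → w ≠ v → ∃ x ∈ C₁, ∃ y ∈ T w, col x = c q ∧ col y = c w ∧ G.Adj x y) :
    ∃ T', G.TreeModel col D J c T' ∧ b ∈ T' v ∧ ∀ w, w ≠ q → w ≠ v → T' w = T w := by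
  have hcv : c v = !c q := hc hqv
  obtain ⟨x, hx, y, hy, hxc, hyc, hxy⟩ := hp₂
  obtain ⟨x₁, hx₁, hbx₁⟩ := hb₁
  obtain ⟨x₂, hx₂, hbx₂⟩ := hb₂
  have hCT : ∀ z, z ∈ C₁ ∨ z ∈ C₂ ↔ z ≠ b ∧ z ∈ T q := by
    intro z
    rw [← mem_union, hC, mem_erase]
  have hb1 : b ∉ C₁ := fun h => ((hCT b).1 (.inl h)).1 rfl
  have hb2 : b ∉ C₂ := fun h => ((hCT b).1 (.inr h)).1 rfl
  have hqvT : ∀ z ∈ T q, z ∉ T v := fun z hz => Finset.disjoint_left.1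
    (hT.disjoint q v hqv.ne) hz
  -- A path in `C₂` from its connection to `T v` to a neighbour of `b`, ending at `b`. Attached to
  -- `T v` it carries `b` there, and the rest of `C₂` is paired.
  obtain ⟨S, hS, hE, hmem, hP⟩ := ht₂.exists_ear hcol hx hxc hx₂
    (by rw [hcol hbx₂, hbc, Bool.not_not]) hb2 hbx₂.symm
  have hSq : ∀ z ∈ insert x (insert b S), z ∈ T q ∧ z ∉ C₁ := by
    intro z hz
    simp only [mem_insert] at hz
    rcases hz with rfl | rfl | hz
    · exact ⟨((hCT z).1 (.inr hx)).2, fun h => Finset.disjoint_left.1 hd h hx⟩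
    · exact ⟨hbT, hb1⟩
    · exact ⟨((hCT z).1 (.inr (hS hz))).2, fun h => Finset.disjoint_left.1 hd h (hS hz)⟩
  have hE' : G.Ear col (!c v) x b S := by rw [hcv, Bool.not_not]; exact hE
  have ht := (hT.tree v).attach hcol hy hyc hxy.symm hE'
    (hqvT _ (hSq x (by simp)).1) (hqvT _ hbT) (Finset.disjoint_left.2 fun z hz hz' =>
      hqvT z (hSq z (by simp [hz'])).1 hz)
  -- `C₁` takes over the role of `q`. Its connection to `v` is now an edge to `b`.
  set T' : W → Finset V := fun w => if w = q then C₁ else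
    if w = v then T v ∪ insert x (insert b S) else T w with hT'
  have hT'q : T' q = C₁ := by simp [hT']
  have hT'v : T' v = T v ∪ insert x (insert b S) := by simp [hT', hqv.ne']
  have hT'w : ∀ w, w ≠ q → w ≠ v → T' w = T w := fun w h1 h2 => by simp [hT', h1, h2]
  have hsub : ∀ w, w ≠ q → T w ⊆ T' w := by
    intro w hw
    by_cases hwv : w = v
    · subst hwv; rw [hT'v]; exact Finset.subset_union_left
    · rw [hT'w w hw hwv]
  have hC₁q : C₁ ⊆ T q := fun z hz => ((hCT z).1 (.inl hz)).2
  refine ⟨T', ⟨?_, ?_, ?_, ?_, ?_⟩, by rw [hT'v]; simp, hT'w⟩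
  · intro w
    by_cases h1 : w = q
    · subst h1; rw [hT'q]; exact hC₁q.trans (hT.subset w)
    by_cases h2 : w = v
    · subst h2; rw [hT'v]
      exact Finset.union_subset (hT.subset w) (fun z hz => hT.subset q (hSq z hz).1)
    rw [hT'w w h1 h2]; exact hT.subset w
  · have key : ∀ w, w ≠ q → w ≠ v → Disjoint (T' q) (T' w) ∧ Disjoint (T' v) (T' w) := by
      intro w h1 h2
      rw [hT'q, hT'v, hT'w w h1 h2]
      refine ⟨(hT.disjoint q w h1.symm).mono_left hC₁q, ?_⟩
      rw [Finset.disjoint_union_left]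
      exact ⟨hT.disjoint v w h2.symm, (hT.disjoint q w h1.symm).mono_left
        (fun z hz => (hSq z hz).1)⟩
    have key' : Disjoint (T' q) (T' v) := by
      rw [hT'q, hT'v, Finset.disjoint_union_right]
      exact ⟨(hT.disjoint q v hqv.ne).mono_left hC₁q,
        Finset.disjoint_right.2 fun z hz => (hSq z hz).2⟩
    intro u w huw
    by_cases h1 : u = q
    · subst h1
      by_cases h2 : w = v
      · subst h2; exact key'
      · exact (key w huw.symm h2).1
    by_cases h2 : u = v
    · subst h2
      by_cases h3 : w = q
      · subst h3; exact key'.symm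
      · exact (key w h3 huw.symm).2
    by_cases h3 : w = q
    · subst h3; exact (key u h1 h2).1.symm
    by_cases h4 : w = v
    · subst h4; exact (key u h1 h2).2.symm
    rw [hT'w u h1 h2, hT'w w h3 h4]
    exact hT.disjoint u w huw
  · intro w
    by_cases h1 : w = q
    · subst h1; rw [hT'q]; exact ht₁
    by_cases h2 : w = v
    · subst h2; rw [hT'v]; exact ht
    rw [hT'w w h1 h2]; exact hT.tree w
  · have key : ∀ w, J.Adj q w →
        ∃ x ∈ T' q, ∃ y ∈ T' w, col x = c q ∧ col y = c w ∧ G.Adj x y := by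
      intro w hqw
      by_cases hwv : w = v
      · subst hwv
        rw [hT'q, hT'v]
        exact ⟨x₁, hx₁, b, by simp, by rw [hcol hbx₁, hbc, Bool.not_not], by rw [hbc, hcv],
          hbx₁.symm⟩
      · rw [hT'q, hT'w w hqw.ne' hwv]
        exact hp₁ w hqw hwv
    intro u w huw
    by_cases h1 : u = q
    · subst h1; exact key w huw
    by_cases h2 : w = q
    · subst h2
      obtain ⟨x, hx, y, hy, h3, h4, h5⟩ := key u huw.symm
      exact ⟨y, hy, x, hx, h4, h3, h5.symm⟩
    obtain ⟨x, hx, y, hy, h'⟩ := hT.exists_adj u w huw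
    exact ⟨x, hsub u h1 hx, y, hsub w h2 hy, h'⟩
  · have hdis : Disjoint (D \ univ.biUnion T) (C₂ \ insert x S) := by
      rw [Finset.disjoint_left]
      intro z hz hz'
      simp only [mem_sdiff, mem_univ, true_and, mem_biUnion, not_exists] at hz
      exact hz.2 q ((hCT z).1 (.inr (mem_sdiff.1 hz').1)).2
    convert hT.rest.union hP hdis using 1
    ext z
    simp only [mem_sdiff, mem_univ, true_and, mem_biUnion, mem_union, not_exists]
    constructor
    · rintro ⟨hzD, hz⟩
      by_cases hzT : ∃ w, z ∈ T w
      · obtain ⟨w, hw⟩ := hzT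
        right
        by_cases hwq : w = q
        · subst hwq
          have h1 := hz w
          have h2 := hz v
          rw [hT'q] at h1
          rw [hT'v] at h2
          simp only [mem_union, mem_insert, not_or] at h2
          refine ⟨((hCT z).2 ⟨h2.2.2.1, hw⟩).resolve_left h1, ?_⟩
          simp only [mem_insert, not_or]
          exact ⟨h2.2.1, h2.2.2.2⟩
        · exact absurd (hsub w hwq hw) (hz w)
      · exact .inl ⟨hzD, not_exists.1 hzT⟩
    · rintro (⟨hzD, hz⟩ | ⟨hz, hzS⟩)
      · refine ⟨hzD, fun w hw => ?_⟩
        by_cases h1 : w = q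
        · subst h1; rw [hT'q] at hw; exact hz w (hC₁q hw)
        by_cases h2 : w = v
        · subst h2; rw [hT'v, mem_union] at hw
          rcases hw with hw | hw
          · exact hz w hw
          · exact hz q (hSq z hw).1
        · rw [hT'w w h1 h2] at hw; exact hz w hw
      · have hzq := ((hCT z).1 (.inr hz))
        refine ⟨hT.subset q hzq.2, fun w hw => ?_⟩
        by_cases h1 : w = q
        · subst h1; rw [hT'q] at hw; exact Finset.disjoint_left.1 hd hw hz
        by_cases h2 : w = v
        · subst h2; rw [hT'v] at hw
          simp only [mem_union, mem_insert] at hw hzS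
          have := hqvT z hzq.2
          have := hzq.1
          tauto
        · rw [hT'w w h1 h2] at hw
          exact Finset.disjoint_left.1 (hT.disjoint q w (Ne.symm h1)) hzq.2 hw

/-- A vertex `b` in the class of `q` that has the colour of the neighbours of `q` can be moved
to the class of the neighbour `v₁` of `q`, or, in a tree model, to the tree of another
neighbour. -/
theorem TightPartition.move_or_treeModel (hcol : ∀ ⦃x y⦄, G.Adj x y → col y = !col x)
    (hc : ∀ ⦃x y⦄, J.Adj x y → c y = !c x) (h : TightPartition G col J c U E φ)
    (hT : G.TreeModel col D J c T) {q v₁ v₂ v₃ : W} (hTq : T q = U.filter fun x => φ x = q)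
    (hTv : ∀ v, J.Adj q v → v ≠ v₁ → T v = U.filter fun x => φ x = v)
    (hq : ∀ v, J.Adj q v ↔ v = v₁ ∨ v = v₂ ∨ v = v₃) (h₁₂ : v₂ ≠ v₁) (h₁₃ : v₃ ≠ v₁)
    {b : V} (hb : b ∈ U) (hbq : φ b = q) (hbc : col b = !c q) :
    (∃ φ', TightPartition G col J c U E φ' ∧ φ' b = v₁ ∧ ∀ x, φ x ≠ q → φ' x = φ x) ∨
    ∃ v, J.Adj q v ∧ v ≠ v₁ ∧ ∃ T', G.TreeModel col D J c T' ∧ b ∈ T' v ∧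
      ∀ w, w ≠ q → w ≠ v → T' w = T w := by
  classical
  have hqv₁ : J.Adj q v₁ := (hq v₁).2 (.inl rfl)
  have hqv₂ : J.Adj q v₂ := (hq v₂).2 (.inr (.inl rfl))
  have hqv₃ : J.Adj q v₃ := (hq v₃).2 (.inr (.inr rfl))
  have hcol' : ∀ ⦃x y⦄, E.Adj x y → col y = !col x := fun x y hxy => hcol (h.le hxy)
  set A := U.filter fun x => φ x = q ∧ col x = c q with hA
  set B := U.filter fun x => φ x = q ∧ col x = !c q with hB
  have hAs : ∀ x ∈ A, col x = c q := fun x hx => (mem_filter.1 hx).2.2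
  have hBs : ∀ x ∈ B, col x = !c q := fun x hx => (mem_filter.1 hx).2.2
  have hAB : A ∪ B = T q := by rw [hTq]; exact TightPartition.filter_union q
  have hall : ∀ X ⊆ B, X.Nonempty → X.card < (E.neighborsIn A X).card := fun X hX hne =>
    h.card_lt_card_neighborsIn hcol hc hqv₁ hX hne
  have hbB : b ∈ B := by simp [hB, hb, hbq, hbc]
  -- The vertices through which the class of `q` is joined to the classes of `v₂` and `v₃`.
  set P := A.filter fun x => ∃ y, E.Adj x y ∧ φ y ≠ q ∧ φ y ≠ v₁ with hP
  obtain ⟨r, hr⟩ : P.Nonempty := by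
    obtain ⟨x, y, hxy, hx, hy, hxc, -⟩ := h.full hqv₂
    refine ⟨x, ?_⟩
    rw [hP, mem_filter, hA, mem_filter]
    exact ⟨⟨h.mem hxy, hx, hxc⟩, y, hxy, by rw [hy]; exact hqv₂.ne', by rw [hy]; exact h₁₂⟩
  have hrA : r ∈ A := (mem_filter.1 hr).1
  -- A largest critical set avoiding `b`; the empty set qualifies. Critical means that its
  -- neighbourhood together with `r` exceeds it by at most one, hence by exactly one. If this
  -- captures all of `P`, it is the part that stays with `q`.
  obtain ⟨Q, hQ, hmax⟩ := Finset.exists_max_image (B.powerset.filter fun Q => b ∉ Q ∧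
    (insert r (E.neighborsIn A Q)).card ≤ Q.card + 1) Finset.card
    ⟨∅, by
      have : E.neighborsIn A ∅ = ∅ := by ext; simp
      simp [this]⟩
  simp only [mem_filter, mem_powerset] at hQ hmax
  obtain ⟨hQB, hbQ, hQc⟩ := hQ
  have hins : ∀ Y ⊆ B, Y.card + 1 ≤ (insert r (E.neighborsIn A Y)).card := by
    intro Y hY
    rcases Y.eq_empty_or_nonempty with rfl | hne
    · simp
    · exact (hall Y hY hne).trans_le (Finset.card_le_card (Finset.subset_insert _ _))
  by_cases hPX : P ⊆ insert r (E.neighborsIn A Q)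
  · left
    refine h.move hcol hc hqv₁ hb hbq hbc (X := insert r (E.neighborsIn A Q)) (Q := Q) ?_ hQB
      (le_antisymm hQc (hins Q hQB)) ?_ hbQ ?_
    · intro x hx
      rcases mem_insert.1 hx with rfl | hx
      · exact hrA
      · exact (mem_neighborsIn.1 hx).1
    · exact (h.neighborsIn_subset hcol hQB).trans (Finset.subset_insert _ _)
    · intro x y hxy hx hyq hyv
      apply hPX
      rw [hP, mem_filter, hA, mem_filter]
      refine ⟨⟨h.mem hxy, hx, ?_⟩, y, hxy, hyq, hyv⟩
      rcases h.tight hxy with h5 | ⟨-, h5, -⟩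
      · exact absurd (h5.symm.trans hx) hyq
      · rw [h5, hx]
  right
  obtain ⟨r', hr', hrX⟩ := Finset.not_subset.1 hPX
  have hrA' : r' ∈ A := (mem_filter.1 hr').1
  simp only [mem_insert, not_or] at hrX
  obtain ⟨C₁, C₂, hd, hC, hrC₁, hrC₂, ht₁, ht₂, hb₁, hb₂⟩ := exists_altTree_split hcol' hAs hBs
    (h.card q) hall hbB hrA hrA' (Ne.symm hrX.1) (by
      intro Y hY hbY hrY hrY'
      by_contra hlt
      -- Submodularity of neighbourhoods: a set `Y` violating the condition would make `Q ∪ Y`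
      -- critical. By maximality `Y` lies in `Q`, so `r'` would be a neighbour of `Q`.
      have e1 : insert r (E.neighborsIn A (Q ∪ Y)) ⊆
          insert r (E.neighborsIn A Q) ∪ E.neighborsIn A Y := by
        intro x hx
        simp only [mem_insert, mem_union, mem_neighborsIn] at hx ⊢
        rcases hx with rfl | ⟨hxA, y, hy | hy, hyx⟩
        · exact .inl (.inl rfl)
        · exact .inl (.inr ⟨hxA, y, hy, hyx⟩)
        · exact .inr ⟨hxA, y, hy, hyx⟩
      have e2 : insert r (E.neighborsIn A (Q ∩ Y)) ⊆
          insert r (E.neighborsIn A Q) ∩ E.neighborsIn A Y := by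
        intro x hx
        rw [mem_insert] at hx
        rcases hx with rfl | hx
        · exact mem_inter.2 ⟨mem_insert_self _ _, hrY⟩
        · simp only [mem_insert, mem_inter, mem_neighborsIn] at hx ⊢
          obtain ⟨hxA, y, ⟨hy, hy'⟩, hyx⟩ := hx
          exact ⟨.inr ⟨hxA, y, hy, hyx⟩, hxA, y, hy', hyx⟩
      have e3 := Finset.card_union_add_card_inter (insert r (E.neighborsIn A Q))
        (E.neighborsIn A Y)
      have e4 := Finset.card_union_add_card_inter Q Y
      have e5 := Finset.card_le_card e1
      have e6 := Finset.card_le_card e2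
      have e7 := hins (Q ∩ Y) (Finset.inter_subset_left.trans hQB)
      have e8 := hmax (Q ∪ Y) ⟨Finset.union_subset hQB hY, by simp [hbQ, hbY], by omega⟩
      have e9 : Q = Q ∪ Y := Finset.eq_of_subset_of_card_le Finset.subset_union_left e8
      have e10 : Y ⊆ Q := by rw [e9]; exact Finset.subset_union_right
      refine hrX.2 ?_
      rw [mem_neighborsIn] at hrY' ⊢
      obtain ⟨h1, y, hy, h2⟩ := hrY'
      exact ⟨h1, y, e10 hy, h2⟩)
  rw [hAB] at hC
  have hbT : b ∈ T q := by rw [← hAB]; exact mem_union_right _ hbB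
  let p : Finset V → W → Prop := fun C w =>
    ∃ x ∈ C, ∃ y ∈ T w, col x = c q ∧ col y = c w ∧ G.Adj x y
  have hp : ∀ w, J.Adj q w → p C₁ w ∨ p C₂ w := by
    intro w hw
    obtain ⟨x, hx, y, hy, hxc, hyc, hxy⟩ := hT.exists_adj q w hw
    have : x ∈ C₁ ∪ C₂ := by
      rw [hC, mem_erase]
      refine ⟨?_, hx⟩
      rintro rfl
      rw [hbc] at hxc; simp at hxc
    rcases mem_union.1 this with h' | h'
    · exact .inl ⟨x, h', y, hy, hxc, hyc, hxy⟩
    · exact .inr ⟨x, h', y, hy, hxc, hyc, hxy⟩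
  -- Each part contains `r` or `r'`, so it is connected to `v₂` or `v₃`. The trees of these two must
  -- still be their classes, which is what `hTv` requires.
  have hpr : ∀ C, ∀ r ∈ P, r ∈ C → p C v₂ ∨ p C v₃ := by
    intro C r hr hrC
    rw [hP, mem_filter, hA, mem_filter] at hr
    obtain ⟨⟨hrU, hrq, hrc⟩, y, hry, hyq, hyv⟩ := hr
    rcases h.tight hry with h5 | ⟨h5, -, h6⟩
    · exact absurd (h5.symm.trans hrq) hyq
    · rw [hrq] at h5
      have : p C (φ y) := by
        refine ⟨r, hrC, y, ?_, hrc, h6, h.le hry⟩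
        rw [hTv _ h5 hyv]
        simp [h.mem hry.symm]
      rcases (hq _).1 h5 with h7 | h7 | h7
      · exact absurd h7 hyv
      · exact .inl (h7 ▸ this)
      · exact .inr (h7 ▸ this)
  have hdC : ∀ v, J.Adj q v → v ≠ v₁ →
      (p C₂ v ∧ ∀ w, J.Adj q w → w ≠ v → p C₁ w) ∨ (p C₁ v ∧ ∀ w, J.Adj q w → w ≠ v → p C₂ w) →
      ∃ v, J.Adj q v ∧ v ≠ v₁ ∧ ∃ T', G.TreeModel col D J c T' ∧ b ∈ T' v ∧
      ∀ w, w ≠ q → w ≠ v → T' w = T w := by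
    intro v hqv hv h'
    refine ⟨v, hqv, hv, ?_⟩
    have hb₁' : ∃ x ∈ C₁, G.Adj b x := by
      obtain ⟨x, hx, hbx⟩ := hb₁; exact ⟨x, hx, h.le hbx⟩
    have hb₂' : ∃ x ∈ C₂, G.Adj b x := by
      obtain ⟨x, hx, hbx⟩ := hb₂; exact ⟨x, hx, h.le hbx⟩
    rcases h' with ⟨h1, h2⟩ | ⟨h1, h2⟩
    · exact hT.split hcol hc hqv hbT hbc hd hC (ht₁.mono h.le) (ht₂.mono h.le) hb₁' hb₂' h1 h2
    · exact hT.split hcol hc hqv hbT hbc hd.symm (by rw [Finset.union_comm, hC])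
        (ht₂.mono h.le) (ht₁.mono h.le) hb₂' hb₁' h1 h2
  have ha : ∀ C, p C v₁ → p C v₂ → ∀ w, J.Adj q w → w ≠ v₃ → p C w := by
    intro C h1 h2 w hw hne
    rcases (hq w).1 hw with rfl | rfl | rfl
    · exact h1
    · exact h2
    · exact absurd rfl hne
  have ha' : ∀ C, p C v₁ → p C v₃ → ∀ w, J.Adj q w → w ≠ v₂ → p C w := by
    intro C h1 h2 w hw hne
    rcases (hq w).1 hw with rfl | rfl | rfl
    · exact h1
    · exact absurd rfl hne
    · exact h2
  -- Fix a part connected to `v₁`. In every case one of `v₂`, `v₃` can be assigned to the other part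
  -- while the fixed part is connected to the remaining one.
  have f1 := hp v₁ hqv₁
  have f2 := hp v₂ hqv₂
  have f3 := hp v₃ hqv₃
  have g1 := hpr C₁ r hr hrC₁
  have g2 := hpr C₂ r' hr' hrC₂
  have k2 := hdC v₂ hqv₂ h₁₂
  have k3 := hdC v₃ hqv₃ h₁₃
  rcases f1 with f1 | f1
  · by_cases e : p C₁ v₂
    · by_cases e3 : p C₂ v₃
      · exact k3 (.inl ⟨e3, ha C₁ f1 e⟩)
      · exact k2 (.inl ⟨g2.resolve_right e3, ha' C₁ f1 (f3.resolve_right e3)⟩)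
    · exact k2 (.inl ⟨f2.resolve_left e, ha' C₁ f1 (g1.resolve_left e)⟩)
  · by_cases e : p C₂ v₂
    · by_cases e3 : p C₁ v₃
      · exact k3 (.inr ⟨e3, ha C₂ f1 e⟩)
      · exact k2 (.inr ⟨g1.resolve_right e3, ha' C₂ f1 (f3.resolve_left e3)⟩)
    · exact k2 (.inr ⟨f2.resolve_right e, ha' C₂ f1 (g2.resolve_left e)⟩)

end SimpleGraph

/-! ### Adding ears to partitions of Heawood type -/

namespace SimpleGraph

open Finset

theorem heawoodGraph_isLeft : ∀ ⦃x y⦄, heawoodGraph.Adj x y → y.isLeft = !x.isLeft := by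
  decide +kernel

theorem heawoodGraph_exists_neighbors : ∀ q v₁, heawoodGraph.Adj q v₁ →
    ∃ v₂ v₃, v₂ ≠ v₁ ∧ v₃ ≠ v₁ ∧ v₂ ≠ v₃ ∧ ∀ v, heawoodGraph.Adj q v ↔ v = v₁ ∨ v = v₂ ∨ v = v₃ := by
  decide +kernel

theorem heawoodGraph_exists_adj : ∀ q, ∃ v, heawoodGraph.Adj q v := by
  decide +kernel

theorem heawoodGraph_no_four_cycle : ∀ u v u' v', heawoodGraph.Adj u v → heawoodGraph.Adj u' v →
    heawoodGraph.Adj u v' → heawoodGraph.Adj u' v' → u ≠ u' → v = v' := by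
  decide +kernel

theorem heawoodGraph_exists_common_neighbor : ∀ u v, u.isLeft = v.isLeft →
    ∃ w, heawoodGraph.Adj u w ∧ heawoodGraph.Adj v w := by
  decide +kernel

theorem exists_ne_isLeft_eq : ∀ (s : Bool) (w : ZMod 7 ⊕ ZMod 7), ∃ w', w' ≠ w ∧ w'.isLeft = s := by
  decide +kernel

variable {V : Type*} [DecidableEq V] [Fintype V] {G : SimpleGraph V} {col : V → Bool}
  {T : ZMod 7 ⊕ ZMod 7 → Finset V} {D U : Finset V} {E : SimpleGraph V}
  {φ : V → ZMod 7 ⊕ ZMod 7}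

/-- A model of the Heawood graph and an ear that joins the trees of two nonadjacent vertices of
different colours give rise to `K₃,₃`. -/
theorem TreeModel.containsEvenly_of_ear (hcol : ∀ ⦃x y⦄, G.Adj x y → col y = !col x)
    (hT : G.TreeModel col D heawoodGraph Sum.isLeft T) {s : Bool} {a b : V} {S : Finset V}
    (hS : G.Ear col s a b S) {u v : ZMod 7 ⊕ ZMod 7} (ha : a ∈ T u) (hb : b ∈ T v)
    (hau : col a = u.isLeft) (hbv : col b = v.isLeft) (huv : ¬ heawoodGraph.Adj u v)
    (hSD : Disjoint S D) (hR : G.Paired (univ \ (D ∪ S))) :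
    G.ContainsEvenly (completeBipartiteGraph (Fin 3) (Fin 3)) := by
  have hs : s = u.isLeft := hS.left_col.symm.trans hau
  have hvs : v.isLeft = !u.isLeft := by rw [← hbv, hS.right_col, hs]
  have hvu : v ≠ u := by rintro rfl; exact (Bool.not_ne_self _).symm hvs
  have hST : ∀ w, ∀ z ∈ T w, z ∉ S := fun w z hz hzS =>
    Finset.disjoint_left.1 hSD hzS (hT.subset w hz)
  -- The interior of the ear is absorbed by the tree of `u`, so that a single edge joins it to the
  -- tree of `v`.
  set T' : ZMod 7 ⊕ ZMod 7 → Finset V := fun w => if w = u then T u ∪ S else T w with hT'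
  have hT'u : T' u = T u ∪ S := by simp [hT']
  have hT'w : ∀ w, w ≠ u → T' w = T w := fun w hw => by simp [hT', hw]
  have hsub : ∀ w, T w ⊆ T' w := by
    intro w
    by_cases hw : w = u
    · subst hw; rw [hT'u]; exact Finset.subset_union_left
    · rw [hT'w w hw]
  have hmod : G.TreeModel col univ heawoodGraph Sum.isLeft T' := by
    refine ⟨fun _ => Finset.subset_univ _, ?_, ?_, ?_, ?_⟩
    · have key : ∀ w, w ≠ u → Disjoint (T' u) (T' w) := by
        intro w hw
        rw [hT'u, hT'w w hw, Finset.disjoint_union_left]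
        exact ⟨hT.disjoint u w hw.symm, Finset.disjoint_right.2 (hST w)⟩
      intro w w' hne
      by_cases h1 : w = u
      · subst h1; exact key w' hne.symm
      by_cases h2 : w' = u
      · subst h2; exact (key w h1).symm
      rw [hT'w w h1, hT'w w' h2]
      exact hT.disjoint w w' hne
    · intro w
      by_cases h1 : w = u
      · subst h1
        rw [hT'u]
        have := (hT.tree w).union hcol (hs ▸ hS.left_tree) (p := a) hau ha (by simp) (by
          intro z hz hz'
          rcases mem_insert.1 hz' with h | h
          · exact h
          · exact absurd h (hST w z hz))
        convert this using 1
        ext z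
        simp only [mem_union, mem_insert]
        constructor
        · tauto
        · rintro (h | rfl | h)
          · exact .inl h
          · exact .inl ha
          · exact .inr h
      · rw [hT'w w h1]; exact hT.tree w
    · intro w w' hww
      obtain ⟨x, hx, y, hy, h⟩ := hT.exists_adj w w' hww
      exact ⟨x, hsub w hx, y, hsub w' hy, h⟩
    · have hdis : Disjoint (D \ univ.biUnion T) (univ \ (D ∪ S)) := by
        rw [Finset.disjoint_left]
        intro z hz hz'
        simp only [mem_sdiff, mem_union, not_or] at hz hz'
        exact hz'.2.1 hz.1
      convert hT.rest.union hR hdis using 1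
      ext z
      simp only [mem_sdiff, mem_univ, true_and, mem_biUnion, mem_union, not_exists, not_or]
      constructor
      · intro hz
        by_cases hzD : z ∈ D
        · exact .inl ⟨hzD, fun w hw => hz w (hsub w hw)⟩
        · refine .inr ⟨hzD, fun hzS => hz u ?_⟩
          rw [hT'u]; simp [hzS]
      · rintro (⟨hzD, hz⟩ | ⟨hzD, hzS⟩) w hw
        · by_cases h1 : w = u
          · subst h1
            rw [hT'u, mem_union] at hw
            rcases hw with hw | hw
            · exact hz w hw
            · exact Finset.disjoint_left.1 hSD hw hzD
          · rw [hT'w w h1] at hw; exact hz w hw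
        · by_cases h1 : w = u
          · subst h1
            rw [hT'u, mem_union] at hw
            rcases hw with hw | hw
            · exact hzD (hT.subset w hw)
            · exact hzS hw
          · rw [hT'w w h1] at hw; exact hzD (hT.subset w hw)
  obtain ⟨z, hz, hzs, hzb⟩ := hS.right_adj
  have hzT : z ∈ T' u := by
    rw [hT'u, mem_union]
    rcases mem_insert.1 hz with rfl | h
    · exact .inl ha
    · exact .inr h
  have key : ∀ p l x y, x ∈ T' (.inl p) → y ∈ T' (.inr l) → col x = true → col y = false →
      G.Adj x y → ¬ heawoodGraph.Adj (.inl p) (.inr l) →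
      G.ContainsEvenly (completeBipartiteGraph (Fin 3) (Fin 3)) := by
    intro p l x y hx hy hxc hyc hxy hpl
    have h1 := hmod.sup_edge hx hy hxc hyc hxy
    obtain ⟨Z, hZ⟩ := exists_treeModel_heawoodGraph_sup_edge p l hpl
    obtain ⟨T'', hT''⟩ := h1.trans hcol (by
      intro x y hxy
      rw [sup_adj, edge_adj] at hxy
      rcases hxy with h | ⟨⟨rfl, rfl⟩ | ⟨rfl, rfl⟩, _⟩
      · exact heawoodGraph_isLeft h
      · rfl
      · rfl) hZ
    exact hT''.containsEvenly hcol
  rcases u with p | l <;> rcases v with p' | l'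
  · simp at hvs
  · exact key p l' z b hzT (hsub _ hb) (hzs.trans hs) hbv hzb huv
  · exact key p' l b z (hsub _ hb) hzT hbv (hzs.trans hs) hzb.symm (fun h => huv h.symm)
  · simp at hvs

namespace TightPartition

/-- An ear one of whose ends has the colour of its class can be added to a tight partition of
Heawood type unless there is a `K₃,₃`. -/
theorem exists_add_ear_of_col_eq (hcol : ∀ ⦃x y⦄, G.Adj x y → col y = !col x)
    (hK : ¬ G.ContainsEvenly (completeBipartiteGraph (Fin 3) (Fin 3)))
    (h : TightPartition G col heawoodGraph Sum.isLeft U E φ) {s : Bool} {a b : V} {S : Finset V}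
    (hS : G.Ear col s a b S) (ha : a ∈ U) (hb : b ∈ U) (hSU : Disjoint S U)
    (hR : G.Paired (univ \ (U ∪ S))) (hac : col a = (φ a).isLeft) :
    ∃ E' φ', TightPartition G col heawoodGraph Sum.isLeft (U ∪ S) E' φ' ∧ E ≤ E' ∧
      (G.Adj a b → E'.Adj a b) := by
  have hT := h.treeModel hcol heawoodGraph_isLeft heawoodGraph_exists_adj
  have hba : col b = !col a := by rw [hS.right_col, hS.left_col]
  by_cases hbc : col b = (φ b).isLeft
  · by_cases hadj : heawoodGraph.Adj (φ a) (φ b)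
    · exact h.add_ear hcol heawoodGraph_isLeft exists_ne_isLeft_eq hS ha hb hSU hR
        (.inr ⟨hadj, hac, hbc⟩)
    · exact absurd (hT.containsEvenly_of_ear hcol hS (by simp [ha]) (by simp [hb]) hac hbc hadj
        hSU hR) hK
  have hbc' : col b = !(φ b).isLeft := by
    cases h1 : col b <;> cases h2 : (φ b).isLeft <;> simp_all
  have hqa : (φ a).isLeft = (φ b).isLeft := by
    rw [← hac]
    rw [hba] at hbc'
    simpa using hbc'
  by_cases hab : φ a = φ b
  · exact h.add_ear hcol heawoodGraph_isLeft exists_ne_isLeft_eq hS ha hb hSU hR (.inl hab)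
  -- Both classes are points or both are lines. Moving `b` to their common neighbour `v₁` would make
  -- the ear fit; in any other neighbour of `φ b` it meets a vertex not adjacent to `φ a`, as there
  -- is no four-cycle.
  obtain ⟨v₁, hav₁, hbv₁⟩ := heawoodGraph_exists_common_neighbor _ _ hqa
  obtain ⟨v₂, v₃, h₁₂, h₁₃, h₂₃, hq⟩ := heawoodGraph_exists_neighbors _ _ hbv₁
  rcases h.move_or_treeModel hcol heawoodGraph_isLeft hT rfl (fun _ _ _ => rfl) hq h₁₂ h₁₃ hb
    rfl hbc' with ⟨φ', h', hb', hφ'⟩ | ⟨v, hqv, hv, T', hT', hbT', hw⟩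
  · refine h'.add_ear hcol heawoodGraph_isLeft exists_ne_isLeft_eq hS ha hb hSU hR (.inr ?_)
    rw [hb', hφ' a hab]
    exact ⟨hav₁, hac, by rw [hbc', heawoodGraph_isLeft hbv₁]⟩
  · refine absurd (hT'.containsEvenly_of_ear hcol hS (u := φ a) (v := v) ?_ hbT' hac
      (by rw [hbc', heawoodGraph_isLeft hqv]) ?_ hSU hR) hK
    · rw [hw _ hab]
      · simp [ha]
      · intro h1
        have := heawoodGraph_isLeft hqv
        rw [← h1, hqa] at this
        exact (Bool.not_ne_self _).symm this
    · exact fun hav => hv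
        (heawoodGraph_no_four_cycle _ _ _ _ hav₁ hbv₁ hav hqv hab).symm

/-- Every ear can be added to a tight partition of Heawood type unless there is a `K₃,₃`. -/
theorem exists_add_ear (hcol : ∀ ⦃x y⦄, G.Adj x y → col y = !col x)
    (hK : ¬ G.ContainsEvenly (completeBipartiteGraph (Fin 3) (Fin 3)))
    (h : TightPartition G col heawoodGraph Sum.isLeft U E φ) {s : Bool} {a b : V} {S : Finset V}
    (hS : G.Ear col s a b S) (ha : a ∈ U) (hb : b ∈ U) (hSU : Disjoint S U)
    (hR : G.Paired (univ \ (U ∪ S))) :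
    ∃ E' φ', TightPartition G col heawoodGraph Sum.isLeft (U ∪ S) E' φ' ∧ E ≤ E' ∧
      (G.Adj a b → E'.Adj a b) := by
  have hswap : ∀ φ', TightPartition G col heawoodGraph Sum.isLeft U E φ' →
      col b = (φ' b).isLeft → ∃ E' φ', TightPartition G col heawoodGraph Sum.isLeft (U ∪ S) E' φ' ∧
      E ≤ E' ∧ (G.Adj a b → E'.Adj a b) := by
    intro φ' h' hbc
    obtain ⟨E', φ'', h1, h2, h3⟩ := h'.exists_add_ear_of_col_eq hcol hK hS.symm hb ha hSU hR hbc
    exact ⟨E', φ'', h1, h2, fun hab => (h3 hab.symm).symm⟩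
  by_cases hac : col a = (φ a).isLeft
  · exact h.exists_add_ear_of_col_eq hcol hK hS ha hb hSU hR hac
  by_cases hbc : col b = (φ b).isLeft
  · exact hswap φ h hbc
  have hac' : col a = !(φ a).isLeft := by
    cases h1 : col a <;> cases h2 : (φ a).isLeft <;> simp_all
  have hbc' : col b = !(φ b).isLeft := by
    cases h1 : col b <;> cases h2 : (φ b).isLeft <;> simp_all
  have hba : col b = !col a := by rw [hS.right_col, hS.left_col]
  have hqp : (φ b).isLeft = !(φ a).isLeft := by
    rw [hba, hac'] at hbc'
    cases h1 : (φ a).isLeft <;> cases h2 : (φ b).isLeft <;> simp_all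
  have hne : ∀ {x y : ZMod 7 ⊕ ZMod 7}, x.isLeft = !y.isLeft → x ≠ y := by
    rintro x y h1 rfl; exact (Bool.not_ne_self _).symm h1
  have hT := h.treeModel hcol heawoodGraph_isLeft heawoodGraph_exists_adj
  -- The preferred neighbour is `φ b` whenever possible, so that a split puts `a` into the tree of
  -- some `u` other than `φ b` and leaves the tree of `φ b` intact.
  obtain ⟨v₀, hpv₀, hv₀⟩ : ∃ v₀, heawoodGraph.Adj (φ a) v₀ ∧
      (heawoodGraph.Adj (φ a) (φ b) → v₀ = φ b) := by
    by_cases hpq : heawoodGraph.Adj (φ a) (φ b)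
    · exact ⟨_, hpq, fun _ => rfl⟩
    · obtain ⟨v, hv⟩ := heawoodGraph_exists_adj (φ a)
      exact ⟨v, hv, fun h => absurd h hpq⟩
  obtain ⟨u₂, u₃, h₁₂, h₁₃, h₂₃, hq⟩ := heawoodGraph_exists_neighbors _ _ hpv₀
  rcases h.move_or_treeModel hcol heawoodGraph_isLeft hT rfl (fun _ _ _ => rfl) hq h₁₂ h₁₃ ha
    rfl hac' with ⟨φ', h', ha', hφ'⟩ | ⟨u, hpu, hu, T', hT', haT', hw⟩
  · refine h'.exists_add_ear_of_col_eq hcol hK hS ha hb hSU hR ?_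
    rw [ha', hac', heawoodGraph_isLeft hpv₀]
  clear h₁₂ h₁₃ h₂₃ hq
  have huq : u ≠ φ b := by
    rintro rfl
    exact hu (hv₀ hpu).symm
  have hcu : u.isLeft = !(φ a).isLeft := heawoodGraph_isLeft hpu
  -- `v₁` is the common neighbour of `φ b` and `u` if there is one, so a second split makes the ear
  -- join nonadjacent vertices. If `φ a` is adjacent to `φ b`, that common neighbour is `φ a`, whose
  -- tree has changed; the second split then needs no information about it.
  obtain ⟨v₁, hqv₁, hv₁u, hv₁p⟩ : ∃ v₁, heawoodGraph.Adj (φ b) v₁ ∧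
      (∀ v, heawoodGraph.Adj (φ b) v → heawoodGraph.Adj u v → v = v₁) ∧
      (heawoodGraph.Adj (φ b) (φ a) → v₁ = φ a) := by
    by_cases hpq : heawoodGraph.Adj (φ b) (φ a)
    · exact ⟨_, hpq, fun v hv hv' =>
        heawoodGraph_no_four_cycle _ _ _ _ hv hv' hpq hpu.symm huq.symm, fun _ => rfl⟩
    · by_cases hex : ∃ v, heawoodGraph.Adj (φ b) v ∧ heawoodGraph.Adj u v
      · obtain ⟨v₁, h1, h2⟩ := hex
        exact ⟨v₁, h1, fun v hv hv' => heawoodGraph_no_four_cycle _ _ _ _ hv hv' h1 h2 huq.symm,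
          fun h => absurd h hpq⟩
      · obtain ⟨v, hv⟩ := heawoodGraph_exists_adj (φ b)
        exact ⟨v, hv, fun v hv hv' => absurd ⟨v, hv, hv'⟩ hex, fun h => absurd h hpq⟩
  have hvu : ∀ v, heawoodGraph.Adj (φ b) v → v ≠ u := by
    intro v hv
    refine hne ?_
    rw [heawoodGraph_isLeft hv, hqp, hcu]
  obtain ⟨v₂, v₃, h₁₂, h₁₃, h₂₃, hq⟩ := heawoodGraph_exists_neighbors _ _ hqv₁
  -- Moves are made in the original partition, splits in the model already split at `a`. A
  -- successful move gives `b` the main colour and leads back to the case of one minority end.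
  rcases h.move_or_treeModel hcol heawoodGraph_isLeft hT' (hw _ (hne hqp) huq.symm)
    (fun v hv hvv₁ => hw v (fun h1 => hvv₁ ((hv₁p (h1 ▸ hv)).trans h1.symm).symm) (hvu v hv)) hq
    h₁₂ h₁₃ hb rfl hbc' with
    ⟨φ', h', hb', hφ'⟩ | ⟨v, hqv, hv, T'', hT'', hbT'', hw'⟩
  · refine hswap φ' h' ?_
    rw [hb', hbc', heawoodGraph_isLeft hqv₁]
  · refine absurd (hT''.containsEvenly_of_ear hcol hS (u := u) (v := v) ?_ hbT''
      (by rw [hac', hcu]) (by rw [hbc', heawoodGraph_isLeft hqv]) ?_ hSU hR) hK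
    · rw [hw' u huq (hvu v hqv).symm]
      exact haT'
    · exact fun huv => hv (hv₁u v hqv huv)

end TightPartition

end SimpleGraph

/-! ### Ears in connected braces and the absence of tight cuts -/

namespace SimpleGraph

open Finset

variable {V : Type*} {G : SimpleGraph V} {col : V → Bool}

theorem Subgraph.IsPerfectMatching.exists_involution {M : G.Subgraph} (h : M.IsPerfectMatching) :
    ∃ m : V → V, (∀ x, m (m x) = x ∧ G.Adj x (m x)) ∧ ∀ ⦃x y⦄, M.Adj x y → m x = y := by
  choose m hm hu using fun x => h.1 (h.2 x)
  refine ⟨m, fun x => ⟨(hu (m x) x (hm x).symm).symm, (hm x).adj_sub⟩, fun x y hxy => ?_⟩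
  exact (hu x y hxy).symm

theorem IsExtendable.exists_involution {k : ℕ} (h : G.IsExtendable k) :
    ∃ m : V → V, ∀ x, m (m x) = x ∧ G.Adj x (m x) := by
  obtain ⟨N, hN, -⟩ := h ⊥ (by intro v hv; simp at hv) (by simp)
  obtain ⟨m, hm, -⟩ := hN.exists_involution
  exact ⟨m, hm⟩

theorem IsExtendable.exists_involution_of_adj (h : G.IsExtendable 2) {x y : V}
    (hxy : G.Adj x y) : ∃ m : V → V, (∀ x, m (m x) = x ∧ G.Adj x (m x)) ∧ m x = y := by
  obtain ⟨N, hN, hle⟩ := h (G.subgraphOfAdj hxy) (Subgraph.IsMatching.subgraphOfAdj hxy) (by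
    rw [edgeSet_subgraphOfAdj, Set.encard_singleton]
    exact one_le_two)
  obtain ⟨m, hm, hmN⟩ := hN.exists_involution
  exact ⟨m, hm, hmN (hle.2 (by simp))⟩

theorem IsExtendable.exists_involution_of_adj_of_adj (h : G.IsExtendable 2) {x y x' y' : V}
    (hxy : G.Adj x y) (hxy' : G.Adj x' y') (hxx : x ≠ x') (hxy₁ : x ≠ y') (hyx : y ≠ x')
    (hyy : y ≠ y') :
    ∃ m : V → V, (∀ x, m (m x) = x ∧ G.Adj x (m x)) ∧ m x = y ∧ m x' = y' := by
  obtain ⟨N, hN, hle⟩ := h (G.subgraphOfAdj hxy ⊔ G.subgraphOfAdj hxy')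
    ((Subgraph.IsMatching.subgraphOfAdj hxy).sup (Subgraph.IsMatching.subgraphOfAdj hxy') (by
      rw [support_subgraphOfAdj, support_subgraphOfAdj]
      simp [hxx.symm, hxy₁.symm, hyx.symm, hyy.symm])) (by
    rw [Subgraph.edgeSet_sup, edgeSet_subgraphOfAdj, edgeSet_subgraphOfAdj]
    refine (Set.encard_union_le _ _).trans ?_
    rw [Set.encard_singleton, Set.encard_singleton]
    norm_num)
  obtain ⟨m, hm, hmN⟩ := hN.exists_involution
  exact ⟨m, hm, hmN (hle.2 (by simp)), hmN (hle.2 (by simp))⟩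

theorem Connected.mem_of_closed (h : G.Connected) {A : Set V} {x : V} (hx : x ∈ A)
    (hA : ∀ x ∈ A, ∀ y, G.Adj x y → y ∈ A) (y : V) : y ∈ A := by
  obtain ⟨w⟩ := h.preconnected x y
  induction w with
  | nil => exact hx
  | cons h _ ih => exact ih (hA _ hx _ h)

variable [DecidableEq V]

theorem Paired.of_involution {m : V → V} {R : Finset V}
    (h : ∀ x ∈ R, m x ∈ R ∧ m (m x) = x ∧ G.Adj x (m x)) : G.Paired R := by
  induction R using Finset.strongInduction with
  | H R ih =>
    rcases R.eq_empty_or_nonempty with rfl | ⟨x, hx⟩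
    · exact .empty
    obtain ⟨h1, h2, h3⟩ := h x hx
    have := (ih ((R.erase (m x)).erase x) ?_ ?_).cons h3 (by simp) (by simp)
    · convert this using 1
      ext y
      by_cases hyx : y = x
      · simp [hyx, hx]
      by_cases hym : y = m x
      · simp [hym, h1]
      simp [hyx, hym]
    · refine Finset.ssubset_iff_subset_ne.2 ⟨?_, fun h => ?_⟩
      · exact (Finset.erase_subset _ _).trans (Finset.erase_subset _ _)
      · rw [← h] at hx; simp at hx
    · intro y hy
      simp only [mem_erase] at hy ⊢
      obtain ⟨hyx, hym, hyR⟩ := hy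
      obtain ⟨h4, h5, h6⟩ := h y hyR
      refine ⟨⟨?_, ?_, h4⟩, h5, h6⟩
      · intro h7; exact hym (by rw [← h7, h5])
      · intro h7; exact hyx (by rw [← h5, h7, h2])

variable [Fintype V]

/-- In a connected bipartite graph all whose edges lie in perfect matchings, every nonempty
proper subset of a colour class has more neighbours than elements. -/
theorem IsExtendable.card_lt_card_neighborsIn (hcol : ∀ ⦃x y⦄, G.Adj x y → col y = !col x)
    (hG : G.IsExtendable 2) (hconn : G.Connected) {s : Bool} {X : Finset V}
    (hXs : ∀ x ∈ X, col x = s) (hne : X.Nonempty) (hmiss : ∃ y, col y = s ∧ y ∉ X) :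
    X.card < (G.neighborsIn univ X).card := by
  obtain ⟨z, hz⟩ := hne
  obtain ⟨y, hys, hyX⟩ := hmiss
  -- By connectivity some edge leaves `X` together with its neighbours. A perfect matching through
  -- it sends `X` into the neighbours other than `a`.
  obtain ⟨a, b, ha, hab, hbs, hb⟩ : ∃ a b, a ∈ G.neighborsIn univ X ∧ G.Adj a b ∧ col b = s ∧
      b ∉ X := by
    by_contra hcon
    push Not at hcon
    have hNs : ∀ x ∈ G.neighborsIn univ X, col x = !s := by
      intro x hx
      obtain ⟨-, y, hy, hyx⟩ := mem_neighborsIn.1 hx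
      rw [hcol hyx, hXs y hy]
    have := hconn.mem_of_closed (A := ↑(X ∪ G.neighborsIn univ X)) (x := z) (by simp [hz]) (by
      intro x hx t hxt
      simp only [Finset.mem_coe, mem_union] at hx ⊢
      rcases hx with hx | hx
      · right; rw [mem_neighborsIn]; exact ⟨mem_univ _, x, hx, hxt⟩
      · left; exact hcon x t hx hxt (by rw [hcol hxt, hNs x hx, Bool.not_not])) y
    simp only [Finset.mem_coe, mem_union] at this
    rcases this with h | h
    · exact hyX h
    · have := hNs y h
      rw [hys] at this
      simp at this
  obtain ⟨m, hm, hma⟩ := hG.exists_involution_of_adj hab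
  have hinj : Function.Injective m := fun u v h => by rw [← (hm u).1, h, (hm v).1]
  rw [← Finset.card_image_of_injective X hinj]
  refine Finset.card_lt_card (Finset.ssubset_iff_subset_ne.2 ⟨?_, ?_⟩)
  · intro w hw
    obtain ⟨v, hv, rfl⟩ := mem_image.1 hw
    exact mem_neighborsIn.2 ⟨mem_univ _, v, hv, (hm v).2⟩
  · intro h
    rw [← h] at ha
    obtain ⟨v, hv, rfl⟩ := mem_image.1 ha
    rw [(hm v).1] at hma
    exact hb (hma ▸ hv)

/-- Outside a set `U` with a complement that can be paired up there is an ear with ends in `U`. -/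
theorem IsExtendable.exists_ear (hcol : ∀ ⦃x y⦄, G.Adj x y → col y = !col x)
    (hG : G.IsExtendable 2) (hconn : G.Connected) {U : Finset V} (hU : G.Paired (univ \ U))
    (hUs : ∀ s, ∃ x ∈ U, col x = s) (hne : U ≠ univ) :
    ∃ s a b S, G.Ear col s a b S ∧ a ∈ U ∧ b ∈ U ∧ Disjoint S U ∧ S.Nonempty ∧
      G.Paired (univ \ (U ∪ S)) := by
  classical
  obtain ⟨z, hz⟩ : ∃ z, z ∉ U := by
    by_contra h
    push Not at h
    exact hne (Finset.eq_univ_iff_forall.2 h)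
  obtain ⟨m, hm⟩ := hU.exists_involution
  simp only [mem_sdiff, mem_univ, true_and] at hm
  obtain ⟨s, hs⟩ : ∃ s, col z = s := ⟨_, rfl⟩
  set Y := univ.filter fun x => x ∉ U ∧ col x = s with hY
  have hYs : ∀ y ∈ Y, col y = s := fun y hy => (mem_filter.1 hy).2.2
  have hYU : ∀ y ∈ Y, y ∉ U := fun y hy => (mem_filter.1 hy).2.1
  have hinj : Set.InjOn m Y := by
    intro u hu v hv h
    rw [← (hm u (hYU u hu)).2.1, h, (hm v (hYU v hv)).2.1]
  have hmY : ∀ x, x ∉ U → col x = !s → x ∈ Y.image m := by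
    intro x hx hxs
    obtain ⟨h1, h2, h3⟩ := hm x hx
    refine mem_image.2 ⟨m x, ?_, h2⟩
    rw [hY, mem_filter]
    exact ⟨mem_univ _, h1, by rw [hcol h3, hxs, Bool.not_not]⟩
  have hUm : ∀ t, ∀ X : Finset V, (∀ x ∈ X, x ∉ U) → ∃ y, col y = t ∧ y ∉ X := by
    intro t X hX
    obtain ⟨y, hy, hyt⟩ := hUs t
    exact ⟨y, hyt, fun h => hX y h hy⟩
  -- `Y` has more neighbours than partners, and a neighbour that is not a partner lies in `U`. It
  -- becomes the first end of the ear and the root of an alternating tree outside `U`.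
  obtain ⟨b, hb, hbY⟩ : ∃ b ∈ G.neighborsIn univ Y, b ∉ Y.image m := by
    by_contra hcon
    push Not at hcon
    have h1 := hG.card_lt_card_neighborsIn hcol hconn hYs ⟨z, by simp [hY, hz, hs]⟩
      (hUm s Y hYU)
    have h2 := Finset.card_le_card (show G.neighborsIn univ Y ⊆ Y.image m from hcon)
    rw [Finset.card_image_of_injOn hinj] at h2
    omega
  obtain ⟨-, y₀, hy₀, hy₀b⟩ := mem_neighborsIn.1 hb
  have hbs : col b = !s := by rw [hcol hy₀b, hYs _ hy₀]
  have hbU : b ∈ U := by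
    by_contra h
    exact hbY (hmY b h hbs)
  obtain ⟨Y', hY', htree, hmax⟩ := (AltTree.single (G := G) hbs).grow hcol Y m
    (fun y hy => by rw [hYs y hy, Bool.not_not]) (fun y hy => (hm y (hYU y hy)).2.2) hinj
    (fun y hy h => hYU y hy (by rw [mem_singleton.1 h]; exact hbU))
    (fun y hy h => (hm y (hYU y hy)).1 (by rw [mem_singleton.1 h]; exact hbU))
  have hy₀' : y₀ ∈ Y' := by
    by_contra h
    exact hmax y₀ hy₀ h b (by simp) hy₀b
  have hmU : ∀ x ∈ Y'.image m, x ∉ U := by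
    intro x hx
    obtain ⟨y, hy, rfl⟩ := mem_image.1 hx
    exact (hm y (hYU y (hY' hy))).1
  have hms : ∀ x ∈ Y'.image m, col x = !s := by
    intro x hx
    obtain ⟨y, hy, rfl⟩ := mem_image.1 hx
    rw [hcol (hm y (hYU y (hY' hy))).2.2, hYs y (hY' hy)]
  -- The partners in the maximal tree have more neighbours than `Y'` has elements. By maximality an
  -- additional one lies in `U`; it is the second end.
  obtain ⟨a, ha, haY⟩ : ∃ a ∈ G.neighborsIn univ (Y'.image m), a ∉ Y' := by
    by_contra hcon
    push Not at hcon
    have h1 := hG.card_lt_card_neighborsIn hcol hconn hms ⟨m y₀, mem_image_of_mem _ hy₀'⟩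
      (hUm _ _ hmU)
    have h2 := Finset.card_le_card (show G.neighborsIn univ (Y'.image m) ⊆ Y' from hcon)
    rw [Finset.card_image_of_injOn (hinj.mono (by exact_mod_cast hY'))] at h1
    omega
  obtain ⟨-, c, hc, hca⟩ := mem_neighborsIn.1 ha
  have has : col a = s := by rw [hcol hca, hms c hc, Bool.not_not]
  have haU : a ∈ U := by
    by_contra h
    exact hmax a (by simp [hY, h, has]) haY c (by simp [hc]) hca.symm
  have hBU : ∀ x ∈ {b} ∪ (Y' ∪ Y'.image m), x ∈ U → x = b := by
    intro x hx hxU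
    simp only [mem_union, mem_singleton] at hx
    rcases hx with rfl | hx | hx
    · rfl
    · exact absurd hxU (hYU x (hY' hx))
    · exact absurd hxU (hmU x hx)
  have hab : a ≠ b := by rintro rfl; rw [has] at hbs; simp at hbs
  obtain ⟨S, hSB, hS, hcS, hP⟩ := htree.exists_ear hcol (x := b) (c := c) (b := a) (by simp) hbs
    (by simp only [mem_union]; exact .inr (.inr hc)) (hms c hc) (fun h => hab (hBU a h haU)) hca
  have hSU : Disjoint S U := by
    rw [Finset.disjoint_left]
    intro x hx hxU
    exact hS.left_notMem (hBU x (hSB hx) hxU ▸ hx)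
  refine ⟨_, b, a, S, hS, hbU, haU, hSU, ⟨c, ?_⟩, ?_⟩
  · rcases mem_insert.1 hcS with rfl | h
    · exact absurd hbU (hmU _ hc)
    · exact h
  · have hrest : G.Paired (univ.filter fun x => x ∉ U ∧ x ∉ Y' ∧ x ∉ Y'.image m) := by
      refine Paired.of_involution (m := m) fun x hx => ?_
      simp only [mem_filter, mem_univ, true_and] at hx ⊢
      obtain ⟨h1, h2, h3⟩ := hm x hx.1
      refine ⟨⟨h1, fun h => hx.2.2 (mem_image.2 ⟨_, h, h2⟩), fun h => ?_⟩, h2, h3⟩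
      obtain ⟨y, hy, hyx⟩ := mem_image.1 h
      have h4 := (hm y (hYU y (hY' hy))).2.1
      rw [hyx, h2] at h4
      exact hx.2.1 (h4 ▸ hy)
    convert hP.union hrest ?_ using 1
    · ext x
      have hx4 : x = b → x ∈ U := by rintro rfl; exact hbU
      have hx5 : x ∈ {b} ∪ (Y' ∪ Y'.image m) → x = b ∨ x ∉ U := fun h => by
        by_cases hxU : x ∈ U
        · exact .inl (hBU x h hxU)
        · exact .inr hxU
      have hx6 := @hSB x
      have hx7 : x ∈ {b} ∪ (Y' ∪ Y'.image m) ↔ x = b ∨ x ∈ Y' ∨ x ∈ Y'.image m := by simp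
      rw [mem_sdiff, mem_union, mem_union, mem_sdiff, mem_filter, mem_insert]
      by_cases hxU : x ∈ U
      · have := hx5
        simp only [hxU, not_true_eq_false, or_false] at this
        simp only [hxU, mem_univ, true_or, not_true_eq_false, and_false, false_and, or_false,
          false_iff]
        exact fun h => h.2 (.inl (this h.1))
      · have hxb : x ≠ b := fun h => hxU (hx4 h)
        simp only [hxb, false_or] at hx7
        rw [hx7] at hx6 ⊢
        simp only [hxU, hxb, mem_univ, true_and, false_or, not_false_eq_true]
        by_cases h1 : x ∈ S
        · have := hx6 h1
          simp only [h1, not_true_eq_false, and_false, false_or, false_iff, not_and_or, not_not]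
          exact this
        · by_cases h2 : x ∈ Y' <;> by_cases h3 : x ∈ Y'.image m <;> simp [h1, h2, h3]
    · rw [Finset.disjoint_left]
      intro x hx hx'
      simp only [mem_sdiff, mem_union, mem_singleton, mem_filter, mem_insert] at hx hx'
      rcases hx.1 with h | h | h
      · exact hx.2 (.inl h)
      · exact hx'.2.2.1 h
      · exact hx'.2.2.2 h

namespace TightPartition

/-- A connected brace without `K₃,₃` and with a tight partition of Heawood type has a spanning
one. -/
theorem exists_univ (hcol : ∀ ⦃x y⦄, G.Adj x y → col y = !col x) (hG : G.IsExtendable 2)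
    (hconn : G.Connected)
    (hK : ¬ G.ContainsEvenly (completeBipartiteGraph (Fin 3) (Fin 3)))
    {U : Finset V} {E : SimpleGraph V} {φ : V → ZMod 7 ⊕ ZMod 7}
    (h : TightPartition G col heawoodGraph Sum.isLeft U E φ) :
    ∃ φ, TightPartition G col heawoodGraph Sum.isLeft univ G φ := by
  classical
  obtain ⟨⟨U, E⟩, ⟨φ, h⟩, hmax⟩ := Set.Finite.exists_maximal
    (Set.toFinite {p : Finset V × SimpleGraph V |
      ∃ φ, TightPartition G col heawoodGraph Sum.isLeft p.1 p.2 φ}) ⟨(U, E), φ, h⟩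
  have key : ∀ s a b S, G.Ear col s a b S → a ∈ U → b ∈ U → Disjoint S U →
      G.Paired (univ \ (U ∪ S)) → S ⊆ U ∧ (G.Adj a b → E.Adj a b) := by
    intro s a b S hS ha hb hSU hR
    obtain ⟨E', φ', h', hE, hab⟩ := h.exists_add_ear hcol hK hS ha hb hSU hR
    have := hmax (y := (U ∪ S, E')) ⟨φ', h'⟩ ⟨Finset.subset_union_left, hE⟩
    exact ⟨Finset.subset_union_right.trans this.1, fun hadj => this.2 (hab hadj)⟩
  have hU : U = univ := by
    by_contra hne
    obtain ⟨s, a, b, S, hS, ha, hb, hSU, ⟨x, hx⟩, hR⟩ := hG.exists_ear hcol hconn h.paired (by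
      intro s
      obtain ⟨w, -, hw⟩ := exists_ne_isLeft_eq s (.inl 0)
      obtain ⟨x, hx, -, hxw⟩ := h.exists_main w
      exact ⟨x, hx, hxw.trans hw⟩) hne
    exact Finset.disjoint_left.1 hSU hx ((key s a b S hS ha hb hSU hR).1 hx)
  subst hU
  have hE : E = G := by
    refine le_antisymm h.le fun a b hab => ?_
    -- Once all vertices are used, single edges are ears with empty interior.
    exact (key (col a) a b ∅ (Ear.of_adj hcol rfl hab) (mem_univ _) (mem_univ _) (by simp)
      (by simpa using Paired.empty)).2 hab
  subst hE
  exact ⟨φ, h⟩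

variable {W : Type*} [Fintype W] [DecidableEq W] {J : SimpleGraph W} {c : W → Bool} {φ : V → W}

/-- Two disjoint edges leaving a class extend to a perfect matching that wastes two main vertices,
leaving too few for the minority vertices. So all leaving edges meet pairwise; as they lead to two
different classes, they share one end `x₁`. If there is a minority vertex, the outside vertices of
its colour then have too few neighbours for Hall's strict condition. -/
theorem filter_eq_empty (hcol : ∀ ⦃x y⦄, G.Adj x y → col y = !col x) (hG : G.IsExtendable 2)
    (hc : ∀ ⦃x y⦄, J.Adj x y → c y = !c x) (h : TightPartition G col J c univ G φ) {w v₁ v₂ : W}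
    (hv₁ : J.Adj w v₁) (hv₂ : J.Adj w v₂) (hne : v₁ ≠ v₂) :
    univ.filter (fun x => φ x = w ∧ col x = !c w) = ∅ := by
  by_contra hX
  set X := univ.filter (fun x => φ x = w ∧ col x = !c w) with hXdef
  set A := univ.filter (fun x => φ x = w ∧ col x = c w) with hAdef
  have hcard : A.card = X.card + 1 := h.card w
  have hstar : ∀ x y x' y', G.Adj x y → G.Adj x' y' → x ∈ A → x' ∈ A → φ y ≠ w → φ y' ≠ w →
      x = x' ∨ y = y' := by
    intro x y x' y' hxy hxy' hx hx' hy hy'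
    by_contra hcon
    push Not at hcon
    have hxw := (mem_filter.1 hx).2.1
    have hxw' := (mem_filter.1 hx').2.1
    obtain ⟨m, hm, hmx, hmx'⟩ := hG.exists_involution_of_adj_of_adj hxy hxy' hcon.1
      (by rintro rfl; exact hy' hxw) (by rintro rfl; exact hy hxw') hcon.2
    have hinj : Function.Injective m := fun u v h => by rw [← (hm u).1, h, (hm v).1]
    have hsub : X.image m ⊆ (A.erase x).erase x' := by
      intro u hu
      obtain ⟨z, hz, rfl⟩ := mem_image.1 hu
      obtain ⟨-, hzw, hzc⟩ := mem_filter.1 hz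
      rw [mem_erase, mem_erase, hAdef, mem_filter]
      refine ⟨?_, ?_, mem_univ _, ?_, ?_⟩
      · intro h1; rw [← h1, (hm z).1] at hmx'; exact hy' (hmx' ▸ hzw)
      · intro h1; rw [← h1, (hm z).1] at hmx; exact hy (hmx ▸ hzw)
      · rcases h.tight (hm z).2 with h1 | ⟨-, h1, -⟩
        · rw [← h1, hzw]
        · rw [hzc, hzw] at h1; simp at h1
      · rw [hcol (hm z).2, hzc, Bool.not_not]
    have h1 := Finset.card_le_card hsub
    have h2 := Finset.card_erase_add_one hx
    have h3 := Finset.card_erase_add_one (mem_erase.2 ⟨Ne.symm hcon.1, hx'⟩)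
    rw [Finset.card_image_of_injective X hinj] at h1
    omega
  obtain ⟨x₁, y₁, hxy₁, hx₁, hy₁, hxc₁, hyc₁⟩ := h.full hv₁
  obtain ⟨x₂, y₂, hxy₂, hx₂, hy₂, hxc₂, -⟩ := h.full hv₂
  have hA₁ : x₁ ∈ A := by simp [hAdef, hx₁, hxc₁]
  have hA₂ : x₂ ∈ A := by simp [hAdef, hx₂, hxc₂]
  have hyw₁ : φ y₁ ≠ w := hy₁ ▸ hv₁.ne'
  have hyw₂ : φ y₂ ≠ w := hy₂ ▸ hv₂.ne'
  have hyy : y₁ ≠ y₂ := by rintro rfl; exact hne (hy₁.symm.trans hy₂)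
  have hx₁₂ : x₁ = x₂ := (hstar _ _ _ _ hxy₁ hxy₂ hA₁ hA₂ hyw₁ hyw₂).resolve_right hyy
  have hall : ∀ x y, G.Adj x y → x ∈ A → φ y ≠ w → x = x₁ := by
    intro x y hxy hx hy
    rcases hstar _ _ _ _ hxy hxy₁ hx hA₁ hy hyw₁ with h1 | h1
    · exact h1
    rcases hstar _ _ _ _ hxy hxy₂ hx hA₂ hy hyw₂ with h2 | h2
    · exact h2.trans hx₁₂.symm
    · exact absurd (h1.symm.trans h2) hyy
  obtain ⟨m, hm⟩ := hG.exists_involution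
  have hinj : Function.Injective m := fun u v h => by rw [← (hm u).1, h, (hm v).1]
  have hbal : (univ.filter fun x => col x = c w).card = (univ.filter fun x => col x = !c w).card := by
    rw [← Finset.card_image_of_injective _ hinj]
    congr 1
    ext x
    simp only [mem_image, mem_filter, mem_univ, true_and]
    constructor
    · rintro ⟨y, hy, rfl⟩
      rw [hcol (hm y).2, hy]
    · intro hx
      exact ⟨m x, by rw [hcol (hm x).2, hx, Bool.not_not], (hm x).1⟩
  have hsplit : ∀ s, (univ.filter fun x => col x = s).card =
      (univ.filter fun x => φ x = w ∧ col x = s).card +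
      (univ.filter fun x => φ x ≠ w ∧ col x = s).card := by
    intro s
    rw [← Finset.card_filter_add_card_filter_not (s := univ.filter fun x => col x = s)
      (fun x => φ x = w), Finset.filter_filter, Finset.filter_filter]
    congr 2
    · exact Finset.filter_congr fun x _ => and_comm
    · exact Finset.filter_congr fun x _ => and_comm
  have h1 := hsplit (c w)
  have h2 := hsplit (!c w)
  rw [← hAdef] at h1
  rw [← hXdef] at h2
  obtain ⟨z, hz⟩ := Finset.nonempty_iff_ne_empty.2 hX
  have hzX := (mem_filter.1 hz).2
  -- By global balance these outside vertices outnumber those of the main colour by one, while `x₁`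
  -- is their only neighbour inside the class.
  have h3 := h.hall (!c w) (univ.filter fun x => φ x ≠ w ∧ col x = !c w) (Finset.subset_univ _)
    (by simp) ⟨y₁, by simp [hyw₁, hyc₁, hc hv₁]⟩ ⟨z, mem_univ _, hzX.2, by simp [hzX.1]⟩
  have h4 := (Finset.card_le_card
    (s := G.neighborsIn univ (univ.filter fun x => φ x ≠ w ∧ col x = !c w))
    (t := insert x₁ (univ.filter fun x => φ x ≠ w ∧ col x = c w)) (by
    intro x hx
    obtain ⟨-, y, hy, hyx⟩ := mem_neighborsIn.1 hx
    simp only [mem_filter, mem_univ, true_and] at hy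
    have hxc : col x = c w := by rw [hcol hyx, hy.2, Bool.not_not]
    rw [mem_insert, mem_filter]
    by_cases hxw : φ x = w
    · exact .inl (hall x y hyx.symm (by simp [hAdef, hxw, hxc]) hy.1)
    · exact .inr ⟨mem_univ _, hxw, hxc⟩)).trans (Finset.card_insert_le _ _)
  omega

/-- Without minority vertices the surplus of one makes every class a singleton. Then `tight` and
`full` say that `φ` preserves and reflects adjacency. -/
theorem nonempty_iso (hcol : ∀ ⦃x y⦄, G.Adj x y → col y = !col x) (hG : G.IsExtendable 2)
    (hc : ∀ ⦃x y⦄, J.Adj x y → c y = !c x)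
    (hJ : ∀ w, ∃ v₁ v₂, J.Adj w v₁ ∧ J.Adj w v₂ ∧ v₁ ≠ v₂)
    (h : TightPartition G col J c univ G φ) : Nonempty (G ≃g J) := by
  have hempty : ∀ w, univ.filter (fun x => φ x = w ∧ col x = !c w) = ∅ := by
    intro w
    obtain ⟨v₁, v₂, h1, h2, h3⟩ := hJ w
    exact h.filter_eq_empty hcol hG hc h1 h2 h3
  have hmain : ∀ x, col x = c (φ x) := by
    intro x
    by_contra hx
    have : x ∈ univ.filter (fun y => φ y = φ x ∧ col y = !c (φ x)) := by
      simpa using Bool.eq_not_of_ne hx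
    rw [hempty] at this
    simp at this
  have hinj : Function.Injective φ := by
    intro x y hxy
    have h1 := h.card (φ y)
    rw [hempty, Finset.card_empty, zero_add] at h1
    exact Finset.card_le_one.1 h1.le x (by simp [hxy, hmain x]) y (by simp [hmain y])
  have hsurj : Function.Surjective φ := fun w => by
    obtain ⟨x, -, hx, -⟩ := h.exists_main w
    exact ⟨x, hx⟩
  refine ⟨Equiv.ofBijective φ ⟨hinj, hsurj⟩, fun {x y} => ?_⟩
  · change J.Adj (φ x) (φ y) ↔ G.Adj x y
    constructor
    · intro hxy
      obtain ⟨x', y', hxy', hx, hy, -⟩ := h.full hxy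
      rwa [hinj hx, hinj hy] at hxy'
    · intro hxy
      rcases h.tight hxy with h1 | h1
      · exact absurd (hinj h1) hxy.ne
      · exact h1.1

end TightPartition

end SimpleGraph

/-! ### From an even subdivision to a tight partition -/

namespace SimpleGraph

open Finset

variable {V : Type*} [DecidableEq V] {G : SimpleGraph V} {col : V → Bool}

/-- Alternating trees that share exactly one vertex, a potential leaf, can be merged. -/
theorem AltTree.biUnion (hcol : ∀ ⦃x y⦄, G.Adj x y → col y = !col x) {s : Bool} {a : V}
    (ha : col a = s) {ι : Type*} [DecidableEq ι] (L : Finset ι) (I : ι → Finset V)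
    (h : ∀ i ∈ L, G.AltTree col s (insert a (I i))) (hd : (L : Set ι).PairwiseDisjoint I) :
    G.AltTree col s (insert a (L.biUnion I)) := by
  induction L using Finset.induction_on with
  | empty => simpa using AltTree.single ha
  | insert i L hi ih =>
    have h1 := (ih (fun j hj => h j (by simp [hj])) (hd.subset (by simp))).union hcol
      (h i (by simp)) ha (by simp) (by simp) (by
        intro w hw hw'
        rcases mem_insert.1 hw with rfl | hw
        · rfl
        rcases mem_insert.1 hw' with rfl | hw'
        · rfl
        obtain ⟨j, hj, hwj⟩ := mem_biUnion.1 hw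
        exact absurd hw' (Finset.disjoint_left.1
          (hd (by simp [hj]) (by simp) (by rintro rfl; exact hi hj)) hwj))
    convert h1 using 1
    ext w
    simp only [Finset.biUnion_insert, mem_insert, mem_union]
    tauto

/-- An even subdivision of `J` with branch vertices `f w` and sets `I w v` of interior vertices of
the subdivided edges. -/
structure EarSubdivision {V W : Type*} [DecidableEq V] (G : SimpleGraph V) (col : V → Bool)
    (J : SimpleGraph W) (c : W → Bool) (U : Finset V) (f : W → V) (I : W → W → Finset V) :
    Prop where
  injective : Function.Injective f
  col_eq : ∀ w, col (f w) = c w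
  comm : ∀ w v, I w v = I v w
  ear : ∀ ⦃w v⦄, J.Adj w v → G.Ear col (c w) (f w) (f v) (I w v)
  notMem : ∀ ⦃w v⦄, J.Adj w v → ∀ u, f u ∉ I w v
  disjoint : ∀ ⦃w v w' v'⦄, J.Adj w v → J.Adj w' v' → s(w, v) ≠ s(w', v') →
    Disjoint (I w v) (I w' v')
  mem_iff : ∀ x, x ∈ U ↔ (∃ w, f w = x) ∨ ∃ w v, J.Adj w v ∧ x ∈ I w v
  adj : ∀ ⦃x y⦄, G.Adj x y → ∃ w v, J.Adj w v ∧ x ∈ insert (f w) (insert (f v) (I w v)) ∧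
    y ∈ insert (f w) (insert (f v) (I w v))

variable {W : Type*} [Fintype W] [DecidableEq W] {J : SimpleGraph W} {c : W → Bool}
  {U : Finset V} {f : W → V} {I : W → W → Finset V}

namespace EarSubdivision

open Classical in
/-- The branch vertex of `w` together with the interiors of the subdivided edges that are
directed to `w` by the orientation `o`. -/
noncomputable def star (J : SimpleGraph W) (f : W → V) (I : W → W → Finset V) (o : W → W → Prop)
    (w : W) : Finset V :=
  insert (f w) ((univ.filter fun v => J.Adj w v ∧ o w v).biUnion (I w))

theorem mem_star {o : W → W → Prop} {w : W} {x : V} :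
    x ∈ star J f I o w ↔ x = f w ∨ ∃ v, J.Adj w v ∧ o w v ∧ x ∈ I w v := by
  simp [star, and_assoc]

/-- The interior of an ear forms an alternating tree with either end, so the orientation is free to
choose which end receives it. The ears at a vertex meet only there and merge into one tree. -/
theorem treeModel (hcol : ∀ ⦃x y⦄, G.Adj x y → col y = !col x)
    (hc : ∀ ⦃x y⦄, J.Adj x y → c y = !c x) (h : G.EarSubdivision col J c U f I)
    {o : W → W → Prop} (ho : ∀ ⦃w v⦄, J.Adj w v → (o v w ↔ ¬ o w v)) :
    G.TreeModel col U J c (star J f I o) where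
  subset w x hx := by
    rw [h.mem_iff]
    rcases mem_star.1 hx with rfl | ⟨v, hwv, -, hx⟩
    · exact .inl ⟨w, rfl⟩
    · exact .inr ⟨w, v, hwv, hx⟩
  disjoint u v huv := by
    rw [Finset.disjoint_left]
    intro x hx hx'
    rcases mem_star.1 hx with rfl | ⟨u', huu, hou, hx⟩ <;>
      rcases mem_star.1 hx' with hx' | ⟨v', hvv, hov, hx'⟩
    · exact huv (h.injective hx')
    · exact h.notMem hvv u hx'
    · exact h.notMem huu v (hx' ▸ hx)
    · by_cases he : s(u, u') = s(v, v')
      · rcases Sym2.eq_iff.1 he with ⟨h1, -⟩ | ⟨rfl, rfl⟩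
        · exact huv h1
        · exact (ho hvv).1 hou hov
      · exact Finset.disjoint_left.1 (h.disjoint huu hvv he) hx hx'
  tree w := by
    refine AltTree.biUnion hcol (h.col_eq w) _ _ (fun v hv => ?_) fun v hv v' hv' hne => ?_
    · simp only [mem_filter] at hv
      exact (h.ear hv.2.1).left_tree
    · simp only [coe_filter, Set.mem_ofPred_eq] at hv hv'
      refine h.disjoint hv.2.1 hv'.2.1 fun he => ?_
      rcases Sym2.eq_iff.1 he with ⟨-, h1⟩ | ⟨h1, h2⟩
      · exact hne h1
      · exact hne (h2.trans h1)
  exists_adj u v huv := by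
    by_cases hou : o u v
    · obtain ⟨z, hz, hzc, hzv⟩ := (h.ear huv).right_adj
      refine ⟨z, ?_, f v, mem_star.2 (.inl rfl), hzc, h.col_eq v, hzv⟩
      rcases mem_insert.1 hz with rfl | hz
      · exact mem_star.2 (.inl rfl)
      · exact mem_star.2 (.inr ⟨v, huv, hou, hz⟩)
    · obtain ⟨z, hz, hzc, hzu⟩ := (h.ear huv).left_adj
      refine ⟨f u, mem_star.2 (.inl rfl), z, ?_, h.col_eq u, hzc.trans (hc huv).symm, hzu.symm⟩
      rcases mem_insert.1 hz with rfl | hz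
      · exact mem_star.2 (.inl rfl)
      · exact mem_star.2 (.inr ⟨u, huv.symm, (ho huv).2 hou, h.comm u v ▸ hz⟩)
  rest := by
    have : U \ univ.biUnion (star J f I o) = ∅ := by
      rw [Finset.sdiff_eq_empty_iff_subset]
      intro x hx
      rw [mem_biUnion]
      rcases (h.mem_iff x).1 hx with ⟨w, rfl⟩ | ⟨w, v, hwv, hx⟩
      · exact ⟨w, mem_univ _, mem_star.2 (.inl rfl)⟩
      by_cases how : o w v
      · exact ⟨w, mem_univ _, mem_star.2 (.inr ⟨v, hwv, how, hx⟩)⟩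
      · exact ⟨v, mem_univ _, mem_star.2 (.inr ⟨w, hwv.symm, (ho hwv).2 how, h.comm w v ▸ hx⟩)⟩
    rw [this]
    exact .empty

/-- Two vertices of different colours that are not in the interior of the same subdivided edge can
be deleted. -/
theorem paired_sdiff (hcol : ∀ ⦃x y⦄, G.Adj x y → col y = !col x)
    (hc : ∀ ⦃x y⦄, J.Adj x y → c y = !c x) (h : G.EarSubdivision col J c U f I)
    (hJ : ∀ u v, c v = !c u → J.Paired (univ \ {u, v})) {a b : V} (ha : a ∈ U) (hb : b ∈ U)
    (hab : col b = !col a) (hI : ∀ w v, J.Adj w v → a ∈ I w v → b ∉ I w v) :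
    G.Paired (U \ {a, b}) := by
  -- A subdivided edge with `a` or `b` in its interior is directed to the end of that vertex's
  -- colour, making the vertex a potential leaf of its tree. All other edges are directed to the
  -- colour `true`.
  set o : W → W → Prop := fun w v => (a ∈ I w v ∧ c w = col a) ∨
    (a ∉ I w v ∧ b ∈ I w v ∧ c w = col b) ∨ (a ∉ I w v ∧ b ∉ I w v ∧ c w = true) with hodef
  have ho : ∀ ⦃w v⦄, J.Adj w v → (o v w ↔ ¬ o w v) := by
    intro w v hwv
    simp only [hodef, h.comm v w, hc hwv]
    by_cases h1 : a ∈ I w v <;> by_cases h2 : b ∈ I w v <;> cases c w <;> cases col a <;>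
      cases col b <;> simp [h1, h2]
  have hT := h.treeModel hcol hc ho
  have hcc : ∀ w v, J.Adj w v → ∀ t : Bool, c w = t ∨ c v = t := by
    intro w v hwv t
    rw [hc hwv]
    cases c w <;> cases t <;> simp
  obtain ⟨u, hau, hcu⟩ : ∃ u, a ∈ star J f I o u ∧ col a = c u := by
    rcases (h.mem_iff a).1 ha with ⟨w, rfl⟩ | ⟨w, v, hwv, hx⟩
    · exact ⟨w, mem_star.2 (.inl rfl), h.col_eq w⟩
    rcases hcc w v hwv (col a) with h1 | h1
    · exact ⟨w, mem_star.2 (.inr ⟨v, hwv, .inl ⟨hx, h1⟩, hx⟩), h1.symm⟩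
    · rw [h.comm] at hx
      exact ⟨v, mem_star.2 (.inr ⟨w, hwv.symm, .inl ⟨hx, h1⟩, hx⟩), h1.symm⟩
  obtain ⟨v, hbv, hcv⟩ : ∃ u, b ∈ star J f I o u ∧ col b = c u := by
    rcases (h.mem_iff b).1 hb with ⟨w, rfl⟩ | ⟨w, v, hwv, hx⟩
    · exact ⟨w, mem_star.2 (.inl rfl), h.col_eq w⟩
    have hna : a ∉ I w v := fun h => hI w v hwv h hx
    rcases hcc w v hwv (col b) with h1 | h1
    · exact ⟨w, mem_star.2 (.inr ⟨v, hwv, .inr (.inl ⟨hna, hx, h1⟩), hx⟩), h1.symm⟩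
    · rw [h.comm] at hx hna
      exact ⟨v, mem_star.2 (.inr ⟨w, hwv.symm, .inr (.inl ⟨hna, hx, h1⟩), hx⟩), h1.symm⟩
  have hcuv : c v = !c u := by rw [← hcv, ← hcu, hab]
  have huv : u ≠ v := by rintro rfl; exact (Bool.not_ne_self _).symm hcuv
  have hd := hT.disjoint u v huv
  have h1 := (((hT.tree u).paired_erase hcol hau hcu).union
    ((hT.tree v).paired_erase hcol hbv hcv)
    (hd.mono (Finset.erase_subset _ _) (Finset.erase_subset _ _))).union
    (Paired.biUnion_model hcol hT (hJ u v hcuv)) (by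
      rw [Finset.disjoint_biUnion_right]
      intro w hw
      simp only [mem_sdiff, mem_univ, mem_insert, mem_singleton, true_and, not_or] at hw
      rw [Finset.disjoint_union_left]
      exact ⟨(hT.disjoint _ _ (Ne.symm hw.1)).mono_left (Finset.erase_subset _ _),
        (hT.disjoint _ _ (Ne.symm hw.2)).mono_left (Finset.erase_subset _ _)⟩)
  have hav : a ∉ star J f I o v := Finset.disjoint_left.1 hd hau
  have hbu : b ∉ star J f I o u := Finset.disjoint_right.1 hd hbv
  have haw : ∀ w, a ∈ star J f I o w → w = u := fun w hw => by
    by_contra hne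
    exact Finset.disjoint_left.1 (hT.disjoint w u hne) hw hau
  have hbw : ∀ w, b ∈ star J f I o w → w = v := fun w hw => by
    by_contra hne
    exact Finset.disjoint_left.1 (hT.disjoint w v hne) hw hbv
  have hUT : ∀ x ∈ U, ∃ w, x ∈ star J f I o w := by
    intro x hx
    rcases (h.mem_iff x).1 hx with ⟨w, rfl⟩ | ⟨w, v, hwv, hx⟩
    · exact ⟨w, mem_star.2 (.inl rfl)⟩
    by_cases how : o w v
    · exact ⟨w, mem_star.2 (.inr ⟨v, hwv, how, hx⟩)⟩
    · exact ⟨v, mem_star.2 (.inr ⟨w, hwv.symm, (ho hwv).2 how, h.comm w v ▸ hx⟩)⟩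
  convert h1 using 1
  ext x
  simp only [mem_sdiff, mem_insert, mem_singleton, not_or, mem_union, mem_erase, mem_biUnion,
    mem_univ, true_and]
  constructor
  · rintro ⟨hxU, hxa, hxb⟩
    obtain ⟨w, hw⟩ := hUT x hxU
    by_cases hwu : w = u
    · subst hwu; exact .inl (.inl ⟨hxa, hw⟩)
    by_cases hwv : w = v
    · subst hwv; exact .inl (.inr ⟨hxb, hw⟩)
    exact .inr ⟨w, ⟨hwu, hwv⟩, hw⟩
  · rintro ((⟨hxa, hx⟩ | ⟨hxb, hx⟩) | ⟨w, ⟨hwu, hwv⟩, hx⟩)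
    · exact ⟨hT.subset _ hx, hxa, by rintro rfl; exact hbu hx⟩
    · exact ⟨hT.subset _ hx, by rintro rfl; exact hav hx, hxb⟩
    · exact ⟨hT.subset _ hx, by rintro rfl; exact hwu (haw w hx),
        by rintro rfl; exact hwv (hbw w hx)⟩

/-- The pairing of the other vertices of `U` sends `X` injectively into its neighbours other than
`b`. -/
theorem card_lt_card_neighborsIn_of_paired (hcol : ∀ ⦃x y⦄, G.Adj x y → col y = !col x)
    {s : Bool} {X : Finset V} (hXU : X ⊆ U) (hXs : ∀ x ∈ X, col x = s) {y b : V} (hy : y ∉ X)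
    (hb : b ∈ G.neighborsIn U X) (h : G.Paired (U \ {y, b})) :
    X.card < (G.neighborsIn U X).card := by
  obtain ⟨m, hm⟩ := h.exists_involution
  have hbX : b ∉ X := by
    intro hbX
    obtain ⟨-, z, hz, hzb⟩ := mem_neighborsIn.1 hb
    have := hcol hzb
    rw [hXs z hz, hXs b hbX] at this
    simp at this
  have hX : ∀ x ∈ X, x ∈ U \ {y, b} := by
    intro x hx
    simp only [mem_sdiff, mem_insert, mem_singleton, not_or]
    exact ⟨hXU hx, by rintro rfl; exact hy hx, by rintro rfl; exact hbX hx⟩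
  have hinj : Set.InjOn m X := fun u hu v hv h => by
    rw [← (hm u (hX u hu)).2.1, h, (hm v (hX v hv)).2.1]
  rw [← Finset.card_image_of_injOn hinj]
  refine Finset.card_lt_card (Finset.ssubset_iff_subset_ne.2 ⟨?_, ?_⟩)
  · intro w hw
    obtain ⟨v, hv, rfl⟩ := mem_image.1 hw
    have h1 := hm v (hX v hv)
    exact mem_neighborsIn.2 ⟨(mem_sdiff.1 h1.1).1, v, hv, h1.2.2⟩
  · intro h
    rw [← h] at hb
    obtain ⟨v, hv, rfl⟩ := mem_image.1 hb
    have h1 := (hm v (hX v hv)).1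
    simp at h1

/-- It suffices to find a vertex outside `X` of its colour and a neighbour of `X` that are not
interior to the same subdivided edge. If `y` and `b` are, use a branch vertex `f u` of the
neighbours' colour off that edge: it replaces `b` if it is a neighbour of `X`; otherwise a neighbour
of `f u` on another subdivided edge replaces `y`. -/
theorem card_lt_card_neighborsIn (hcol : ∀ ⦃x y⦄, G.Adj x y → col y = !col x)
    (hc : ∀ ⦃x y⦄, J.Adj x y → c y = !c x) (h : G.EarSubdivision col J c U f I)
    (hJ : ∀ u v, c v = !c u → J.Paired (univ \ {u, v})) (hJadj : ∀ w, ∃ v, J.Adj w v)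
    (hJc : ∀ s w v, J.Adj w v → ∃ u, c u = s ∧ u ≠ w ∧ u ≠ v) {s : Bool} {X : Finset V}
    (hXU : X ⊆ U) (hXs : ∀ x ∈ X, col x = s) (hne : X.Nonempty)
    (hmiss : ∃ y ∈ U, col y = s ∧ y ∉ X) : X.card < (G.neighborsIn U X).card := by
  obtain ⟨y, hyU, hys, hyX⟩ := hmiss
  have hgood : ∀ y ∈ U, col y = s → y ∉ X → ∀ b ∈ G.neighborsIn U X,
      (∀ w v, J.Adj w v → y ∈ I w v → b ∉ I w v) → X.card < (G.neighborsIn U X).card := by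
    intro y hyU hys hyX b hb hI
    refine card_lt_card_neighborsIn_of_paired hcol hXU hXs hyX hb
      (h.paired_sdiff hcol hc hJ hyU (neighborsIn_subset hb) ?_ hI)
    obtain ⟨-, z, hz, hzb⟩ := mem_neighborsIn.1 hb
    rw [hcol hzb, hXs z hz, hys]
  have hfU : ∀ w, f w ∈ U := fun w => (h.mem_iff _).2 (.inl ⟨w, rfl⟩)
  have hex : ∃ w v, J.Adj w v := by
    rcases (h.mem_iff y).1 hyU with ⟨w, -⟩ | ⟨w, v, hwv, -⟩
    · exact ⟨w, hJadj w⟩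
    · exact ⟨w, v, hwv⟩
  obtain ⟨b, hb⟩ : (G.neighborsIn U X).Nonempty := by
    obtain ⟨w, v, hwv⟩ := hex
    obtain ⟨u, hu, -⟩ := hJc (!s) w v hwv
    have hP := h.paired_sdiff hcol hc hJ hyU (hfU u) (by rw [h.col_eq, hu, hys])
      (fun w v hwv _ => h.notMem hwv u)
    obtain ⟨m, hm⟩ := hP.exists_involution
    obtain ⟨x, hx⟩ := hne
    have h1 := hm x (by
      simp only [mem_sdiff, mem_insert, mem_singleton, not_or]
      refine ⟨hXU hx, by rintro rfl; exact hyX hx, ?_⟩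
      rintro rfl
      have := hXs _ hx
      rw [h.col_eq, hu] at this
      simp at this)
    exact ⟨m x, mem_neighborsIn.2 ⟨(mem_sdiff.1 h1.1).1, x, hx, h1.2.2⟩⟩
  by_cases hI : ∀ w v, J.Adj w v → y ∈ I w v → b ∉ I w v
  · exact hgood y hyU hys hyX b hb hI
  push Not at hI
  obtain ⟨w, v, hwv, hy, hbI⟩ := hI
  obtain ⟨u, hu, huw, huv⟩ := hJc (!s) w v hwv
  by_cases hfu : f u ∈ G.neighborsIn U X
  · exact hgood y hyU hys hyX _ hfu fun w' v' hwv' _ => h.notMem hwv' u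
  obtain ⟨t, hut⟩ := hJadj u
  have hct : c t = s := by rw [hc hut, hu, Bool.not_not]
  obtain ⟨z, hz, hzs, hzu⟩ := (h.ear hut.symm).right_adj
  have hzU : z ∈ U := by
    rcases mem_insert.1 hz with rfl | hz
    · exact hfU t
    · exact (h.mem_iff z).2 (.inr ⟨t, u, hut.symm, hz⟩)
  refine hgood z hzU (hzs.trans hct)
    (fun hzX => hfu (mem_neighborsIn.2 ⟨hfU u, z, hzX, hzu⟩)) b hb fun w' v' hwv' hz' hb' => ?_
  rcases mem_insert.1 hz with rfl | hz
  · exact h.notMem hwv' t hz'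
  have he : s(t, u) = s(w', v') := by
    by_contra hne
    exact Finset.disjoint_left.1 (h.disjoint hut.symm hwv' hne) hz hz'
  have he' : s(w, v) = s(w', v') := by
    by_contra hne
    exact Finset.disjoint_left.1 (h.disjoint hwv hwv' hne) hbI hb'
  rcases Sym2.eq_iff.1 (he.trans he'.symm) with ⟨-, h1⟩ | ⟨-, h1⟩
  · exact huv h1
  · exact huw h1

variable [Fintype V] {E : SimpleGraph V}

/-- Directing every subdivided edge to its end of colour `true` partitions `U` into trees. Each ear
lies in one class except for its other end, so edges between classes follow `J`. -/
theorem exists_tightPartition (hcol : ∀ ⦃x y⦄, G.Adj x y → col y = !col x)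
    (hc : ∀ ⦃x y⦄, J.Adj x y → c y = !c x) (hE : E ≤ G) (h : E.EarSubdivision col J c U f I)
    (hJ : ∀ u v, c v = !c u → J.Paired (univ \ {u, v})) (hJadj : ∀ w, ∃ v, J.Adj w v)
    (hJc : ∀ s w v, J.Adj w v → ∃ u, c u = s ∧ u ≠ w ∧ u ≠ v) [Nonempty W]
    (hU : G.Paired (univ \ U)) : ∃ φ, TightPartition G col J c U E φ := by
  classical
  have hcol' : ∀ ⦃x y⦄, E.Adj x y → col y = !col x := fun x y hxy => hcol (hE hxy)
  have ho : ∀ ⦃w v⦄, J.Adj w v → (c v = true ↔ ¬ c w = true) := by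
    intro w v hwv
    rw [hc hwv]
    cases c w <;> simp
  have hT := h.treeModel hcol' hc (o := fun w _ => c w = true) fun w v hwv => ho hwv
  set T := star J f I fun w _ => c w = true with hTdef
  have hex : ∀ x, ∃ w, x ∈ U → x ∈ T w := by
    intro x
    by_cases hx : x ∈ U
    · rcases (h.mem_iff x).1 hx with ⟨w, rfl⟩ | ⟨w, v, hwv, hx⟩
      · exact ⟨w, fun _ => mem_star.2 (.inl rfl)⟩
      by_cases how : c w = true
      · exact ⟨w, fun _ => mem_star.2 (.inr ⟨v, hwv, how, hx⟩)⟩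
      · exact ⟨v, fun _ => mem_star.2 (.inr ⟨w, hwv.symm, (ho hwv).2 how, h.comm w v ▸ hx⟩)⟩
    · exact ⟨Classical.arbitrary W, fun h => absurd h hx⟩
  choose φ hφ using hex
  have hφT : ∀ w, ∀ x ∈ T w, φ x = w := by
    intro w x hx
    by_contra hne
    exact Finset.disjoint_left.1 (hT.disjoint _ _ hne) (hφ x (hT.subset w hx)) hx
  have hfφ : ∀ w, φ (f w) = w := fun w => hφT w _ (mem_star.2 (.inl rfl))
  have hfilter : ∀ w s, (U.filter fun x => φ x = w ∧ col x = s) =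
      (T w).filter fun x => col x = s := by
    intro w s
    ext x
    simp only [mem_filter]
    constructor
    · rintro ⟨hx, rfl, hxs⟩
      exact ⟨hφ x hx, hxs⟩
    · rintro ⟨hx, hxs⟩
      exact ⟨hT.subset w hx, hφT w x hx, hxs⟩
  refine ⟨φ, hE, ?_, hU, ?_, ?_, ?_, ?_⟩
  · intro x y hxy
    obtain ⟨w, v, hwv, hx, -⟩ := h.adj hxy
    rw [h.mem_iff]
    simp only [mem_insert] at hx
    rcases hx with rfl | rfl | hx
    · exact .inl ⟨w, rfl⟩
    · exact .inl ⟨v, rfl⟩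
    · exact .inr ⟨w, v, hwv, hx⟩
  · intro s X hXU hXs hne hmiss
    exact h.card_lt_card_neighborsIn hcol' hc hJ hJadj hJc hXU hXs hne hmiss
  · intro w
    rw [hfilter, hfilter]
    exact (hT.tree w).card hcol'
  · intro x y hxy
    obtain ⟨w, v, hwv, hcw, hx, hy⟩ : ∃ w v, J.Adj w v ∧ c w = true ∧
        x ∈ insert (f w) (insert (f v) (I w v)) ∧ y ∈ insert (f w) (insert (f v) (I w v)) := by
      obtain ⟨w, v, hwv, hx, hy⟩ := h.adj hxy
      by_cases hcw : c w = true
      · exact ⟨w, v, hwv, hcw, hx, hy⟩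
      · refine ⟨v, w, hwv.symm, (ho hwv).2 hcw, ?_, ?_⟩ <;>
          rwa [h.comm v w, Finset.insert_comm]
    have hw : ∀ z ∈ insert (f w) (I w v), φ z = w := by
      intro z hz
      refine hφT w z (mem_star.2 ?_)
      rcases mem_insert.1 hz with rfl | hz
      · exact .inl rfl
      · exact .inr ⟨v, hwv, hcw, hz⟩
    have key : ∀ z, E.Adj z (f v) → z ∈ insert (f w) (I w v) →
        J.Adj (φ z) v ∧ col z = c (φ z) ∧ col (f v) = c v := by
      intro z hzv hz
      rw [hw z hz]
      refine ⟨hwv, ?_, h.col_eq v⟩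
      rw [hcol' hzv.symm, h.col_eq, hc hwv, Bool.not_not]
    rw [Finset.insert_comm, mem_insert] at hx hy
    rcases hx with rfl | hx <;> rcases hy with rfl | hy
    · exact absurd rfl hxy.ne
    · obtain ⟨h1, h2, h3⟩ := key y hxy.symm hy
      rw [hfφ]
      exact .inr ⟨h1.symm, h3, h2⟩
    · rw [hfφ]
      exact .inr (key x hxy hx)
    · exact .inl ((hw x hx).trans (hw y hy).symm)
  · intro u v huv
    obtain ⟨x, hx, y, hy, hxc, hyc, hxy⟩ := hT.exists_adj u v huv
    exact ⟨x, y, hxy, hφT u x hx, hφT v y hy, hxc, hyc⟩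

end EarSubdivision

end SimpleGraph

/-! ### Paths as ears, and the data of the Heawood graph -/

namespace SimpleGraph

open Finset

variable {V : Type*} [DecidableEq V] {G : SimpleGraph V} {col : V → Bool}

/-- The path is peeled off two edges at a time from its start. The reversed ear is prolonged by
`snoc`, which adds vertices at the right end. -/
theorem Walk.IsPath.ear (hcol : ∀ ⦃x y⦄, G.Adj x y → col y = !col x) {s : Bool} {a b : V}
    {p : G.Walk a b} (hp : p.IsPath) (hodd : Odd p.length) (has : col a = s) :
    G.Ear col s a b ((p.support.toFinset.erase a).erase b) := by
  obtain ⟨n, hn⟩ := hodd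
  induction n generalizing a with
  | zero =>
    cases p with
    | nil => simp at hn
    | cons h q =>
      cases q with
      | nil =>
        convert Ear.of_adj hcol has h using 1
        ext x
        simp
        tauto
      | cons h' q => simp at hn
  | succ n ih =>
    cases p with
    | nil => simp at hn
    | @cons _ y _ h q =>
      cases q with
      | nil => simp at hn
      | @cons _ z _ h' q =>
        rw [Walk.cons_isPath_iff, Walk.cons_isPath_iff, Walk.support_cons, List.mem_cons,
          not_or] at hp
        obtain ⟨⟨hq, hyq⟩, hay, haq⟩ := hp
        have hcz : col z = s := by rw [hcol h', hcol h, has, Bool.not_not]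
        have hqn : q.length = 2 * n + 1 := by
          rw [Walk.length_cons, Walk.length_cons] at hn
          omega
        have hzb : z ≠ b := by
          rintro rfl
          rw [Walk.length_eq_zero_iff.2 (Walk.isPath_iff_nil.1 hq)] at hqn
          omega
        have hbq := q.end_mem_support
        have hzq := q.start_mem_support
        have h1 := ((ih hq hcz hqn).symm.snoc hcol h'.symm h.symm hzb
          (by rintro rfl; exact hyq hbq) (by rintro rfl; exact haq hbq)
          (by rintro rfl; exact haq hzq) (by simp [hyq]) (by simp [haq])).symm
        rw [Bool.not_not] at h1
        convert h1 using 1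
        ext x
        simp only [Walk.support_cons, List.toFinset_cons, mem_erase, mem_insert, List.mem_toFinset]
        constructor
        · rintro ⟨h1, h2, rfl | rfl | h3⟩
          · exact absurd rfl h2
          · simp
          · by_cases hxz : x = z
            · simp [hxz]
            · simp [hxz, h1, h3]
        · rintro (rfl | rfl | ⟨h1, h2, h3⟩)
          · exact ⟨hzb, by rintro rfl; exact haq hzq, by simp [hzq]⟩
          · exact ⟨by rintro rfl; exact hyq hbq, Ne.symm hay, by simp⟩
          · exact ⟨h1, by rintro rfl; exact haq h3, by simp [h3]⟩

theorem Subgraph.IsCentral.paired [Fintype V] {K : G.Subgraph} (hK : K.IsCentral) {U : Finset V}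
    (hU : ∀ x, x ∈ U ↔ x ∈ K.verts) : G.Paired (univ \ U) := by
  classical
  obtain ⟨M, hM⟩ := hK
  obtain ⟨m, hm, -⟩ := hM.exists_involution
  refine Paired.of_involution
    (m := fun x => if h : x ∈ K.vertsᶜ then (m ⟨x, h⟩ : V) else x) fun x hx => ?_
  have hx' : x ∈ K.vertsᶜ := by
    simp only [mem_sdiff, mem_univ, true_and, hU] at hx
    exact hx
  have h1 := hm ⟨x, hx'⟩
  have h2 := (m ⟨x, hx'⟩).2
  refine ⟨?_, ?_, ?_⟩
  · rw [dif_pos hx', mem_sdiff, hU]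
    exact ⟨mem_univ _, h2⟩
  · simp only [dif_pos hx', dif_pos h2, Subtype.coe_eta, h1.1]
  · rw [dif_pos hx']
    exact h1.2

namespace EvenSubdivision

variable {W : Type*} {J : SimpleGraph W} {c : W → Bool} {K : G.Subgraph}

theorem col_eq_not (hcol : ∀ ⦃x y⦄, G.Adj x y → col y = !col x) (S : EvenSubdivision J K.coe)
    {w v : W} (h : J.Adj w v) : col (S.f v) = !col (S.f w) := by
  have := (Walk.odd_length_of_col hcol ((S.P w v h).map K.hom)).1 (by
    rw [Walk.length_map]; exact S.odd_length w v h)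
  exact this

theorem exists_earSubdivision [Fintype V] (hcol : ∀ ⦃x y⦄, G.Adj x y → col y = !col x)
    (S : EvenSubdivision J K.coe) (hc : ∀ w, col (S.f w) = c w) {U : Finset V}
    (hU : ∀ x, x ∈ U ↔ x ∈ K.verts) :
    ∃ I, K.spanningCoe.EarSubdivision col J c U (fun w => (S.f w : V)) I := by
  classical
  let I : W → W → Finset V := fun w v => univ.filter fun x =>
    ∃ (h : J.Adj w v) (hx : x ∈ K.verts), (⟨x, hx⟩ : K.verts) ∈ (S.P w v h).support ∧
      x ≠ S.f w ∧ x ≠ S.f v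
  have hI : ∀ w v x, x ∈ I w v ↔
    ∃ (h : J.Adj w v) (hx : x ∈ K.verts), (⟨x, hx⟩ : K.verts) ∈ (S.P w v h).support ∧
      x ≠ S.f w ∧ x ≠ S.f v := fun w v x => by simp [I]
  have hcomm : ∀ w v x, x ∈ I w v → x ∈ I v w := by
    intro w v x hx
    obtain ⟨h, hxK, hxP, h1, h2⟩ := (hI w v x).1 hx
    refine (hI v w x).2 ⟨h.symm, hxK, ?_, h2, h1⟩
    rw [S.P_symm w v h, Walk.support_reverse, List.mem_reverse]
    exact hxP
  have hmem : ∀ w v (h : J.Adj w v) (x : K.verts), x ∈ (S.P w v h).support →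
      (x : V) ∈ insert (S.f w : V) (insert (S.f v : V) (I w v)) := by
    intro w v h x hx
    rw [mem_insert, mem_insert]
    by_cases h1 : (x : V) = S.f w
    · exact .inl h1
    by_cases h2 : (x : V) = S.f v
    · exact .inr (.inl h2)
    exact .inr (.inr ((hI w v x).2 ⟨h, x.2, hx, h1, h2⟩))
  let g : K.coe →g K.spanningCoe := ⟨Subtype.val, fun h => h⟩
  have hg : Function.Injective g := Subtype.val_injective
  refine ⟨I, ⟨?_, hc, ?_, ?_, ?_, ?_, ?_, ?_⟩⟩
  · exact Subtype.val_injective.comp S.f_injective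
  · exact fun w v => Finset.ext fun x => ⟨hcomm w v x, hcomm v w x⟩
  · intro w v h
    have h1 := Walk.IsPath.ear (col := col) (fun x y hxy => hcol (K.spanningCoe_le hxy))
      ((S.isPath w v h).map (f := g) hg) (by rw [Walk.length_map]; exact S.odd_length w v h) (hc w)
    suffices he : I w v = (((S.P w v h).map g).support.toFinset.erase (S.f w : V)).erase
        (S.f v : V) by rw [he]; exact h1
    ext x
    rw [hI, mem_erase, mem_erase, List.mem_toFinset, Walk.support_map, List.mem_map]
    constructor
    · rintro ⟨_, hxK, hxP, h1, h2⟩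
      exact ⟨h2, h1, ⟨x, hxK⟩, hxP, rfl⟩
    · rintro ⟨h2, h1, y, hy, rfl⟩
      exact ⟨h, y.2, hy, h1, h2⟩
  · intro w v h u hu
    obtain ⟨_, _, h1, h2, h3⟩ := (hI _ _ _).1 hu
    rcases S.end_of_mem w v h u h1 with rfl | rfl
    · exact h2 rfl
    · exact h3 rfl
  · intro w v w' v' h h' hne
    rw [Finset.disjoint_left]
    intro x hx hx'
    obtain ⟨_, hxK, h1, h2, h3⟩ := (hI _ _ _).1 hx
    obtain ⟨_, _, h1', -, -⟩ := (hI _ _ _).1 hx'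
    obtain ⟨u, hu, rfl | rfl, -⟩ := S.disjoint w v h w' v' h' hne ⟨x, hxK⟩ h1 h1'
    · exact h2 (congrArg Subtype.val hu)
    · exact h3 (congrArg Subtype.val hu)
  · intro x
    rw [hU]
    constructor
    · intro hx
      rcases S.verts_cover ⟨x, hx⟩ with ⟨w, hw⟩ | ⟨w, v, h, hxP⟩
      · exact .inl ⟨w, congrArg Subtype.val hw⟩
      · have := hmem w v h _ hxP
        rw [mem_insert, mem_insert] at this
        rcases this with h1 | h1 | h1
        · exact .inl ⟨w, h1.symm⟩
        · exact .inl ⟨v, h1.symm⟩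
        · exact .inr ⟨w, v, h, h1⟩
    · rintro (⟨w, rfl⟩ | ⟨w, v, -, hx⟩)
      · exact (S.f w).2
      · obtain ⟨_, hxK, -⟩ := (hI _ _ _).1 hx
        exact hxK
  · intro x y hxy
    have hxy' : K.coe.Adj ⟨x, K.edge_vert hxy⟩ ⟨y, K.edge_vert hxy.symm⟩ := hxy
    obtain ⟨w, v, h, he⟩ := S.edges_cover _ ((mem_edgeSet _).2 hxy')
    exact ⟨w, v, h, hmem w v h _ (Walk.fst_mem_support_of_mem_edges _ he),
      hmem w v h _ (Walk.snd_mem_support_of_mem_edges _ he)⟩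

end EvenSubdivision

theorem heawoodGraph_exists_two_neighbors : ∀ w, ∃ v₁ v₂, heawoodGraph.Adj w v₁ ∧
    heawoodGraph.Adj w v₂ ∧ v₁ ≠ v₂ := by
  decide +kernel

theorem heawoodGraph_exists_ne : ∀ (s : Bool) (w v : ZMod 7 ⊕ ZMod 7), heawoodGraph.Adj w v →
    ∃ u, Sum.isLeft u = s ∧ u ≠ w ∧ u ≠ v := by
  decide +kernel

/-- The perfect matching of the Heawood graph that joins the point `l + d` to the line `l` for
every `l`, switched such that it still covers all vertices but the point `p` and the line `l`
after their removal. -/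
def heawoodMatching (p l d : ZMod 7) : ZMod 7 ⊕ ZMod 7 → ZMod 7 ⊕ ZMod 7
  | .inl q => .inr (if q = l + d then p - d else q - d)
  | .inr k => .inl (if k = p - d then l + d else k + d)

/-- The former partners `l + d` and `p - d` must be incident, or already be `p` and `l`. A suitable
`d` exists because every residue modulo 7 is `e - 2 * d` for some `d, e` in `{0, 1, 3}`. -/
theorem heawoodGraph_exists_heawoodMatching : ∀ p l, ∃ d, ∀ x ∈ univ \ {Sum.inl p, Sum.inr l},
    heawoodMatching p l d x ∈ univ \ {Sum.inl p, Sum.inr l} ∧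
    heawoodMatching p l d (heawoodMatching p l d x) = x ∧
    heawoodGraph.Adj x (heawoodMatching p l d x) := by
  decide +kernel

theorem heawoodGraph_paired (u v : ZMod 7 ⊕ ZMod 7) (h : v.isLeft = !u.isLeft) :
    heawoodGraph.Paired (univ \ {u, v}) := by
  have key : ∀ p l, heawoodGraph.Paired (univ \ {Sum.inl p, Sum.inr l}) := fun p l => by
    obtain ⟨d, hd⟩ := heawoodGraph_exists_heawoodMatching p l
    exact Paired.of_involution hd
  rcases u with p | l <;> rcases v with p' | l'
  · simp at h
  · exact key p l'
  · rw [Finset.pair_comm]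
    exact key p' l
  · simp at h

/-- A common neighbour with the point `0` forces the colour of every point, and then that of every
line. -/
theorem eq_isLeft_of_adj {g : ZMod 7 ⊕ ZMod 7 → Bool}
    (hg : ∀ w v, heawoodGraph.Adj w v → g v = !g w) (h₀ : g (.inl 0) = true) (w) :
    g w = w.isLeft := by
  have key : ∀ p, g (.inl p) = true := fun p => by
    obtain ⟨w, h1, h2⟩ := heawoodGraph_exists_common_neighbor (.inl p) (.inl 0) rfl
    have h3 := (hg _ _ h1).symm.trans (hg _ _ h2)
    rw [h₀] at h3
    simpa using h3
  rcases w with p | l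
  · exact key p
  · obtain ⟨v, hv⟩ := heawoodGraph_exists_adj (.inr l)
    rcases v with p | l'
    · rw [hg _ _ hv.symm, key]
      rfl
    · have := heawoodGraph_isLeft hv
      simp at this

theorem IsBipartite.exists_col (h : G.IsBipartite) (x₀ : V) :
    ∃ col : V → Bool, (∀ ⦃x y⦄, G.Adj x y → col y = !col x) ∧ col x₀ = true := by
  obtain ⟨C⟩ := h
  have hC : ∀ ⦃x y⦄, G.Adj x y → (C x = C x₀ ↔ C y ≠ C x₀) := by
    intro x y hxy
    have := C.valid hxy
    omega
  refine ⟨fun x => decide (C x = C x₀), fun x y hxy => ?_, by simp⟩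
  have := hC hxy
  by_cases h1 : C x = C x₀ <;> by_cases h2 : C y = C x₀ <;> simp_all

end SimpleGraph

theorem mainTheorem6 {V : Type*} [Finite V] (G : SimpleGraph V) (hconn : G.Connected)
    (hbrace : G.IsBrace) (hHeawood : G.ContainsEvenly heawoodGraph)
    (hK33 : ¬ G.ContainsEvenly (completeBipartiteGraph (Fin 3) (Fin 3))) :
    Nonempty (G ≃g heawoodGraph) := by
  classical
  have := Fintype.ofFinite V
  obtain ⟨K, hK, ⟨S⟩⟩ := hHeawood
  -- The colouring is normalized at the image of the point `0`, so that on all branch vertices it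
  -- agrees with the distinction between points and lines.
  obtain ⟨col, hcol, h₀⟩ := hbrace.1.exists_col (S.f (.inl 0) : V)
  have hc : ∀ w, col (S.f w) = Sum.isLeft w :=
    SimpleGraph.eq_isLeft_of_adj (fun w v h => S.col_eq_not hcol h) h₀
  have hU : ∀ x, x ∈ (Finset.univ.filter fun x => x ∈ K.verts) ↔ x ∈ K.verts := by simp
  obtain ⟨I, hI⟩ := S.exists_earSubdivision hcol hc hU
  obtain ⟨φ, hφ⟩ := hI.exists_tightPartition hcol SimpleGraph.heawoodGraph_isLeft K.spanningCoe_le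
    SimpleGraph.heawoodGraph_paired SimpleGraph.heawoodGraph_exists_adj
    SimpleGraph.heawoodGraph_exists_ne (hK.paired hU)
  obtain ⟨φ, hφ⟩ := hφ.exists_univ hcol hbrace.2 hconn hK33
  exact hφ.nonempty_iso hcol hbrace.2 SimpleGraph.heawoodGraph_isLeft
    SimpleGraph.heawoodGraph_exists_two_neighbors
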